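/- Let $\sigma\in\{1,-1\}$ and consider charged-particle motion in the slab magnetic field $\mathbf B=(1+y)\,e_z$ in the region $y>-1$, with $x$ being $2\pi$-periodic: $\dot v_x=\sigma v_y(1+y)$, $\dot v_y=-\sigma v_x(1+y)$, $\dot x=\epsilon v_x$, $\dot y=\epsilon v_y$. These equations are Hamiltonian for $H=\tfrac12\epsilon^2(v_x^2+v_y^2)$ and $\omega=-d\vartheta$, $\vartheta=\epsilon(v_x\,dx+v_y\,dy)-\sigma(y+y^2/2)\,dx$. Put $r=\sqrt{v_x^2+v_y^2}$, $Y=-p_x/\sigma$ with $p_x=\epsilon v_x-\sigma(y+y^2/2)$, and $$J_1(r,Y)=\epsilon\,\sigma\,r\,(1+2Y)^{1/2}\,\frac1{2\pi}\int_0^{2\pi}\Bigl(1+\frac{2\sigma\epsilon r}{1+2Y}\cos\zeta\Bigr)^{1/2}\cos\zeta\,d\zeta .$$ (1) For $\epsilon,r>0$ with $2\epsilon r<1+2Y$, the level set of $(r,Y)$ in $y>-1$ is invariant under the motion and equals $\{\Gamma(x,\zeta)\}$, where $\Gamma(x,\zeta)$ is the point with coordinates $x$, $y=-1+(1+2Y)^{1/2}\bigl(1+\frac{2\sigma\epsilon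 r}{1+2Y}\cos\zeta\bigr)^{1/2}$, $v_x=r\cos\zeta$, $v_y=-r\sin\zeta$; and $J_1(r,Y)=\frac1{2\pi}\oint_{\gamma_1}\vartheta$ for the cyclotron cycle $\gamma_1(\zeta)=\Gamma(0,\sigma\zeta)$, $0\le\zeta\le2\pi$. (2) For every $\epsilon>0$, $J_1$ is an exact constant of motion. (3) A roto-rate is a formal power series $\mathcal R=\sum_k\epsilon^k\mathcal R_k$ of smooth vector fields on the region $y>-1$ which commutes with the vector field of the equations of motion to all orders in $\epsilon$, all of whose (formal) integral curves are $2\pi$-periodic to all orders in $\epsilon$, and whose term of order $\epsilon^0$ is $\mathcal R_0=\sigma(v_y\partial_{v_x}-v_x\partial_{v_y})$. Kruskal's adiabatic invariant series is the formal power series $\mu=\sum_k\epsilon^k\mu_k$ whose value at a point is $\frac1{2\pi}\oint\vartheta$ over the closed integral curve of $\mathcal R$ through this point. The roto-rate $\mathcal R$ and the series $\mu$ exist and are unique, all $\mu_k$ are smooth, $\iota_{\mathcal R}\omega=d\mu$ to all orders in $\epsilon$, and the power series of $J_1$ in $\epsilon$ agrees with $\mu$ to all orders: each compact subset of the region $y>-1$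 of the phase space has a $\rho>0$ such that $J_1=\sum_k\epsilon^k\mu_k$ (a convergent series) at all its points for $|\epsilon|<\rho$, where $J_1$ is regarded as a function of $\epsilon$ and the phase space point through $r$ and $Y$. -/

import Mathlib

open scoped Topology ContDiff

namespace Slab

/-- Points `(x, y, v_x, v_y)` of the phase space, with the `2π`-periodic coordinate `x` lifted
to the real line. -/
abbrev Phase : Type := Fin 4 → ℝ

/-- The part `y > -1` of the phase space, where the magnetic field `1 + y` is positive. -/
def region : Set Phase := {z | -1 < z 1}

/-- The Lorentz force vector field in the magnetic field `(1 + y) e_z`, for the sign of charge `σ`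
and the ordering parameter `ε`. -/
def field (σ ε : ℝ) (z : Phase) : Phase :=
  ![ε * z 2, ε * z 3, σ * z 3 * (1 + z 1), -(σ * z 2 * (1 + z 1))]

/-- The Liouville 1-form `ε (v_x dx + v_y dy) - σ (y + y²/2) dx` at `z`, applied to the tangent
vector `u`. -/
noncomputable def liouville (σ ε : ℝ) (z u : Phase) : ℝ :=
  ε * (z 2 * u 0 + z 3 * u 1) - σ * (z 1 + z 1 ^ 2 / 2) * u 0

/-- The 2-form `ω = -dϑ` at `z`, applied to the tangent vectors `u` and `w`, where `ϑ` is the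
Liouville 1-form. -/
noncomputable def omega (σ ε : ℝ) (z u w : Phase) : ℝ :=
  -(fderiv ℝ (fun p => liouville σ ε p w) z u - fderiv ℝ (fun p => liouville σ ε p u) z w)

/-- The canonical `x`-momentum `p_x`. -/
noncomputable def momentum (σ ε : ℝ) (z : Phase) : ℝ :=
  ε * z 2 - σ * (z 1 + z 1 ^ 2 / 2)

/-- The conserved quantity `r`, the speed. -/
noncomputable def speed (z : Phase) : ℝ := Real.sqrt (z 2 ^ 2 + z 3 ^ 2)

/-- The conserved quantity `Y = -p_x / σ`. -/
noncomputable def centerY (σ ε : ℝ) (z : Phase) : ℝ := -momentum σ ε z / σ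

/-- The action variable `J₁` as a function of `(r, Y)`. -/
noncomputable def action (σ ε r Y : ℝ) : ℝ :=
  ε * σ * r * Real.sqrt (1 + 2 * Y) * ((2 * Real.pi)⁻¹ *
    ∫ ζ in (0 : ℝ)..(2 * Real.pi),
      Real.sqrt (1 + 2 * σ * ε * r / (1 + 2 * Y) * Real.cos ζ) * Real.cos ζ)

/-- The action variable `J₁` as a function on phase space. -/
noncomputable def actionAt (σ ε : ℝ) (z : Phase) : ℝ :=
  action σ ε (speed z) (centerY σ ε z)

/-- The level set of the constants of motion `(r, Y)` in the region `y > -1`. -/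
def levelSet (σ ε r Y : ℝ) : Set Phase :=
  {z | z ∈ region ∧ speed z = r ∧ centerY σ ε z = Y}

/-- The parameterization `(x, ζ) ↦ Γ(x, ζ | r, Y)` of the level set, in the coordinates
`(x, y, v_x, v_y)`. -/
noncomputable def torus (σ ε r Y x ζ : ℝ) : Phase :=
  ![x,
    -1 + Real.sqrt (1 + 2 * Y) * Real.sqrt (1 + 2 * σ * ε * r / (1 + 2 * Y) * Real.cos ζ),
    r * Real.cos ζ,
    -(r * Real.sin ζ)]

/-- The cyclotron cycle `γ₁(ζ | r, Y) = Γ(0, σ ζ | r, Y)`. -/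
noncomputable def cycle (σ ε r Y ζ : ℝ) : Phase := torus σ ε r Y 0 (σ * ζ)

/-- The integral of the Liouville 1-form over `γ` restricted to `[0, 2π]`, divided by `2π`. -/
noncomputable def loopAction (σ ε : ℝ) (γ : ℝ → Phase) : ℝ :=
  (2 * Real.pi)⁻¹ * ∫ t in (0 : ℝ)..(2 * Real.pi), liouville σ ε (γ t) (deriv γ t)

/-- `γ` solves the equations of motion on the set of times `s`. -/
def IsMotionOn (σ ε : ℝ) (γ : ℝ → Phase) (s : Set ℝ) : Prop :=
  ∀ t ∈ s, HasDerivWithinAt γ (field σ ε (γ t)) s t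

section FormalSeries

variable {E : Type*} [NormedAddCommGroup E] [NormedSpace ℝ E]

/-- The partial sum `a₀ + ε a₁ + ⋯ + ε^k a_k` of a formal power series in `ε`. -/
noncomputable def partialSum (a : ℕ → E) (k : ℕ) (ε : ℝ) : E :=
  ∑ i ∈ Finset.range (k + 1), ε ^ i • a i

/-- `f` and `g` agree modulo `O(ε^n)` as `ε → 0`. -/
def EqMod (n : ℕ) (f g : ℝ → E) : Prop :=
  (fun ε => f ε - g ε) =O[𝓝 (0 : ℝ)] (fun ε => ε ^ n)

end FormalSeries

/-- The partial sum of order `k` of a formal power series of vector fields. -/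
noncomputable def partialField (R : ℕ → Phase → Phase) (k : ℕ) (ε : ℝ) (z : Phase) : Phase :=
  partialSum (fun i => R i z) k ε

/-- The partial sum of order `k` of a formal power series of curves. -/
noncomputable def partialCurve (c : ℕ → ℝ → Phase) (k : ℕ) (ε t : ℝ) : Phase :=
  partialSum (fun i => c i t) k ε

/-- `c = ∑ ε^k c_k` is an integral curve in `y > -1` of the formal vector field
`R = ∑ ε^k R_k`: the equation `ċ = R(c)` holds to every order in `ε`. -/
structure IsFormalIntegralCurve (R : ℕ → Phase → Phase) (c : ℕ → ℝ → Phase) : Prop where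
  smooth : ∀ k, ContDiff ℝ 1 (c k)
  mem : ∀ t, c 0 t ∈ region
  eqn : ∀ k t, EqMod (k + 1) (fun ε => deriv (partialCurve c k ε) t)
    (fun ε => partialField R k ε (partialCurve c k ε t))

/-- The limiting roto-rate `σ (v_y ∂_{v_x} - v_x ∂_{v_y})`. -/
def limitingRotoRate (σ : ℝ) (z : Phase) : Phase := ![0, 0, σ * z 3, -(σ * z 2)]

/-- `R = ∑ ε^k R_k` is a roto-rate: a formal power series of smooth vector fields
on the region `y > -1` (`2π`-periodic in `x`), which commutes with the Lorentz force vector field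
to every order in `ε`, all of whose integral curves are `2π`-periodic to every order in `ε`, and
which tends to the limiting roto-rate as `ε → 0`. -/
structure IsRotoRate (σ : ℝ) (R : ℕ → Phase → Phase) : Prop where
  smooth : ∀ k, ContDiffOn ℝ ∞ (R k) region
  periodic_x : ∀ k, ∀ z ∈ region, R k (z + ![2 * Real.pi, 0, 0, 0]) = R k z
  commutes : ∀ k, ∀ z ∈ region,
    EqMod (k + 1) (fun ε => VectorField.lieBracket ℝ (partialField R k ε) (field σ ε) z)
      (fun _ => 0)
  periodic : ∀ c, IsFormalIntegralCurve R c → ∀ k t, c k (t + 2 * Real.pi) = c k t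
  limit : ∀ z ∈ region, R 0 z = limitingRotoRate σ z

/-- `μ = ∑ ε^k μ_k` is Kruskal's adiabatic invariant series for the roto-rate `R`: to every order
in `ε`, its value at `z` is the action (the integral of the Liouville 1-form divided by `2π`) of
the closed integral curve of `R` through `z`. -/
def IsKruskalSeries (σ : ℝ) (R : ℕ → Phase → Phase) (μ : ℕ → Phase → ℝ) : Prop :=
  ∀ z ∈ region, ∀ c, IsFormalIntegralCurve R c → c 0 0 = z → (∀ k, c (k + 1) 0 = 0) →
    ∀ k, EqMod (k + 1) (fun ε => loopAction σ ε (partialCurve c k ε))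
      (fun ε => partialSum (fun i => μ i z) k ε)

/-- The formal vector field `R` is Hamiltonian on `y > -1` with the smooth formal Hamiltonian `μ`:
`ω(R, ·) = dμ` to every order in `ε`. -/
def IsHamiltonianSeries (σ : ℝ) (R : ℕ → Phase → Phase) (μ : ℕ → Phase → ℝ) : Prop :=
  (∀ k, ContDiffOn ℝ ∞ (μ k) region) ∧
  ∀ k, ∀ z ∈ region, ∀ w : Phase,
    EqMod (k + 1) (fun ε => omega σ ε z (partialField R k ε z) w)
      (fun ε => partialSum (fun i => fderiv ℝ (μ i) z w) k ε)

end Slab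

/-! The system is integrable: the speed `r` and `Y` are conserved, everything is invariant under
translations of `x`, and on a torus the motion only advances the gyro-angle, at the rate `1 + y`.
Hence the roto-rate has a closed form. Let `Q_s` be the squared magnetic field at the point of the
same torus whose velocity is turned by the angle `s`, with `v_s` the turned `x`-velocity. Let `A` be
the mean of `1/√Q` over `s`, and `B` be `-ε` times the mean of `v/√Q`. Then `exactRotoRate` is `A`
times the Lorentz field plus `B ∂_x`: the factor `A` makes the gyration period `2π`, and `B` cancels
the drift in `x` over one period. Since `A` and `B` are constants of motion independent of `x`, this
field commutes with the Lorentz field (`lieBracket_exactRotoRate`); an integration by parts over `s`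
gives `ω(R, ·) = dJ₁` (`omega_exactRotoRate`). Everything is smooth in `(ε, z)` near `ε = 0`, so
iterated Hadamard division turns it into formal series with smooth coefficients.

A formal integral curve is not an orbit, but its truncations satisfy the exact equation up to a
uniform `O(ε^(k+1))`. The map `normalCoords` conjugates the exact roto-rate to the rigid rotation of
the velocity, so truncated curves almost close up; injectivity of its derivative at `ε = 0` makes
the coefficients themselves periodic, one order at a time (`apply_two_pi_of_formalIntegralCurve`).
For the loop action, `p_x` is almost constant and `x` returns, so only the integral of `ε v_y dy`
counts; its rate differs from `J₁` by the derivative of `actionShift` along the roto-rate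
(`eqMod_loopAction`).

Uniqueness is a resonance argument. At the first order where two roto-rates differ, the difference
`D` commutes with the leading Lorentz field, hence with rotations of the velocity
(`apply_rot_of_lieBracket_eq_zero`). It then drives the difference of the formal integral curves
resonantly, by `2π D` per turn, which periodicity excludes (`IsRotoRate.unique`). Thus any roto-rate
and Kruskal series agree with the constructed ones.

For convergence, the square root in `J₁` is expanded in its binomial series and integrated term by
term (`hasSum_actionCoeff`); a convergent series is also asymptotic, so its coefficients are the
`μ_k`. -/

namespace Slab

open Set Filter Asymptotics MeasureTheory

/-! ### Smooth dependence of integrals on parameters -/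

section ParametricIntegral

variable {V E : Type} [NormedAddCommGroup V] [NormedSpace ℝ V]
  [NormedAddCommGroup E] [NormedSpace ℝ E]

/-- Differentiation under an interval integral whose integrand is smooth near the segment of
integration. -/
theorem hasFDerivAt_parametricIntegral {O : Set (ℝ × V)} (hO : IsOpen O)
    {f : ℝ × V → E} (hf : ContDiffOn ℝ ∞ f O) {a b : ℝ} {w₀ : V}
    (h : ∀ s ∈ uIcc a b, (s, w₀) ∈ O) :
    HasFDerivAt (fun w => ∫ s in a..b, f (s, w))
      (∫ s in a..b, (fderiv ℝ f (s, w₀)).comp (ContinuousLinearMap.inr ℝ ℝ V)) w₀ := by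
  have hfd : ContinuousOn (fun p => (fderiv ℝ f p).comp (ContinuousLinearMap.inr ℝ ℝ V)) O :=
    ((hf.continuousOn_fderiv_of_isOpen hO (by simp))).clm_comp continuousOn_const
  obtain ⟨M, hM⟩ : ∃ M, ∀ s ∈ uIcc a b,
      ‖(fderiv ℝ f (s, w₀)).comp (ContinuousLinearMap.inr ℝ ℝ V)‖ ≤ M := by
    have : ContinuousOn (fun s : ℝ => (fderiv ℝ f (s, w₀)).comp (ContinuousLinearMap.inr ℝ ℝ V))
        (uIcc a b) :=
      hfd.comp (f := fun s : ℝ => (s, w₀)) (by fun_prop) (fun s hs => h s hs)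
    exact isCompact_uIcc.exists_bound_of_continuousOn this
  -- Compactness of the segment yields one neighbourhood of `w₀` that serves all `s` at once, so the
  -- constant `M + 1` can dominate the derivative.
  have key : ∀ᶠ w in 𝓝 w₀, ∀ s ∈ uIcc a b, (s, w) ∈ O ∧
      ‖(fderiv ℝ f (s, w)).comp (ContinuousLinearMap.inr ℝ ℝ V)‖ ≤ M + 1 := by
    apply isCompact_uIcc.eventually_forall_of_forall_eventually
    intro s hs
    have hcont : Tendsto (fun z : V × ℝ => (z.2, z.1)) (𝓝 (w₀, s)) (𝓝 (s, w₀)) :=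
      (continuous_snd.prodMk continuous_fst).tendsto _
    have h1 : ∀ᶠ p in 𝓝 (s, w₀), p ∈ O := hO.mem_nhds (h s hs)
    have h2 : ∀ᶠ p in 𝓝 (s, w₀),
        ‖(fderiv ℝ f p).comp (ContinuousLinearMap.inr ℝ ℝ V)‖ < M + 1 :=
      (hfd.continuousAt (hO.mem_nhds (h s hs))).norm.eventually_lt_const
        (lt_of_le_of_lt (hM s hs) (by linarith))
    filter_upwards [hcont.eventually h1, hcont.eventually h2] with z hz1 hz2
    exact ⟨hz1, hz2.le⟩
  obtain ⟨S, hS, hSO⟩ := Filter.eventually_iff_exists_mem.1 key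
  have hcontf : ∀ w ∈ S, ContinuousOn (fun s => f (s, w)) (uIcc a b) := fun w hw =>
    hf.continuousOn.comp (f := fun s : ℝ => (s, w)) (by fun_prop) (fun s hs => (hSO w hw s hs).1)
  refine intervalIntegral.hasFDerivAt_integral_of_dominated_of_fderiv_le
    (μ := volume) (F := fun w s => f (s, w))
    (F' := fun w s => (fderiv ℝ f (s, w)).comp (ContinuousLinearMap.inr ℝ ℝ V))
    (bound := fun _ => M + 1) hS ?_ ?_ ?_ ?_ ?_ ?_
  · filter_upwards [hS] with w hw
    exact ((hcontf w hw).mono uIoc_subset_uIcc).aestronglyMeasurable measurableSet_uIoc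
  · exact (hcontf w₀ (mem_of_mem_nhds hS)).intervalIntegrable
  · have : ContinuousOn (fun s : ℝ => (fderiv ℝ f (s, w₀)).comp (ContinuousLinearMap.inr ℝ ℝ V))
        (uIcc a b) :=
      hfd.comp (f := fun s : ℝ => (s, w₀)) (by fun_prop) (fun s hs => h s hs)
    exact (this.mono uIoc_subset_uIcc).aestronglyMeasurable measurableSet_uIoc
  · exact Eventually.of_forall fun s hs w hw => (hSO w hw s (uIoc_subset_uIcc hs)).2
  · exact intervalIntegrable_const
  · refine Eventually.of_forall fun s hs w hw => ?_
    have hd : HasFDerivAt f (fderiv ℝ f (s, w)) (s, w) :=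
      ((hf.contDiffAt (hO.mem_nhds (hSO w hw s (uIoc_subset_uIcc hs)).1)).differentiableAt
        (by simp)).hasFDerivAt
    exact hd.comp w (hasFDerivAt_prodMk_right s w)

/-- An interval integral depends smoothly on parameters if the integrand does. -/
theorem contDiffOn_parametricIntegral {O : Set (ℝ × V)} (hO : IsOpen O)
    {f : ℝ × V → E} (hf : ContDiffOn ℝ ∞ f O) {a b : ℝ} {W : Set V} (hW : IsOpen W)
    (h : ∀ w ∈ W, ∀ s ∈ uIcc a b, (s, w) ∈ O) :
    ContDiffOn ℝ ∞ (fun w => ∫ s in a..b, f (s, w)) W := by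
  rw [contDiffOn_infty]
  intro n
  induction n generalizing E with
  | zero =>
    rw [Nat.cast_zero, contDiffOn_zero]
    exact fun w hw =>
      (hasFDerivAt_parametricIntegral hO hf (h w hw)).continuousAt.continuousWithinAt
  | succ n ih =>
    rw [Nat.cast_succ, contDiffOn_succ_iff_fderiv_of_isOpen hW]
    refine ⟨fun w hw => (hasFDerivAt_parametricIntegral hO hf
      (h w hw)).differentiableAt.differentiableWithinAt, by simp, ?_⟩
    -- The derivative is again a parametric integral, now with values in linear maps; this is why
    -- the induction generalizes over `E`.
    have hfd : ContDiffOn ℝ ∞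
        (fun p => (fderiv ℝ f p).comp (ContinuousLinearMap.inr ℝ ℝ V)) O :=
      (hf.fderiv_of_isOpen hO (by simp)).clm_comp contDiffOn_const
    refine (ih hfd).congr fun w hw => ?_
    exact (hasFDerivAt_parametricIntegral hO hf (h w hw)).fderiv

end ParametricIntegral

/-! ### Congruence modulo powers of `ε` -/

section EqMod

variable {E : Type} [NormedAddCommGroup E]

theorem EqMod.refl (n : ℕ) (f : ℝ → E) : EqMod n f f := by
  simp only [EqMod, sub_self]
  exact isBigO_zero _ _

theorem EqMod.symm {n : ℕ} {f g : ℝ → E} (h : EqMod n f g) : EqMod n g f := by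
  have := h.neg_left
  simpa [EqMod] using this

theorem EqMod.trans {n : ℕ} {f g k : ℝ → E} (h : EqMod n f g) (h' : EqMod n g k) :
    EqMod n f k := by
  have := IsBigO.add h h'
  simpa [EqMod] using this

theorem EqMod.add {n : ℕ} {f g f' g' : ℝ → E} (h : EqMod n f g) (h' : EqMod n f' g') :
    EqMod n (fun ε => f ε + f' ε) (fun ε => g ε + g' ε) := by
  exact (IsBigO.add h h').congr_left fun ε => (add_sub_add_comm _ _ _ _).symm

theorem EqMod.sub {n : ℕ} {f g f' g' : ℝ → E} (h : EqMod n f g) (h' : EqMod n f' g') :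
    EqMod n (fun ε => f ε - f' ε) (fun ε => g ε - g' ε) := by
  exact (IsBigO.sub h h').congr_left fun ε => sub_sub_sub_comm _ _ _ _

theorem EqMod.congr' {n : ℕ} {f g f' g' : ℝ → E} (h : EqMod n f g) (hf : f =ᶠ[𝓝 0] f')
    (hg : g =ᶠ[𝓝 0] g') : EqMod n f' g' := by
  refine IsBigO.congr' h ?_ EventuallyEq.rfl
  filter_upwards [hf, hg] with ε h1 h2
  rw [h1, h2]

theorem EqMod.of_eventuallyEq {n : ℕ} {f g : ℝ → E} (h : f =ᶠ[𝓝 0] g) : EqMod n f g :=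
  (EqMod.refl n f).congr' EventuallyEq.rfl h

theorem EqMod.mono {n m : ℕ} (hmn : m ≤ n) {f g : ℝ → E} (h : EqMod n f g) : EqMod m f g := by
  refine IsBigO.trans h ?_
  obtain ⟨j, rfl⟩ := Nat.exists_eq_add_of_le hmn
  simp_rw [pow_add]
  have h1 : (fun ε : ℝ => ε ^ m * ε ^ j) =O[𝓝 0] (fun ε : ℝ => ε ^ m * (1 : ℝ)) :=
    (isBigO_refl _ _).mul
      (((continuous_pow j).continuousAt : ContinuousAt (fun ε : ℝ => ε ^ j) 0).isBigO_one ℝ)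
  simpa using h1

end EqMod

/-! ### Expansion in `ε` by iterated Hadamard division -/

section Expansion

variable {P E : Type} [NormedAddCommGroup P] [NormedSpace ℝ P]
  [NormedAddCommGroup E] [NormedSpace ℝ E]

/-- The quotient `(g (ε, z) - g (0, z)) / ε` of Hadamard's lemma. -/
noncomputable def hadamard (g : ℝ × P → E) (p : ℝ × P) : E :=
  ∫ s in (0 : ℝ)..1, fderiv ℝ g (s * p.1, p.2) (1, 0)

/-- The coefficient of `ε ^ k` in the expansion of `g (ε, z)` at `ε = 0`. -/
noncomputable def jet (k : ℕ) (g : ℝ × P → E) (z : P) : E := hadamard^[k] g (0, z)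

/-- A set of pairs `(ε, z)` which contains with each point its segment to `(0, z)`. -/
def StarInFst (U : Set (ℝ × P)) : Prop :=
  ∀ p ∈ U, ∀ s ∈ Icc (0 : ℝ) 1, (s * p.1, p.2) ∈ U

theorem contDiffOn_hadamard {U : Set (ℝ × P)} (hU : IsOpen U) (hs : StarInFst U)
    {g : ℝ × P → E} (hg : ContDiffOn ℝ ∞ g U) : ContDiffOn ℝ ∞ (hadamard g) U := by
  have hm : ContDiff ℝ ∞ (fun q : ℝ × (ℝ × P) => (q.1 * q.2.1, q.2.2)) := by fun_prop
  have hO : IsOpen ((fun q : ℝ × (ℝ × P) => (q.1 * q.2.1, q.2.2)) ⁻¹' U) :=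
    hU.preimage hm.continuous
  have hf : ContDiffOn ℝ ∞ (fun q : ℝ × (ℝ × P) => fderiv ℝ g (q.1 * q.2.1, q.2.2) (1, 0))
      ((fun q : ℝ × (ℝ × P) => (q.1 * q.2.1, q.2.2)) ⁻¹' U) :=
    ((hg.fderiv_of_isOpen hU (by simp)).comp hm.contDiffOn
      (fun q hq => hq)).clm_apply contDiffOn_const
  refine contDiffOn_parametricIntegral hO hf hU fun w hw s hs' => ?_
  rw [uIcc_of_le zero_le_one] at hs'
  exact hs w hw s hs'

/-- The fundamental theorem of calculus along the segment from `(0, z)` to `(ε, z)`, which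
`StarInFst` keeps inside `U`. -/
theorem hadamard_spec [CompleteSpace E] {U : Set (ℝ × P)} (hU : IsOpen U) (hs : StarInFst U)
    {g : ℝ × P → E} (hg : ContDiffOn ℝ ∞ g U) {p : ℝ × P} (hp : p ∈ U) :
    g p = g (0, p.2) + p.1 • hadamard g p := by
  have hd : ∀ s ∈ uIcc (0 : ℝ) 1, HasDerivAt (fun s : ℝ => g (s * p.1, p.2))
      (p.1 • fderiv ℝ g (s * p.1, p.2) (1, 0)) s := by
    intro s hs'
    rw [uIcc_of_le zero_le_one] at hs'
    have h1 : HasFDerivAt g (fderiv ℝ g (s * p.1, p.2)) (s * p.1, p.2) :=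
      ((hg.contDiffAt (hU.mem_nhds (hs p hp s hs'))).differentiableAt (by simp)).hasFDerivAt
    have h2 : HasDerivAt (fun s : ℝ => (s * p.1, p.2)) (p.1 • ((1 : ℝ), (0 : P))) s := by
      have := ((hasDerivAt_id s).mul_const p.1).prodMk (hasDerivAt_const s p.2)
      simpa using this
    have := h1.comp_hasDerivAt s h2
    rwa [map_smul] at this
  have hc : ContinuousOn (fun s : ℝ => fderiv ℝ g (s * p.1, p.2) (1, 0)) (uIcc (0 : ℝ) 1) := by
    have := (hg.continuousOn_fderiv_of_isOpen hU (by simp)).clm_apply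
      (continuousOn_const (c := ((1 : ℝ), (0 : P))))
    refine this.comp (f := fun s : ℝ => (s * p.1, p.2)) (by fun_prop) fun s hs' => ?_
    rw [uIcc_of_le zero_le_one] at hs'
    exact hs p hp s hs'
  have := intervalIntegral.integral_eq_sub_of_hasDerivAt hd
    (hc.const_smul p.1).intervalIntegrable
  rw [intervalIntegral.integral_smul] at this
  simp only [one_mul, zero_mul] at this
  rw [hadamard, this]
  simp

theorem contDiffOn_iterate_hadamard {U : Set (ℝ × P)} (hU : IsOpen U) (hs : StarInFst U)
    {g : ℝ × P → E} (hg : ContDiffOn ℝ ∞ g U) (k : ℕ) : ContDiffOn ℝ ∞ (hadamard^[k] g) U := by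
  induction k with
  | zero => exact hg
  | succ k ih =>
    rw [Function.iterate_succ_apply']
    exact contDiffOn_hadamard hU hs ih

theorem contDiffOn_jet {U : Set (ℝ × P)} (hU : IsOpen U) (hs : StarInFst U)
    {g : ℝ × P → E} (hg : ContDiffOn ℝ ∞ g U) (k : ℕ) :
    ContDiffOn ℝ ∞ (jet k g) {z | ((0 : ℝ), z) ∈ U} :=
  (contDiffOn_iterate_hadamard hU hs hg k).comp
    (contDiff_prodMk_right (0 : ℝ)).contDiffOn fun _ hz => hz

theorem partialSum_succ (a : ℕ → E) (k : ℕ) (ε : ℝ) :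
    partialSum a (k + 1) ε = partialSum a k ε + ε ^ (k + 1) • a (k + 1) := by
  simp [partialSum, Finset.sum_range_succ]

@[simp] theorem partialSum_zero (a : ℕ → E) (ε : ℝ) : partialSum a 0 ε = a 0 := by
  simp [partialSum]

/-- The expansion in powers of `ε` with a smooth remainder. -/
theorem eq_partialSum_jet [CompleteSpace E] {U : Set (ℝ × P)} (hU : IsOpen U)
    (hs : StarInFst U) {g : ℝ × P → E} (hg : ContDiffOn ℝ ∞ g U) (k : ℕ) {p : ℝ × P}
    (hp : p ∈ U) :
    g p = partialSum (fun i => jet i g p.2) k p.1 + p.1 ^ (k + 1) • hadamard^[k + 1] g p := by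
  induction k with
  | zero =>
    rw [partialSum_zero, zero_add, pow_one]
    exact hadamard_spec hU hs hg hp
  | succ k ih =>
    rw [ih, partialSum_succ, add_assoc]
    congr 1
    rw [hadamard_spec hU hs (contDiffOn_iterate_hadamard hU hs hg (k + 1)) hp, smul_add,
      smul_smul, ← pow_succ, Function.iterate_succ_apply' _ (k + 1)]
    rfl

theorem EqMod.of_smul {n : ℕ} {f g : ℝ → E} {r : ℝ → E} (hr : ContinuousAt r 0)
    (h : ∀ᶠ ε in 𝓝 0, f ε = g ε + ε ^ n • r ε) : EqMod n f g := by
  have h1 : (fun ε : ℝ => ε ^ n • r ε) =O[𝓝 0] (fun ε : ℝ => ε ^ n • (1 : ℝ)) :=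
    (isBigO_refl _ _).smul (hr.isBigO_one ℝ)
  simp only [smul_eq_mul, mul_one] at h1
  refine h1.congr' ?_ EventuallyEq.rfl
  filter_upwards [h] with ε hε
  rw [hε]; abel

theorem eqMod_partialSum_jet [CompleteSpace E] {U : Set (ℝ × P)} (hU : IsOpen U)
    (hs : StarInFst U) {g : ℝ × P → E} (hg : ContDiffOn ℝ ∞ g U) (k : ℕ) {z : P}
    (hz : ((0 : ℝ), z) ∈ U) :
    EqMod (k + 1) (fun ε => g (ε, z)) (partialSum (fun i => jet i g z) k) := by
  have hc : ContinuousAt (fun ε : ℝ => (ε, z)) 0 := by fun_prop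
  refine EqMod.of_smul (r := fun ε => hadamard^[k + 1] g (ε, z)) ?_ ?_
  · exact ContinuousAt.comp (f := fun ε : ℝ => (ε, z))
      ((contDiffOn_iterate_hadamard hU hs hg (k + 1)).continuousOn.continuousAt
        (hU.mem_nhds hz)) hc
  · filter_upwards [hc.eventually (hU.mem_nhds hz)] with ε hε
    exact eq_partialSum_jet hU hs hg k hε

/-- A polynomial of degree at most `k` in `ε` which is `O(ε ^ (k + 1))` vanishes. -/
theorem eq_zero_of_partialSum {a : ℕ → E} {k : ℕ}
    (h : EqMod (k + 1) (partialSum a k) (fun _ => 0)) : ∀ i ≤ k, a i = 0 := by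
  induction k with
  | zero =>
    intro i hi
    obtain rfl : i = 0 := by omega
    have h1 : (fun _ : ℝ => a 0) =O[𝓝 0] (fun ε : ℝ => ε) := by simpa [EqMod] using h
    have h2 : Tendsto (fun _ : ℝ => a 0) (𝓝 (0 : ℝ)) (𝓝 0) := h1.trans_tendsto tendsto_id
    exact tendsto_nhds_unique tendsto_const_nhds h2
  | succ k ih =>
    have h0 : ∀ i ≤ k, a i = 0 := by
      refine ih (EqMod.trans ?_ (h.mono (Nat.le_succ _)))
      refine EqMod.of_smul (r := fun _ => -a (k + 1)) continuousAt_const ?_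
      refine Eventually.of_forall fun ε => ?_
      rw [partialSum_succ]; simp
    intro i hi
    rcases Nat.lt_or_ge i (k + 1) with hlt | hge
    · exact h0 i (by omega)
    obtain rfl : i = k + 1 := by omega
    have hs : ∀ ε : ℝ, partialSum a (k + 1) ε = ε ^ (k + 1) • a (k + 1) := by
      intro ε
      rw [partialSum_succ, partialSum, Finset.sum_eq_zero, zero_add]
      intro j hj
      rw [h0 j (by simpa [Nat.lt_succ_iff] using hj), smul_zero]
    -- Only the top term is left. Dividing by `ε ^ (k + 1)` requires the punctured neighbourhood;
    -- the constant `a (k + 1)` is then `O(ε)`.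
    have h1 : (fun ε : ℝ => ε ^ (k + 1) • a (k + 1)) =O[𝓝[≠] 0]
        (fun ε : ℝ => ε ^ (k + 1) • ε) := by
      have := IsBigO.mono h (nhdsWithin_le_nhds (s := {0}ᶜ))
      simpa [hs, pow_succ, EqMod] using this
    have h2 : (fun _ : ℝ => a (k + 1)) =O[𝓝[≠] (0 : ℝ)] (fun ε : ℝ => ε) := by
      have h3 : (fun ε : ℝ => (ε ^ (k + 1))⁻¹ • ε ^ (k + 1) • a (k + 1)) =O[𝓝[≠] 0]
        (fun ε : ℝ => (ε ^ (k + 1))⁻¹ • ε ^ (k + 1) • ε) := (isBigO_refl _ _).smul h1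
      refine h3.congr' ?_ ?_ <;>
      · filter_upwards [self_mem_nhdsWithin] with ε hε
        rw [inv_smul_smul₀ (pow_ne_zero _ hε)]
    have h3 : Tendsto (fun _ : ℝ => a (k + 1)) (𝓝[≠] (0 : ℝ)) (𝓝 0) :=
      h2.trans_tendsto (tendsto_id.mono_left nhdsWithin_le_nhds)
    exact tendsto_nhds_unique tendsto_const_nhds h3

theorem partialSum_sub (a b : ℕ → E) (k : ℕ) (ε : ℝ) :
    partialSum (fun i => a i - b i) k ε = partialSum a k ε - partialSum b k ε := by
  simp [partialSum, smul_sub, Finset.sum_sub_distrib]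

/-- Coefficients of expansions in powers of `ε` are unique. -/
theorem eq_of_eqMod_partialSum {a b : ℕ → E} {k : ℕ}
    (h : EqMod (k + 1) (partialSum a k) (partialSum b k)) : ∀ i ≤ k, a i = b i := by
  intro i hi
  rw [← sub_eq_zero]
  refine eq_zero_of_partialSum (a := fun i => a i - b i) ?_ i hi
  simpa [EqMod, partialSum_sub] using h

/-- A smooth function which is pointwise `O(ε ^ (k + 1))` is so uniformly on compact sets. -/
theorem exists_bound_of_eqMod [CompleteSpace E] {U : Set (ℝ × P)} (hU : IsOpen U)
    (hs : StarInFst U) {g : ℝ × P → E} (hg : ContDiffOn ℝ ∞ g U) (k : ℕ) {K : Set P}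
    (hK : IsCompact K) (hKU : ∀ z ∈ K, ((0 : ℝ), z) ∈ U)
    (h : ∀ z ∈ K, EqMod (k + 1) (fun ε => g (ε, z)) (fun _ => 0)) :
    ∃ C : ℝ, ∀ᶠ ε in 𝓝 (0 : ℝ), ∀ z ∈ K, ‖g (ε, z)‖ ≤ C * |ε| ^ (k + 1) := by
  -- The pointwise hypothesis kills all coefficients up to order `k`. What remains is the Hadamard
  -- remainder, which is jointly continuous and so bounded near `{0} × K`.
  have hj : ∀ z ∈ K, ∀ i ≤ k, jet i g z = 0 := fun z hz =>
    eq_zero_of_partialSum ((eqMod_partialSum_jet hU hs hg k (hKU z hz)).symm.trans (h z hz))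
  have hc := (contDiffOn_iterate_hadamard hU hs hg (k + 1)).continuousOn
  obtain ⟨M, hM⟩ : ∃ M, ∀ z ∈ K, ‖hadamard^[k + 1] g (0, z)‖ ≤ M :=
    hK.exists_bound_of_continuousOn (hc.comp (f := fun z : P => ((0 : ℝ), z)) (by fun_prop) hKU)
  refine ⟨M + 1, ?_⟩
  -- The doubled membership survives the localization: points near `(0, z)` need not lie over `K`,
  -- but the vanishing of the coefficients is known only there.
  suffices H : ∀ᶠ ε in 𝓝 (0 : ℝ), ∀ z ∈ K, z ∈ K → ‖g (ε, z)‖ ≤ (M + 1) * |ε| ^ (k + 1) by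
    filter_upwards [H] with ε hε z hz using hε z hz hz
  apply hK.eventually_forall_of_forall_eventually
  intro z hz
  have h1 : ∀ᶠ p in 𝓝 ((0 : ℝ), z), p ∈ U := hU.mem_nhds (hKU z hz)
  have h2 : ∀ᶠ p in 𝓝 ((0 : ℝ), z), ‖hadamard^[k + 1] g p‖ < M + 1 :=
    (hc.continuousAt (hU.mem_nhds (hKU z hz))).norm.eventually_lt_const
      (lt_of_le_of_lt (hM z hz) (by linarith))
  filter_upwards [h1, h2] with p hp1 hp2 hpK
  rw [eq_partialSum_jet hU hs hg k hp1, partialSum, Finset.sum_eq_zero, zero_add, norm_smul,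
    norm_pow, Real.norm_eq_abs, mul_comm]
  · gcongr
  · intro i hi
    rw [hj p.2 hpK i (by simpa [Nat.lt_succ_iff] using hi), smul_zero]

end Expansion

/-! ### Open domains that are star-shaped in `ε` -/

section StarCore

variable {P : Type}

/-- The points `(ε, z)` whose segment to `(0, z)` lies in `O`. -/
def starCore (O : Set (ℝ × P)) : Set (ℝ × P) :=
  {p | ∀ s ∈ Icc (0 : ℝ) 1, (s * p.1, p.2) ∈ O}

theorem starCore_subset (O : Set (ℝ × P)) : starCore O ⊆ O := fun p hp => by
  simpa using hp 1 (by simp)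

theorem starInFst_starCore (O : Set (ℝ × P)) : StarInFst (starCore O) := by
  intro p hp s hs r hr
  have := hp (r * s) ⟨mul_nonneg hr.1 hs.1, mul_le_one₀ hr.2 hs.1 hs.2⟩
  simpa [mul_assoc] using this

theorem zero_mem_starCore {O : Set (ℝ × P)} {z : P} (hz : ((0 : ℝ), z) ∈ O) :
    ((0 : ℝ), z) ∈ starCore O := fun s _ => by simpa using hz

theorem isOpen_starCore [TopologicalSpace P] {O : Set (ℝ × P)} (hO : IsOpen O) :
    IsOpen (starCore O) := by
  rw [isOpen_iff_mem_nhds]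
  intro p hp
  refine isCompact_Icc.eventually_forall_of_forall_eventually fun s hs => ?_
  have hc : Continuous (fun q : (ℝ × P) × ℝ => (q.2 * q.1.1, q.1.2)) := by fun_prop
  exact hc.continuousAt.eventually (hO.mem_nhds (hp s hs))

end StarCore

/-! ### Congruences under smooth maps -/

section Expansion

variable {P E : Type} [NormedAddCommGroup P] [NormedSpace ℝ P]
  [NormedAddCommGroup E] [NormedSpace ℝ E]

/-- A `C¹` map is Lipschitz near the common limit `(0, z)`, by strict differentiability. -/
theorem EqMod.comp_contDiffAt {n : ℕ} {F : ℝ × P → E} {z : P} (hF : ContDiffAt ℝ 1 F (0, z))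
    {u v : ℝ → P} (hu : Tendsto u (𝓝 0) (𝓝 z)) (hv : Tendsto v (𝓝 0) (𝓝 z))
    (h : EqMod n u v) : EqMod n (fun ε => F (ε, u ε)) (fun ε => F (ε, v ε)) := by
  have h1 := (hF.hasStrictFDerivAt (by simp)).isBigO_sub
  have ht : Tendsto (fun ε : ℝ => ((ε, u ε), (ε, v ε))) (𝓝 0) (𝓝 (((0 : ℝ), z), ((0 : ℝ), z))) :=
    (tendsto_id.prodMk_nhds hu).prodMk_nhds (tendsto_id.prodMk_nhds hv)
  refine (h1.comp_tendsto ht).trans (IsBigO.trans ?_ h)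
  refine isBigO_of_le _ fun ε => ?_
  simp [Prod.norm_def]

theorem EqMod.pow_smul {n : ℕ} (m : ℕ) {u v : ℝ → E} (h : EqMod n u v) :
    EqMod (m + n) (fun ε => ε ^ m • u ε) (fun ε => ε ^ m • v ε) := by
  have := (isBigO_refl (fun ε : ℝ => ε ^ m) (𝓝 0)).smul h
  simpa [EqMod, smul_sub, pow_add] using this

theorem continuous_partialSum (a : ℕ → E) (k : ℕ) : Continuous (partialSum a k) := by
  unfold partialSum
  fun_prop

theorem partialSum_at_zero (a : ℕ → E) (k : ℕ) : partialSum a k 0 = a 0 := by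
  induction k with
  | zero => simp
  | succ k ih => rw [partialSum_succ, ih]; simp

theorem tendsto_partialSum (a : ℕ → E) (k : ℕ) : Tendsto (partialSum a k) (𝓝 0) (𝓝 (a 0)) := by
  have := (continuous_partialSum a k).tendsto 0
  rwa [partialSum_at_zero] at this

end Expansion

theorem isOpen_region : IsOpen region := isOpen_lt continuous_const (continuous_apply 1)

theorem zero_mem_region : (0 : Phase) ∈ region := by simp [region]

/-! ### Rotations of the velocity and variation of constants -/

section Rotation

/-- The flow of the limiting roto-rate. -/
noncomputable def rot (σ t : ℝ) (z : Phase) : Phase :=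
  ![z 0, z 1, Real.cos t * z 2 + σ * Real.sin t * z 3, Real.cos t * z 3 - σ * Real.sin t * z 2]

theorem limitingRotoRate_add (σ : ℝ) (z w : Phase) :
    limitingRotoRate σ (z + w) = limitingRotoRate σ z + limitingRotoRate σ w := by
  ext i; fin_cases i <;> simp [limitingRotoRate] <;> ring

theorem limitingRotoRate_sub (σ : ℝ) (z w : Phase) :
    limitingRotoRate σ (z - w) = limitingRotoRate σ z - limitingRotoRate σ w := by
  ext i; fin_cases i <;> simp [limitingRotoRate] <;> ring

theorem limitingRotoRate_smul (σ c : ℝ) (z : Phase) :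
    limitingRotoRate σ (c • z) = c • limitingRotoRate σ z := by
  ext i; fin_cases i <;> simp [limitingRotoRate] <;> ring

theorem limitingRotoRate_zero (σ : ℝ) : limitingRotoRate σ 0 = 0 := by
  ext i; fin_cases i <;> simp [limitingRotoRate]

@[simp] theorem rot_zero (σ : ℝ) (z : Phase) : rot σ 0 z = z := by
  ext i; fin_cases i <;> simp [rot]

theorem rot_apply_zero (σ t : ℝ) : rot σ t 0 = 0 := by
  ext i; fin_cases i <;> simp [rot]

theorem rot_add_two_pi (σ t : ℝ) (z : Phase) : rot σ (t + 2 * Real.pi) z = rot σ t z := by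
  simp [rot]

theorem rot_rot_neg {σ : ℝ} (hσ : σ ^ 2 = 1) (t : ℝ) (z : Phase) : rot σ t (rot σ (-t) z) = z := by
  have h := Real.sin_sq_add_cos_sq t
  ext i; fin_cases i <;> simp [rot]
  · linear_combination (z 2) * h + Real.sin t ^ 2 * z 2 * hσ
  · linear_combination (z 3) * h + Real.sin t ^ 2 * z 3 * hσ

theorem rot_neg_rot {σ : ℝ} (hσ : σ ^ 2 = 1) (t : ℝ) (z : Phase) : rot σ (-t) (rot σ t z) = z := by
  simpa using rot_rot_neg hσ (-t) z

theorem rot_mem_region {z : Phase} (hz : z ∈ region) (σ t : ℝ) : rot σ t z ∈ region := hz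

theorem contDiff_rot (σ : ℝ) : ContDiff ℝ ∞ (fun p : ℝ × Phase => rot σ p.1 p.2) := by
  rw [contDiff_pi]
  intro i
  fin_cases i <;> simp [rot] <;> fun_prop

theorem hasDerivAt_rot {σ : ℝ} (hσ : σ ^ 2 = 1) {w : ℝ → Phase} {w' : Phase} {t : ℝ}
    (hw : HasDerivAt w w' t) :
    HasDerivAt (fun t => rot σ t (w t)) (limitingRotoRate σ (rot σ t (w t)) + rot σ t w') t := by
  have hw := hasDerivAt_pi.1 hw
  have hc := Real.hasDerivAt_cos t
  have hs := Real.hasDerivAt_sin t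
  rw [hasDerivAt_pi]
  intro i
  fin_cases i
  · simpa [rot, limitingRotoRate] using hw 0
  · simpa [rot, limitingRotoRate] using hw 1
  · have := (hc.mul (hw 2)).add ((hs.const_mul σ).mul (hw 3))
    simp only [rot, limitingRotoRate] at this ⊢
    convert this using 1
    · ext s; simp
    · simp
      linear_combination -Real.sin t * w t 2 * hσ
  · have := (hc.mul (hw 3)).sub ((hs.const_mul σ).mul (hw 2))
    simp only [rot, limitingRotoRate] at this ⊢
    convert this using 1
    · ext s; simp
    · simp
      linear_combination -Real.sin t * w t 3 * hσ

theorem hasDerivAt_rot_neg {σ : ℝ} (hσ : σ ^ 2 = 1) {w : ℝ → Phase} {w' : Phase} {t : ℝ}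
    (hw : HasDerivAt w w' t) :
    HasDerivAt (fun t => rot σ (-t) (w t)) (rot σ (-t) (w' - limitingRotoRate σ (w t))) t := by
  have hw := hasDerivAt_pi.1 hw
  have hc := Real.hasDerivAt_cos t
  have hs := Real.hasDerivAt_sin t
  rw [hasDerivAt_pi]
  intro i
  fin_cases i
  · simpa [rot, limitingRotoRate] using hw 0
  · simpa [rot, limitingRotoRate] using hw 1
  · have := (hc.mul (hw 2)).sub ((hs.const_mul σ).mul (hw 3))
    simp only [rot, limitingRotoRate, Real.cos_neg, Real.sin_neg]
    convert this using 1
    · ext s; simp; ring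
    · simp
      linear_combination -Real.sin t * w t 2 * hσ
  · have := (hc.mul (hw 3)).add ((hs.const_mul σ).mul (hw 2))
    simp only [rot, limitingRotoRate, Real.cos_neg, Real.sin_neg]
    convert this using 1
    · ext s; simp
    · simp
      linear_combination -Real.sin t * w t 3 * hσ

/-- Variation of constants for the limiting roto-rate. -/
theorem rot_neg_eq_add_integral {σ : ℝ} (hσ : σ ^ 2 = 1) {u f : ℝ → Phase}
    (hu : ∀ t, HasDerivAt u (limitingRotoRate σ (u t) + f t) t) (hf : Continuous f) (t : ℝ) :
    rot σ (-t) (u t) = u 0 + ∫ s in (0 : ℝ)..t, rot σ (-s) (f s) := by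
  have hd : ∀ s ∈ uIcc 0 t, HasDerivAt (fun t => rot σ (-t) (u t)) (rot σ (-s) (f s)) s := by
    intro s _
    have := hasDerivAt_rot_neg hσ (hu s)
    rwa [add_sub_cancel_left] at this
  have hc : Continuous (fun s => rot σ (-s) (f s)) :=
    (contDiff_rot σ).continuous.comp (continuous_neg.prodMk hf)
  rw [intervalIntegral.integral_eq_sub_of_hasDerivAt hd (hc.intervalIntegrable _ _)]
  simp

/-- The difference solves the homogeneous equation, so turned back by `rot σ (-t)` it keeps its
initial value `0`. -/
theorem eq_of_hasDerivAt_limitingRotoRate {σ : ℝ} (hσ : σ ^ 2 = 1) {u v f : ℝ → Phase}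
    (hu : ∀ t, HasDerivAt u (limitingRotoRate σ (u t) + f t) t)
    (hv : ∀ t, HasDerivAt v (limitingRotoRate σ (v t) + f t) t) (h0 : u 0 = v 0) : u = v := by
  have hd : ∀ t, HasDerivAt (fun t => u t - v t)
      (limitingRotoRate σ (u t - v t) + (fun _ => (0 : Phase)) t) t := by
    intro t
    have := (hu t).sub (hv t)
    rw [limitingRotoRate_sub]
    refine this.congr_deriv ?_
    show _ = _ + (0 : Phase)
    abel
  funext t
  have h1 := rot_neg_eq_add_integral hσ hd continuous_const t
  simp only [rot_apply_zero, h0, sub_self, intervalIntegral.integral_zero, add_zero] at h1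
  have h3 := rot_rot_neg hσ t (u t - v t)
  rw [h1, rot_apply_zero] at h3
  exact sub_eq_zero.1 h3.symm

end Rotation

/-! ### Formal integral curves, order by order -/

section FormalCurves

/-- The partial sum of order `k` of the formal vector field `R` at a point which is a polynomial
in `ε` with `k` coefficients. -/
noncomputable def fieldAtPolynomial (R : ℕ → Phase → Phase) (k : ℕ) (w : ℝ × (Fin k → Phase)) :
    Phase :=
  partialField R k w.1 (∑ i : Fin k, w.1 ^ (i : ℕ) • w.2 i)

/-- The contribution of the coefficients `b i`, `i < k`, to the equation of order `k` for the
integral curves of `R`. -/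
noncomputable def forcing (R : ℕ → Phase → Phase) (k : ℕ) (b : ℕ → Phase) : Phase :=
  jet k (fieldAtPolynomial R k) (fun i => b i)

/-- The domain on which `fieldAtPolynomial R k` is smooth. -/
def polynomialDomain (k : ℕ) : Set (ℝ × (Fin k → Phase)) :=
  starCore {w | (∑ i : Fin k, w.1 ^ (i : ℕ) • w.2 i) ∈ region}

variable {R R' : ℕ → Phase → Phase} {σ : ℝ}

theorem isOpen_polynomialDomain (k : ℕ) : IsOpen (polynomialDomain k) := by
  refine isOpen_starCore (isOpen_region.preimage ?_)
  fun_prop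

theorem starInFst_polynomialDomain (k : ℕ) : StarInFst (polynomialDomain k) :=
  starInFst_starCore _

theorem sum_fin_eq_partialSum (b : ℕ → Phase) (k : ℕ) (ε : ℝ) :
    ∑ i : Fin (k + 1), ε ^ (i : ℕ) • b i = partialSum b k ε :=
  Fin.sum_univ_eq_sum_range (fun i => ε ^ i • b i) (k + 1)

/-- For `k = 0` the polynomial is the empty sum `0`, which has to lie in the region as well. -/
theorem zero_mem_polynomialDomain (k : ℕ) {b : ℕ → Phase} (hb : b 0 ∈ region) :
    ((0 : ℝ), fun i : Fin k => b i) ∈ polynomialDomain k := by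
  refine zero_mem_starCore ?_
  cases k with
  | zero => simpa using zero_mem_region
  | succ k =>
    rw [mem_ofPred_eq, sum_fin_eq_partialSum b k 0, partialSum_at_zero]
    exact hb

theorem contDiffOn_partialField (hR : ∀ k, ContDiffOn ℝ ∞ (R k) region) (k : ℕ) :
    ContDiffOn ℝ ∞ (fun p : ℝ × Phase => partialField R k p.1 p.2) {p | p.2 ∈ region} := by
  unfold partialField partialSum
  refine ContDiffOn.sum fun i _ => ?_
  exact (contDiff_fst.pow i).contDiffOn.smul
    ((hR i).comp contDiff_snd.contDiffOn fun p hp => hp)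

theorem contDiffOn_fieldAtPolynomial (hR : ∀ k, ContDiffOn ℝ ∞ (R k) region) (k : ℕ) :
    ContDiffOn ℝ ∞ (fieldAtPolynomial R k) (polynomialDomain k) := by
  have h : ContDiff ℝ ∞ (fun w : ℝ × (Fin k → Phase) =>
      (w.1, ∑ i : Fin k, w.1 ^ (i : ℕ) • w.2 i)) := by fun_prop
  exact (contDiffOn_partialField hR k).comp h.contDiffOn fun w hw =>
    starCore_subset {w : ℝ × (Fin k → Phase) | (∑ i : Fin k, w.1 ^ (i : ℕ) • w.2 i) ∈ region} hw

theorem eqMod_fieldAtPolynomial (hR : ∀ k, ContDiffOn ℝ ∞ (R k) region) (k : ℕ)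
    {b : ℕ → Phase} (hb : b 0 ∈ region) :
    EqMod (k + 1) (fun ε => fieldAtPolynomial R k (ε, fun i => b i))
      (partialSum (fun i => jet i (fieldAtPolynomial R k) (fun i => b i)) k) :=
  eqMod_partialSum_jet (isOpen_polynomialDomain k) (starInFst_polynomialDomain k)
    (contDiffOn_fieldAtPolynomial hR k) k (zero_mem_polynomialDomain k hb)

theorem fieldAtPolynomial_succ (R : ℕ → Phase → Phase) (k : ℕ) (ε : ℝ) (b : ℕ → Phase) :
    fieldAtPolynomial R (k + 1) (ε, fun i => b i) =
      partialField R (k + 1) ε (partialSum b k ε) := by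
  rw [fieldAtPolynomial, ← sum_fin_eq_partialSum]

theorem partialField_succ (R : ℕ → Phase → Phase) (k : ℕ) (ε : ℝ) (z : Phase) :
    partialField R (k + 1) ε z = partialField R k ε z + ε ^ (k + 1) • R (k + 1) z :=
  partialSum_succ _ _ _

theorem partialField_succ' (R : ℕ → Phase → Phase) (k : ℕ) (ε : ℝ) (z : Phase) :
    partialField R (k + 1) ε z = R 0 z + ε ^ 1 • partialField (fun i => R (i + 1)) k ε z := by
  simp only [partialField, partialSum]
  rw [Finset.sum_range_succ' _ (k + 1), add_comm, Finset.smul_sum]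
  simp [pow_succ', mul_smul]

theorem partialField_congr {k : ℕ} {ε : ℝ} {z : Phase} (h : ∀ i ≤ k, R' i z = R i z) :
    partialField R' k ε z = partialField R k ε z :=
  show ∑ i ∈ Finset.range (k + 1), ε ^ i • R' i z = ∑ i ∈ Finset.range (k + 1), ε ^ i • R i z from
    Finset.sum_congr rfl fun i hi => by
      rw [h i (by simpa [Nat.lt_succ_iff] using hi)]

theorem eventually_partialSum_mem {b : ℕ → Phase} (hb : b 0 ∈ region) (k : ℕ) :
    ∀ᶠ ε in 𝓝 (0 : ℝ), partialSum b k ε ∈ region :=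
  (tendsto_partialSum b k).eventually (isOpen_region.mem_nhds hb)

/-- With no coefficients the polynomial is `0`, a zero of the limiting roto-rate; so the equation of
order zero is homogeneous. -/
theorem forcing_zero (h0 : ∀ z ∈ region, R 0 z = limitingRotoRate σ z) (b : ℕ → Phase) :
    forcing R 0 b = 0 := by
  simp [forcing, jet, fieldAtPolynomial, partialField, h0 0 zero_mem_region,
    limitingRotoRate_zero]

/-- The expansion of a formal vector field along a formal curve. -/
theorem eqMod_partialField_partialSum (hR : ∀ k, ContDiffOn ℝ ∞ (R k) region)
    (h0 : ∀ z ∈ region, R 0 z = limitingRotoRate σ z) {b : ℕ → Phase} (hb : b 0 ∈ region)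
    (k : ℕ) :
    EqMod (k + 1) (fun ε => partialField R k ε (partialSum b k ε))
      (partialSum (fun i => limitingRotoRate σ (b i) + forcing R i b) k) := by
  induction k with
  | zero =>
    refine EqMod.of_eventuallyEq (Eventually.of_forall fun ε => ?_)
    simp [partialField, forcing_zero h0, h0 _ hb]
  | succ k ih =>
    -- Split `R` into `R₀` and `ε` times the rest. Because `R₀` is linear, `b (k + 1)` enters at
    -- order `k + 1` through `R₀` alone; through the rest it counts only from order `k + 2` on.
    have h1 : EqMod (k + 2) (fun ε => partialField R (k + 1) ε (partialSum b (k + 1) ε))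
        (fun ε => fieldAtPolynomial R (k + 1) (ε, fun i => b i)
          + ε ^ (k + 1) • limitingRotoRate σ (b (k + 1))) := by
      have hG : ContDiffAt ℝ 1
          (fun p : ℝ × Phase => partialField (fun i => R (i + 1)) k p.1 p.2) (0, b 0) :=
        ((contDiffOn_partialField (fun i => hR (i + 1)) k).contDiffAt
          ((isOpen_region.preimage continuous_snd).mem_nhds hb)).of_le (by simp)
      have h2 : EqMod (k + 1) (partialSum b (k + 1)) (partialSum b k) :=
        EqMod.of_smul (r := fun _ => b (k + 1)) continuousAt_const
          (Eventually.of_forall fun ε => partialSum_succ b k ε)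
      have h3 := (h2.comp_contDiffAt hG (tendsto_partialSum b _)
        (tendsto_partialSum b _)).pow_smul 1
      rw [show 1 + (k + 1) = k + 2 by ring] at h3
      have h4 := (EqMod.refl (k + 2) (fun ε => limitingRotoRate σ (partialSum b (k + 1) ε))).add h3
      refine h4.congr' ?_ ?_
      · filter_upwards [eventually_partialSum_mem hb (k + 1)] with ε hε
        rw [partialField_succ', h0 _ hε]
      · filter_upwards [eventually_partialSum_mem hb k] with ε hε
        rw [fieldAtPolynomial_succ, partialField_succ', h0 _ hε, partialSum_succ,
          limitingRotoRate_add, limitingRotoRate_smul]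
        abel
    have h5 := eqMod_fieldAtPolynomial hR (k + 1) hb
    -- Below order `k + 1` the term `ε^(k+1) R_(k+1)` is invisible, so the lower coefficients are
    -- those of the induction hypothesis.
    have h6 : EqMod (k + 1) (partialSum (fun i => jet i (fieldAtPolynomial R (k + 1))
        (fun i => b i)) k) (partialSum (fun i => limitingRotoRate σ (b i) + forcing R i b) k) := by
      refine EqMod.trans ?_ ih
      have h7 : EqMod (k + 1) (partialSum (fun i => jet i (fieldAtPolynomial R (k + 1))
        (fun i => b i)) k) (partialSum (fun i => jet i (fieldAtPolynomial R (k + 1))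
        (fun i => b i)) (k + 1)) := by
        refine (EqMod.of_smul (r := fun _ => _) continuousAt_const
          (Eventually.of_forall fun ε => partialSum_succ _ k ε)).symm
      refine (h7.trans (h5.symm.mono (Nat.le_succ _))).trans ?_
      have hc : ContinuousAt (fun ε : ℝ => R (k + 1) (partialSum b k ε)) 0 := by
        refine ContinuousAt.comp (g := R (k + 1)) ?_ (continuous_partialSum b k).continuousAt
        rw [partialSum_at_zero]
        exact (hR (k + 1)).continuousOn.continuousAt (isOpen_region.mem_nhds hb)
      have h8 : EqMod (k + 1) (fun ε => fieldAtPolynomial R (k + 1) (ε, fun i => b i))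
          (fun ε => partialField R k ε (partialSum b k ε)) := by
        refine EqMod.of_smul hc (Eventually.of_forall fun ε => ?_)
        rw [fieldAtPolynomial_succ, partialField_succ]
      refine h8.trans ?_
      have hG : ContDiffAt ℝ 1 (fun p : ℝ × Phase => partialField R k p.1 p.2) (0, b 0) :=
        ((contDiffOn_partialField hR k).contDiffAt
          ((isOpen_region.preimage continuous_snd).mem_nhds hb)).of_le (by simp)
      exact EqMod.refl _ _
    have h9 := eq_of_eqMod_partialSum h6
    refine (h1.trans (h5.add (EqMod.refl _ _))).trans
      (EqMod.of_eventuallyEq (Eventually.of_forall fun ε => ?_))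
    simp only [partialSum_succ]
    rw [show partialSum (fun i => jet i (fieldAtPolynomial R (k + 1)) fun i => b i) k ε =
      partialSum (fun i => limitingRotoRate σ (b i) + forcing R i b) k ε from
        Finset.sum_congr rfl fun i hi => by
          simp only [h9 i (by simpa [Nat.lt_succ_iff] using hi)]]
    rw [smul_add, forcing]
    abel

/-- The first term in which the two fields differ already carries the factor `ε^(k+1)`, so at order
`k + 1` only its value at the leading point `b 0` matters. -/
theorem forcing_sub_forcing (hR : ∀ k, ContDiffOn ℝ ∞ (R k) region)
    (hR' : ∀ k, ContDiffOn ℝ ∞ (R' k) region) {b : ℕ → Phase} (hb : b 0 ∈ region) {k : ℕ}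
    (h : ∀ i ≤ k, ∀ z ∈ region, R' i z = R i z) :
    forcing R' (k + 1) b = forcing R (k + 1) b + (R' (k + 1) (b 0) - R (k + 1) (b 0)) := by
  have h1 := eqMod_fieldAtPolynomial hR (k + 1) hb
  have h2 := eqMod_fieldAtPolynomial hR' (k + 1) hb
  have hc : ∀ {S : ℕ → Phase → Phase}, (∀ k, ContDiffOn ℝ ∞ (S k) region) →
      EqMod 1 (fun ε => S (k + 1) (partialSum b k ε)) (fun _ => S (k + 1) (b 0)) := by
    intro S hS
    have hG : ContDiffAt ℝ 1 (fun p : ℝ × Phase => S (k + 1) p.2) (0, b 0) :=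
      ContDiffAt.comp (g := S (k + 1)) (f := Prod.snd) _
        (((hS (k + 1)).contDiffAt (isOpen_region.mem_nhds hb)).of_le (by simp)) contDiffAt_snd
    refine EqMod.comp_contDiffAt (u := partialSum b k) hG
      (tendsto_partialSum b k) tendsto_const_nhds ?_
    have hd : DifferentiableAt ℝ (partialSum b k) 0 := by
      unfold partialSum
      fun_prop
    have := hd.isBigO_sub
    simp only [partialSum_at_zero, sub_zero] at this
    simpa only [EqMod, pow_one] using this
  have h3 : EqMod (k + 2) (fun ε => fieldAtPolynomial R' (k + 1) (ε, fun i => b i)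
      - fieldAtPolynomial R (k + 1) (ε, fun i => b i))
      (fun ε => ε ^ (k + 1) • (R' (k + 1) (b 0) - R (k + 1) (b 0))) := by
    refine (((hc hR').sub (hc hR)).pow_smul (k + 1)).congr' ?_ EventuallyEq.rfl
    filter_upwards [eventually_partialSum_mem hb k] with ε hε
    rw [fieldAtPolynomial_succ, fieldAtPolynomial_succ, partialField_succ, partialField_succ,
      partialField_congr (k := k) fun i hi => h i hi _ hε, smul_sub]
    abel
  have h4 := ((h2.sub h1).symm.trans h3)
  have h5 : EqMod (k + 2) (partialSum (fun i => (jet i (fieldAtPolynomial R' (k + 1)) (fun i => b i)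
      - jet i (fieldAtPolynomial R (k + 1)) (fun i => b i))) (k + 1))
      (partialSum (fun i => if i = k + 1 then R' (k + 1) (b 0) - R (k + 1) (b 0) else 0)
        (k + 1)) := by
    refine h4.congr' (Eventually.of_forall fun ε => ?_) (Eventually.of_forall fun ε => ?_)
    · rw [partialSum_sub]
    · simp [partialSum]
  have h6 := eq_of_eqMod_partialSum h5 (k + 1) le_rfl
  rw [if_pos rfl] at h6
  rw [← h6, forcing, forcing]
  abel

theorem deriv_partialCurve {c : ℕ → ℝ → Phase} (hc : ∀ k, ContDiff ℝ 1 (c k)) (k : ℕ) (ε t : ℝ) :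
    HasDerivAt (partialCurve c k ε) (partialSum (fun i => deriv (c i) t) k ε) t := by
  unfold partialCurve partialSum
  exact HasDerivAt.fun_sum fun i _ =>
    (((hc i).differentiable (by simp)).differentiableAt.hasDerivAt).const_smul (ε ^ i)

/-- The equations of the successive orders for the formal integral curves. -/
theorem isFormalIntegralCurve_iff (hR : ∀ k, ContDiffOn ℝ ∞ (R k) region)
    (h0 : ∀ z ∈ region, R 0 z = limitingRotoRate σ z) {c : ℕ → ℝ → Phase}
    (hc : ∀ k, ContDiff ℝ 1 (c k)) (hm : ∀ t, c 0 t ∈ region) :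
    IsFormalIntegralCurve R c ↔ ∀ k t, HasDerivAt (c k)
      (limitingRotoRate σ (c k t) + forcing R k (fun i => c i t)) t := by
  have hd : ∀ k t, HasDerivAt (c k) (deriv (c k) t) t := fun k t =>
    ((hc k).differentiable (by simp)).differentiableAt.hasDerivAt
  have he : ∀ k t, EqMod (k + 1) (fun ε => partialField R k ε (partialCurve c k ε t))
      (partialSum (fun i => limitingRotoRate σ (c i t) + forcing R i (fun i => c i t)) k) :=
    fun k t => eqMod_partialField_partialSum hR h0 (b := fun i => c i t) (hm t) k
  constructor
  · intro h k t
    have h1 := (h.eqn k t).trans (he k t)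
    simp only [(deriv_partialCurve hc k _ t).deriv] at h1
    rw [← eq_of_eqMod_partialSum h1 k le_rfl]
    exact hd k t
  · intro h
    refine ⟨hc, hm, fun k t => ?_⟩
    refine EqMod.trans ?_ (he k t).symm
    simp only [(deriv_partialCurve hc k _ t).deriv, fun i => (h i t).deriv]
    exact EqMod.refl _ _

theorem forcing_congr_prefix {k : ℕ} {b b' : ℕ → Phase} (h : ∀ i < k, b i = b' i) :
    forcing R k b = forcing R k b' := by
  simp only [forcing]
  congr 1
  funext i
  exact h i i.2

theorem IsFormalIntegralCurve.apply_zero (hσ : σ ^ 2 = 1)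
    (hR : ∀ k, ContDiffOn ℝ ∞ (R k) region)
    (h0 : ∀ z ∈ region, R 0 z = limitingRotoRate σ z) {c : ℕ → ℝ → Phase}
    (hc : IsFormalIntegralCurve R c) (t : ℝ) : c 0 t = rot σ t (c 0 0) := by
  have e := (isFormalIntegralCurve_iff hR h0 hc.smooth hc.mem).1 hc 0
  refine congrFun (eq_of_hasDerivAt_limitingRotoRate (v := fun t => rot σ t (c 0 0)) hσ e
    (fun t => ?_) (by simp)) t
  rw [forcing_zero h0]
  have := hasDerivAt_rot hσ (hasDerivAt_const t (c 0 0))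
  rwa [rot_apply_zero] at this

theorem continuous_forcing (hR : ∀ k, ContDiffOn ℝ ∞ (R k) region) (k : ℕ)
    {b : ℕ → ℝ → Phase} (hb : ∀ i < k, Continuous (b i)) (hm : ∀ t, b 0 t ∈ region) :
    Continuous (fun t => forcing R k (fun i => b i t)) := by
  have h := (contDiffOn_jet (isOpen_polynomialDomain k) (starInFst_polynomialDomain k)
    (contDiffOn_fieldAtPolynomial hR k) k).continuousOn
  rw [← continuousOn_univ]
  refine h.comp (f := fun t => fun i : Fin k => b i t) ?_ fun t _ =>
    zero_mem_polynomialDomain k (b := fun i => b i t) (hm t)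
  exact (continuous_pi fun i : Fin k => hb i i.2).continuousOn

/-- The coefficients of the formal integral curve through `z`, by variation of constants. -/
noncomputable def formalCurve (σ : ℝ) (R : ℕ → Phase → Phase) (z : Phase) (k : ℕ) (t : ℝ) : Phase :=
  rot σ t ((if k = 0 then z else 0) + ∫ s in (0 : ℝ)..t, rot σ (-s)
    (jet k (fieldAtPolynomial R k) (fun i : Fin k => formalCurve σ R z i s)))
termination_by k
decreasing_by exact Fin.is_lt _

theorem formalCurve_eq (σ : ℝ) (R : ℕ → Phase → Phase) (z : Phase) (k : ℕ) :
    formalCurve σ R z k = fun t => rot σ t ((if k = 0 then z else 0) +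
      ∫ s in (0 : ℝ)..t, rot σ (-s) (forcing R k (fun i => formalCurve σ R z i s))) := by
  funext t
  rw [formalCurve]
  rfl

theorem formalCurve_mem {z : Phase} (hz : z ∈ region)
    (h0 : ∀ z ∈ region, R 0 z = limitingRotoRate σ z) (t : ℝ) :
    formalCurve σ R z 0 t ∈ region := by
  rw [formalCurve_eq]
  simp only [forcing_zero h0, rot_apply_zero, intervalIntegral.integral_zero, add_zero, if_true]
  exact rot_mem_region hz σ t

/-- At each order the equation is linear with a forcing made of lower orders, so `formalCurve`
solves it recursively; the strong induction supplies the continuity that makes the forcing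
integrable. -/
theorem exists_formalIntegralCurve (hσ : σ ^ 2 = 1) (hR : ∀ k, ContDiffOn ℝ ∞ (R k) region)
    (h0 : ∀ z ∈ region, R 0 z = limitingRotoRate σ z) {z : Phase} (hz : z ∈ region) :
    ∃ c, IsFormalIntegralCurve R c ∧ c 0 0 = z ∧ ∀ k, c (k + 1) 0 = 0 := by
  have hm := formalCurve_mem (R := R) hz h0
  have key : ∀ k, ContDiff ℝ 1 (formalCurve σ R z k) ∧ ∀ t, HasDerivAt (formalCurve σ R z k)
      (limitingRotoRate σ (formalCurve σ R z k t) +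
        forcing R k (fun i => formalCurve σ R z i t)) t := by
    intro k
    induction k using Nat.strong_induction_on with
    | _ k ih =>
      have hf : Continuous (fun t => forcing R k (fun i => formalCurve σ R z i t)) :=
        continuous_forcing hR k (fun i hi => (ih i hi).1.continuous) hm
      have hc : Continuous (fun s => rot σ (-s)
          (forcing R k (fun i => formalCurve σ R z i s))) :=
        (contDiff_rot σ).continuous.comp (continuous_neg.prodMk hf)
      have hd : ∀ t, HasDerivAt (formalCurve σ R z k)
          (limitingRotoRate σ (formalCurve σ R z k t) +
            forcing R k (fun i => formalCurve σ R z i t)) t := by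
        intro t
        have h1 := ((intervalIntegral.integral_hasDerivAt_right (hc.intervalIntegrable 0 t)
          (hc.stronglyMeasurableAtFilter _ _) hc.continuousAt).const_add (if k = 0 then z else 0))
        have h2 := hasDerivAt_rot hσ h1
        rw [rot_rot_neg hσ] at h2
        rw [formalCurve_eq]
        exact h2
      refine ⟨?_, hd⟩
      rw [contDiff_one_iff_deriv]
      refine ⟨fun t => (hd t).differentiableAt, ?_⟩
      rw [show deriv (formalCurve σ R z k) = fun t => _ from funext fun t => (hd t).deriv]
      have hcont : Continuous (formalCurve σ R z k) :=
        continuous_iff_continuousAt.2 fun t => (hd t).continuousAt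
      refine Continuous.add ?_ hf
      refine continuous_pi fun i => ?_
      fin_cases i <;> simp [limitingRotoRate] <;> fun_prop
  refine ⟨formalCurve σ R z, (isFormalIntegralCurve_iff hR h0 (fun k => (key k).1) hm).2
    fun k => (key k).2, ?_, fun k => ?_⟩
  · rw [formalCurve_eq]; simp
  · rw [formalCurve_eq]; simp

end FormalCurves

/-! ### Uniqueness of the roto-rate and of Kruskal's series -/

theorem fderiv_apply_eq_of_hasDerivAt {V E : Type*} [NormedAddCommGroup V] [NormedSpace ℝ V]
    [NormedAddCommGroup E] [NormedSpace ℝ E] {f : V → E} {z u : V} {d : E}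
    (hf : DifferentiableAt ℝ f z) (h : HasDerivAt (fun τ : ℝ => f (z + τ • u)) d 0) :
    fderiv ℝ f z u = d := by
  rw [← hf.lineDeriv_eq_fderiv]
  exact HasLineDerivAt.lineDeriv h

theorem contDiff_field (σ : ℝ) : ContDiff ℝ ∞ (fun p : ℝ × Phase => field σ p.1 p.2) := by
  rw [contDiff_pi]
  intro i
  fin_cases i <;> simp [field] <;> fun_prop

theorem differentiable_field (σ ε : ℝ) : Differentiable ℝ (field σ ε) :=
  ((contDiff_field σ).comp (contDiff_prodMk_right ε)).differentiable (by simp)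

theorem hasDerivAt_line (z u : Phase) (i : Fin 4) (t : ℝ) :
    HasDerivAt (fun τ : ℝ => (z + τ • u) i) (u i) t := by
  simpa using ((hasDerivAt_id t).mul_const (u i)).const_add (z i)

theorem fderiv_field_apply (σ ε : ℝ) (z u : Phase) :
    fderiv ℝ (field σ ε) z u = ![ε * u 2, ε * u 3, σ * (u 3 * (1 + z 1) + z 3 * u 1),
      -(σ * (u 2 * (1 + z 1) + z 2 * u 1))] := by
  refine fderiv_apply_eq_of_hasDerivAt (differentiable_field σ ε).differentiableAt ?_
  rw [hasDerivAt_pi]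
  have h := fun i => hasDerivAt_line z u i 0
  intro i
  fin_cases i
  · exact (h 2).const_mul ε
  · exact (h 3).const_mul ε
  · refine (((h 3).const_mul σ).mul ((h 1).const_add 1)).congr_deriv ?_
    simp; ring
  · refine (((h 2).const_mul σ).mul ((h 1).const_add 1)).neg.congr_deriv ?_
    simp; ring

/-- The Lorentz field is affine in `ε`, hence so is its bracket with a fixed `D`; at leading order
only `field σ 0` counts. -/
theorem lieBracket_field_eq (σ ε : ℝ) {D : Phase → Phase} (z : Phase) :
    VectorField.lieBracket ℝ D (field σ ε) z = VectorField.lieBracket ℝ D (field σ 0) z +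
      ε • VectorField.lieBracket ℝ D (fun z => ![z 2, z 3, 0, 0]) z := by
  have hd : Differentiable ℝ (fun z : Phase => (![z 2, z 3, 0, 0] : Phase)) := by
    rw [differentiable_pi]
    intro i
    fin_cases i <;> simp <;> fun_prop
  have h : field σ ε = field σ 0 + ε • fun z : Phase => (![z 2, z 3, 0, 0] : Phase) := by
    ext z i
    fin_cases i <;> simp [field]
  rw [h, VectorField.lieBracket_add_right (differentiable_field σ 0).differentiableAt
    (hd.differentiableAt.const_smul ε), VectorField.lieBracket_const_smul_right
    hd.differentiableAt]

theorem eq_zero_of_eqMod_pow_smul {E : Type} [NormedAddCommGroup E] [NormedSpace ℝ E] {k : ℕ}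
    {w : E} (h : EqMod (k + 1) (fun ε => ε ^ k • w) (fun _ => 0)) : w = 0 := by
  have := eq_zero_of_partialSum (a := fun i => if i = k then w else 0) (k := k) (h.congr'
    (Eventually.of_forall fun ε => by simp [partialSum]) EventuallyEq.rfl) k le_rfl
  simpa using this

/-- The leading term of a difference of two formal vector fields which commute with the Lorentz
force commutes with the leading term of the Lorentz force. -/
theorem lieBracket_leading_difference {σ : ℝ} {R R' : ℕ → Phase → Phase} (hR : IsRotoRate σ R)
    (hR' : IsRotoRate σ R') {k : ℕ} (h : ∀ i < k, ∀ z ∈ region, R' i z = R i z) {z : Phase}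
    (hz : z ∈ region) :
    VectorField.lieBracket ℝ (fun z => R' k z - R k z) (field σ 0) z = 0 := by
  set D : Phase → Phase := fun z => R' k z - R k z with hD
  have hDz : DifferentiableAt ℝ D z :=
    (((hR'.smooth k).sub (hR.smooth k)).contDiffAt (isOpen_region.mem_nhds hz)).differentiableAt
      (by simp)
  have hRz : ∀ ε, DifferentiableAt ℝ (partialField R k ε) z := fun ε => by
    have := ((contDiffOn_partialField hR.smooth k).contDiffAt (x := (ε, z))
      ((isOpen_region.preimage continuous_snd).mem_nhds hz)).differentiableAt (by simp)
    exact this.comp z (differentiableAt_const ε |>.prodMk differentiableAt_id)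
  have h1 : ∀ ε, VectorField.lieBracket ℝ (partialField R' k ε) (field σ ε) z =
      VectorField.lieBracket ℝ (partialField R k ε) (field σ ε) z +
        ε ^ k • VectorField.lieBracket ℝ D (field σ ε) z := by
    intro ε
    have he : partialField R' k ε =ᶠ[𝓝 z] partialField R k ε + ε ^ k • D := by
      filter_upwards [isOpen_region.mem_nhds hz] with p hp
      rw [Pi.add_apply, Pi.smul_apply, hD]
      cases k with
      | zero => simp [partialField]
      | succ k =>
        rw [partialField_succ, partialField_succ,
          partialField_congr fun i hi => h i (Nat.lt_succ_of_le hi) p hp, smul_sub]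
        abel
    rw [← VectorField.lieBracket_const_smul_left hDz,
      ← VectorField.lieBracket_add_left (hRz ε) (hDz.const_smul _)]
    simp only [VectorField.lieBracket, he.fderiv_eq, he.eq_of_nhds]
  refine eq_zero_of_eqMod_pow_smul (k := k) ?_
  have h2 := (hR'.commutes k z hz).sub (hR.commutes k z hz)
  simp only [h1, add_sub_cancel_left, sub_self] at h2
  refine EqMod.trans (EqMod.symm (EqMod.of_smul (n := k + 1)
    (r := fun _ => VectorField.lieBracket ℝ D (fun z => ![z 2, z 3, 0, 0]) z)
    continuousAt_const ?_)) h2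
  refine Eventually.of_forall fun ε => ?_
  rw [lieBracket_field_eq, smul_add, smul_smul, pow_succ]

theorem continuous_rot_apply (σ : ℝ) (z : Phase) : Continuous (fun t => rot σ t z) :=
  (contDiff_rot σ).continuous.comp (continuous_id.prodMk continuous_const)

theorem field_zero (σ : ℝ) (z : Phase) : field σ 0 z = (1 + z 1) • limitingRotoRate σ z := by
  ext i
  fin_cases i <;> simp [field, limitingRotoRate] <;> ring

theorem limitingRotoRate_rot (σ t : ℝ) (z : Phase) :
    limitingRotoRate σ (rot σ t z) = rot σ t (limitingRotoRate σ z) := by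
  ext i
  fin_cases i <;> simp [rot, limitingRotoRate] <;> ring

theorem rot_smul (σ t c : ℝ) (z : Phase) : rot σ t (c • z) = c • rot σ t z := by
  ext i
  fin_cases i <;> simp [rot] <;> ring

/-- A vector field which commutes with the leading term of the Lorentz force is invariant under
rotations of the velocity. -/
theorem apply_rot_of_lieBracket_eq_zero {σ : ℝ} (hσ : σ ^ 2 = 1) {D : Phase → Phase}
    (hD : ContDiffOn ℝ ∞ D region)
    (h : ∀ z ∈ region, VectorField.lieBracket ℝ D (field σ 0) z = 0) {z : Phase}
    (hz : z ∈ region) (t : ℝ) : D (rot σ t z) = rot σ t (D z) := by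
  have hpos : 0 < 1 + z 1 := by
    have : -1 < z 1 := hz
    linarith
  have hrot : ∀ s, HasDerivAt (fun s => rot σ s z) (limitingRotoRate σ (rot σ s z)) s := fun s => by
    have := hasDerivAt_rot hσ (hasDerivAt_const s z)
    rwa [rot_apply_zero, add_zero] at this
  -- The vanishing bracket with `(1 + y) R₀` is solved for the derivative of `D` along `R₀`;
  -- differentiating the factor `1 + y` produces the second term, a multiple of `R₀` itself.
  have hφ : ∀ s, HasDerivAt (fun s => D (rot σ s z)) (limitingRotoRate σ (D (rot σ s z)) +
      (D (rot σ s z) 1 / (1 + z 1)) • limitingRotoRate σ (rot σ s z)) s := by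
    intro s
    have hm := rot_mem_region hz σ s
    have hd : HasFDerivAt D (fderiv ℝ D (rot σ s z)) (rot σ s z) :=
      ((hD.contDiffAt (isOpen_region.mem_nhds hm)).differentiableAt (by simp)).hasFDerivAt
    refine (hd.comp_hasDerivAt s (hrot s)).congr_deriv ?_
    have h1 := h _ hm
    rw [VectorField.lieBracket, sub_eq_zero, field_zero, map_smul, fderiv_field_apply] at h1
    have h2 : (rot σ s z) 1 = z 1 := rfl
    rw [h2] at h1
    rw [← inv_smul_smul₀ hpos.ne' (fderiv ℝ D (rot σ s z) (limitingRotoRate σ (rot σ s z))), ← h1]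
    ext i
    fin_cases i <;> simp [limitingRotoRate] <;> field_simp
    ring
  have h1 : ∀ s, D (rot σ s z) 1 = D z 1 := by
    intro s
    have hd : ∀ s, HasDerivAt (fun s => D (rot σ s z) 1) 0 s := fun s => by
      have := hasDerivAt_pi.1 (hφ s) 1
      simpa [limitingRotoRate] using this
    have := is_const_of_deriv_eq_zero (fun s => (hd s).differentiableAt) (fun s => (hd s).deriv) s 0
    simpa using this
  set β := D z 1 / (1 + z 1) with hβ
  have h2 : ∀ s, rot σ (-s) (D (rot σ s z)) = D z + s • β • limitingRotoRate σ z := by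
    intro s
    have hc : Continuous (fun s => β • limitingRotoRate σ (rot σ s z)) := by
      simp only [limitingRotoRate_rot]
      exact (continuous_rot_apply σ _).const_smul β
    have := rot_neg_eq_add_integral hσ (u := fun s => D (rot σ s z))
      (f := fun s => β • limitingRotoRate σ (rot σ s z)) (fun s => by
        have := hφ s
        rwa [h1 s] at this) hc s
    rw [this]
    simp only [limitingRotoRate_rot, rot_smul, rot_neg_rot hσ]
    simp [smul_comm β s]
  -- The term linear in `s` is secular: at `s = 2π` the rotation has returned, so this term must
  -- vanish.
  have h3 : β • limitingRotoRate σ z = 0 := by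
    have h4 := h2 (2 * Real.pi)
    have h5 := rot_add_two_pi σ 0 z
    have h6 := rot_add_two_pi σ (-(2 * Real.pi)) (D z)
    simp only [neg_add_cancel, rot_zero, zero_add] at h5 h6
    rw [h5, ← h6, left_eq_add] at h4
    exact (smul_eq_zero.1 h4).resolve_left Real.two_pi_pos.ne'
  have h4 := h2 t
  rw [h3, smul_zero, add_zero] at h4
  rw [← h4, rot_rot_neg hσ]

/-- The roto-rate is unique. -/
theorem IsRotoRate.unique {σ : ℝ} (hσ : σ ^ 2 = 1) {R R' : ℕ → Phase → Phase}
    (hR : IsRotoRate σ R) (hR' : IsRotoRate σ R') (k : ℕ) : ∀ z ∈ region, R' k z = R k z := by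
  induction k using Nat.strong_induction_on with
  | _ k ih =>
    intro z hz
    cases k with
    | zero => rw [hR.limit z hz, hR'.limit z hz]
    | succ k =>
      obtain ⟨c, hc, hc0, hc1⟩ := exists_formalIntegralCurve hσ hR.smooth hR.limit hz
      obtain ⟨c', hc', hc0', hc1'⟩ := exists_formalIntegralCurve hσ hR'.smooth hR'.limit hz
      have e := (isFormalIntegralCurve_iff hR.smooth hR.limit hc.smooth hc.mem).1 hc
      have e' := (isFormalIntegralCurve_iff hR'.smooth hR'.limit hc'.smooth hc'.mem).1 hc'
      have h00 : ∀ i, c' i 0 = c i 0 := by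
        intro i
        cases i with
        | zero => rw [hc0, hc0']
        | succ i => rw [hc1, hc1']
      -- Up to order `k` the two hierarchies of equations coincide, and so do the initial values.
      have hcc : ∀ i ≤ k, c' i = c i := by
        intro i
        induction i using Nat.strong_induction_on with
        | _ i ihc =>
          intro hi
          refine eq_of_hasDerivAt_limitingRotoRate hσ (e' i) (fun t => ?_) (h00 i)
          rw [forcing_congr_prefix (b' := fun j => c j t)
            fun j hj => congrFun (ihc j hj (hj.le.trans hi)) t]
          cases i with
          | zero =>
            rw [forcing_zero hR'.limit, ← forcing_zero hR.limit (fun j => c j t)]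
            exact e 0 t
          | succ i =>
            rw [forcing_sub_forcing hR.smooth hR'.smooth (hc.mem t)
              (fun j hj z hz => ih j (by omega) z hz), ih (i + 1) (by omega) _ (hc.mem t),
              sub_self, add_zero]
            exact e (i + 1) t
      have hD : ∀ t, R' (k + 1) (c 0 t) - R (k + 1) (c 0 t) =
          rot σ t (R' (k + 1) z - R (k + 1) z) := by
        intro t
        rw [hc.apply_zero hσ hR.smooth hR.limit, hc0]
        exact apply_rot_of_lieBracket_eq_zero hσ (D := fun z => R' (k + 1) z - R (k + 1) z)
          ((hR'.smooth _).sub (hR.smooth _))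
          (fun p hp => lieBracket_leading_difference hR hR' ih hp) hz t
      have hδ : ∀ t, HasDerivAt (fun t => c' (k + 1) t - c (k + 1) t)
          (limitingRotoRate σ (c' (k + 1) t - c (k + 1) t) +
            rot σ t (R' (k + 1) z - R (k + 1) z)) t := by
        intro t
        refine ((e' (k + 1) t).sub (e (k + 1) t)).congr_deriv ?_
        rw [forcing_congr_prefix (R := R') (b' := fun j => c j t)
          fun j hj => congrFun (hcc j (Nat.le_of_lt_succ hj)) t,
          forcing_sub_forcing hR.smooth hR'.smooth (hc.mem t)
            (fun j hj z hz => ih j (by omega) z hz), hD, limitingRotoRate_sub]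
        abel
      -- The forcing is resonant: turned back it is constant, so over one turn the difference of the
      -- curves gains `2π` times the disagreement of the fields at `z`. Periodicity leaves no room
      -- for this.
      have h1 := rot_neg_eq_add_integral hσ hδ (continuous_rot_apply σ _) (2 * Real.pi)
      have h2 : ∀ {R : ℕ → Phase → Phase} {c : ℕ → ℝ → Phase}, IsRotoRate σ R →
          IsFormalIntegralCurve R c → c (k + 1) (2 * Real.pi) = c (k + 1) 0 := by
        intro R c hR hc
        simpa using hR.periodic c hc (k + 1) 0
      simp only [h2 hR hc, h2 hR' hc', h00, sub_self, rot_apply_zero, rot_neg_rot hσ,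
        intervalIntegral.integral_const, sub_zero, zero_add] at h1
      exact sub_eq_zero.1 ((smul_eq_zero.1 h1.symm).resolve_left Real.two_pi_pos.ne')

/-- Kruskal's series does not change if the roto-rate is changed outside `y > -1`. -/
theorem IsKruskalSeries.unique {σ : ℝ} (hσ : σ ^ 2 = 1) {R R' : ℕ → Phase → Phase}
    {μ μ' : ℕ → Phase → ℝ} (hR : IsRotoRate σ R) (hRR' : ∀ k, ∀ z ∈ region, R' k z = R k z)
    (hμ : IsKruskalSeries σ R μ) (hμ' : IsKruskalSeries σ R' μ') (k : ℕ) :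
    ∀ z ∈ region, μ' k z = μ k z := by
  intro z hz
  obtain ⟨c, hc, hc0, hc1⟩ := exists_formalIntegralCurve hσ hR.smooth hR.limit hz
  -- For small `ε` the truncated curve stays in the open region, where both fields agree.
  have hc' : IsFormalIntegralCurve R' c := by
    refine ⟨hc.smooth, hc.mem, fun k t => (hc.eqn k t).trans (EqMod.of_eventuallyEq ?_)⟩
    filter_upwards [eventually_partialSum_mem (b := fun i => c i t) (hc.mem t) k] with ε hε
    exact (partialField_congr fun i _ => hRR' i _ hε).symm
  exact eq_of_eqMod_partialSum ((hμ' z hz c hc' hc0 hc1 k).symm.trans (hμ z hz c hc hc0 hc1 k))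
    k le_rfl

/-! ### Means over the gyro-angle and their derivatives along the motion -/

theorem fderiv_parametricIntegral_apply {V E : Type} [NormedAddCommGroup V] [NormedSpace ℝ V]
    [NormedAddCommGroup E] [NormedSpace ℝ E] [CompleteSpace E] {O : Set (ℝ × V)} (hO : IsOpen O)
    {f : ℝ × V → E} (hf : ContDiffOn ℝ ∞ f O) {a b : ℝ} {w₀ : V}
    (h : ∀ s ∈ uIcc a b, (s, w₀) ∈ O) (v : V) :
    fderiv ℝ (fun w => ∫ s in a..b, f (s, w)) w₀ v = ∫ s in a..b, fderiv ℝ f (s, w₀) (0, v) := by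
  rw [(hasFDerivAt_parametricIntegral hO hf h).fderiv, ContinuousLinearMap.intervalIntegral_apply]
  · simp
  · refine ContinuousOn.intervalIntegrable ?_
    have hfd : ContinuousOn (fun p => (fderiv ℝ f p).comp (ContinuousLinearMap.inr ℝ ℝ V)) O :=
      ((hf.continuousOn_fderiv_of_isOpen hO (by simp))).clm_comp continuousOn_const
    exact hfd.comp (f := fun s : ℝ => (s, w₀)) (by fun_prop) fun s hs => h s hs

section Mean

/-- The `x`-component of the velocity, rotated by the angle `s`. -/
noncomputable def vel (z : Phase) (s : ℝ) : ℝ := z 2 * Real.cos s + z 3 * Real.sin s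

/-- The `y`-component of the velocity, rotated by the angle `s`. -/
noncomputable def velPerp (z : Phase) (s : ℝ) : ℝ := z 3 * Real.cos s - z 2 * Real.sin s

/-- The square of the magnetic field at the point of the same torus (with the same constants of
motion) at which the velocity is rotated by the angle `s`. -/
noncomputable def gap (σ : ℝ) (p : ℝ × Phase) (s : ℝ) : ℝ :=
  (1 + p.2 1) ^ 2 + 2 * σ * p.1 * (vel p.2 s - p.2 2)

/-- The rotated velocity together with the square of the magnetic field. -/
noncomputable def orbitPoint (σ : ℝ) (p : ℝ × Phase) (s : ℝ) : ℝ × ℝ × ℝ :=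
  (vel p.2 s, velPerp p.2 s, gap σ p s)

/-- The set of `(ε, z)` for which the expressions under consideration are smooth. -/
def domain : Set (ℝ × Phase) :=
  {p | -1 < p.2 1 ∧ 16 * p.1 ^ 2 * (p.2 2 ^ 2 + p.2 3 ^ 2) < (1 + p.2 1) ^ 4}

/-- The triples `(v, v', Q)` with `Q > 0`. -/
def positiveGap : Set (ℝ × ℝ × ℝ) := {q | 0 < q.2.2}

/-- The mean of `w s * f (v_s, v'_s, Q_s)` over the gyro-angle `s`. -/
noncomputable def mean (σ : ℝ) (w : ℝ → ℝ) (f : ℝ × ℝ × ℝ → ℝ) (p : ℝ × Phase) : ℝ :=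
  (2 * Real.pi)⁻¹ * ∫ s in (0 : ℝ)..(2 * Real.pi), w s * f (orbitPoint σ p s)

variable {σ : ℝ} {w w' : ℝ → ℝ} {f : ℝ × ℝ × ℝ → ℝ} {p : ℝ × Phase}

theorem isOpen_domain : IsOpen domain := by
  have h1 : IsOpen {p : ℝ × Phase | -1 < p.2 1} := isOpen_lt (by fun_prop) (by fun_prop)
  have h2 : IsOpen {p : ℝ × Phase |
      16 * p.1 ^ 2 * (p.2 2 ^ 2 + p.2 3 ^ 2) < (1 + p.2 1) ^ 4} :=
    isOpen_lt (by fun_prop) (by fun_prop)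
  exact h1.inter h2

theorem starInFst_domain : StarInFst domain := by
  rintro p ⟨h1, h2⟩ s hs
  refine ⟨h1, lt_of_le_of_lt ?_ h2⟩
  have : s ^ 2 ≤ 1 := pow_le_one₀ hs.1 hs.2
  have h3 : 0 ≤ 16 * p.1 ^ 2 * (p.2 2 ^ 2 + p.2 3 ^ 2) := by positivity
  calc 16 * (s * p.1) ^ 2 * (p.2 2 ^ 2 + p.2 3 ^ 2)
      = s ^ 2 * (16 * p.1 ^ 2 * (p.2 2 ^ 2 + p.2 3 ^ 2)) := by ring
    _ ≤ _ := mul_le_of_le_one_left h3 this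

theorem zero_mem_domain {z : Phase} (hz : z ∈ region) : ((0 : ℝ), z) ∈ domain := by
  have : -1 < z 1 := hz
  have h : 0 < 1 + z 1 := by linarith
  exact ⟨this, by simp; positivity⟩

theorem isOpen_positiveGap : IsOpen positiveGap := isOpen_lt continuous_const (by fun_prop)

theorem vel_sq_add_velPerp_sq (z : Phase) (s : ℝ) :
    vel z s ^ 2 + velPerp z s ^ 2 = z 2 ^ 2 + z 3 ^ 2 := by
  simp only [vel, velPerp]
  linear_combination (z 2 ^ 2 + z 3 ^ 2) * Real.sin_sq_add_cos_sq s

/-- Turning the velocity changes its `x`-component by at most twice the speed, hence `Q` by at most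
`4 |ε|` times the speed. The `16` in `domain` is the square of this `4`; squaring keeps the
condition polynomial and free of the sign of `ε`. -/
theorem gap_bound (hσ : σ ^ 2 = 1) (hp : p ∈ domain) (s : ℝ) :
    |2 * σ * p.1 * (vel p.2 s - p.2 2)| < (1 + p.2 1) ^ 2 := by
  refine abs_lt_of_sq_lt_sq ?_ (by positivity)
  have h1 := vel_sq_add_velPerp_sq p.2 s
  have h2 : (vel p.2 s - p.2 2) ^ 2 ≤ 4 * (p.2 2 ^ 2 + p.2 3 ^ 2) := by
    nlinarith [sq_nonneg (vel p.2 s + p.2 2), sq_nonneg (velPerp p.2 s), sq_nonneg (p.2 3)]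
  calc (2 * σ * p.1 * (vel p.2 s - p.2 2)) ^ 2
      = 4 * p.1 ^ 2 * (vel p.2 s - p.2 2) ^ 2 := by
        linear_combination (4 * p.1 ^ 2 * (vel p.2 s - p.2 2) ^ 2) * hσ
    _ ≤ 4 * p.1 ^ 2 * (4 * (p.2 2 ^ 2 + p.2 3 ^ 2)) := by gcongr
    _ = 16 * p.1 ^ 2 * (p.2 2 ^ 2 + p.2 3 ^ 2) := by ring
    _ < (1 + p.2 1) ^ 4 := hp.2
    _ = ((1 + p.2 1) ^ 2) ^ 2 := by ring

theorem gap_pos (hσ : σ ^ 2 = 1) (hp : p ∈ domain) (s : ℝ) : 0 < gap σ p s := by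
  have := (abs_lt.1 (gap_bound hσ hp s)).1
  unfold gap
  linarith

theorem contDiff_orbitPoint (σ : ℝ) :
    ContDiff ℝ ∞ (fun q : ℝ × (ℝ × Phase) => orbitPoint σ q.2 q.1) := by
  unfold orbitPoint gap vel velPerp
  fun_prop

theorem hasDerivAt_orbitPoint (σ : ℝ) (p : ℝ × Phase) (s : ℝ) :
    HasDerivAt (orbitPoint σ p)
      (velPerp p.2 s, -vel p.2 s, 2 * σ * p.1 * velPerp p.2 s) s := by
  have hv : HasDerivAt (vel p.2) (velPerp p.2 s) s := by
    refine (((Real.hasDerivAt_cos s).const_mul (p.2 2)).add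
      ((Real.hasDerivAt_sin s).const_mul (p.2 3))).congr_deriv ?_
    unfold velPerp; ring
  have hv' : HasDerivAt (velPerp p.2) (-vel p.2 s) s := by
    refine (((Real.hasDerivAt_cos s).const_mul (p.2 3)).sub
      ((Real.hasDerivAt_sin s).const_mul (p.2 2))).congr_deriv ?_
    unfold vel; ring
  exact hv.prodMk (hv'.prodMk (((hv.sub_const _).const_mul _).const_add _))

theorem contDiffOn_meanIntegrand (hσ : σ ^ 2 = 1) (hw : ContDiff ℝ ∞ w)
    (hf : ContDiffOn ℝ ∞ f positiveGap) :
    ContDiffOn ℝ ∞ (fun q : ℝ × (ℝ × Phase) => w q.1 * f (orbitPoint σ q.2 q.1))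
      {q | q.2 ∈ domain} :=
  (hw.comp contDiff_fst).contDiffOn.mul
    (hf.comp (contDiff_orbitPoint σ).contDiffOn fun q hq => gap_pos hσ hq q.1)

theorem isOpen_snd_domain : IsOpen {q : ℝ × (ℝ × Phase) | q.2 ∈ domain} :=
  isOpen_domain.preimage continuous_snd

theorem contDiffOn_mean (hσ : σ ^ 2 = 1) (hw : ContDiff ℝ ∞ w)
    (hf : ContDiffOn ℝ ∞ f positiveGap) : ContDiffOn ℝ ∞ (mean σ w f) domain :=
  contDiffOn_const.mul (contDiffOn_parametricIntegral isOpen_snd_domain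
    (contDiffOn_meanIntegrand hσ hw hf) isOpen_domain fun _ hp _ _ => hp)

/-- The derivative of a mean with respect to the phase space point. -/
theorem fderiv_mean_apply (hσ : σ ^ 2 = 1) (hw : ContDiff ℝ ∞ w)
    (hf : ContDiffOn ℝ ∞ f positiveGap) (hp : p ∈ domain) (u : Phase) :
    fderiv ℝ (mean σ w f) p (0, u) = (2 * Real.pi)⁻¹ * ∫ s in (0 : ℝ)..(2 * Real.pi),
      w s * fderiv ℝ f (orbitPoint σ p s) (vel u s, velPerp u s,
        2 * (1 + p.2 1) * u 1 + 2 * σ * p.1 * (vel u s - u 2)) := by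
  have hg := contDiffOn_meanIntegrand hσ hw hf
  have h1 := fderiv_parametricIntegral_apply (a := 0) (b := 2 * Real.pi) isOpen_snd_domain hg
    (w₀ := p) (fun _ _ => hp) (0, u)
  have hd := (hasFDerivAt_parametricIntegral (a := 0) (b := 2 * Real.pi) isOpen_snd_domain hg
    (w₀ := p) (fun _ _ => hp)).differentiableAt
  have h2 : fderiv ℝ (mean σ w f) p = (2 * Real.pi)⁻¹ •
      fderiv ℝ (fun p => ∫ s in (0 : ℝ)..(2 * Real.pi), w s * f (orbitPoint σ p s)) p :=
    fderiv_const_mul hd _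
  rw [h2, smul_apply, h1, smul_eq_mul]
  congr 1
  refine intervalIntegral.integral_congr fun s _ => ?_
  refine fderiv_apply_eq_of_hasDerivAt ((hg.contDiffAt
    (isOpen_snd_domain.mem_nhds hp)).differentiableAt (by simp)) ?_
  have hl : ∀ i, HasDerivAt (fun τ : ℝ => (p.2 + τ • u) i) (u i) 0 := fun i =>
    hasDerivAt_line p.2 u i 0
  have hc : HasDerivAt (fun τ : ℝ => orbitPoint σ (p.1, p.2 + τ • u) s)
      (vel u s, velPerp u s, 2 * (1 + p.2 1) * u 1 + 2 * σ * p.1 * (vel u s - u 2)) 0 := by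
    have hv : HasDerivAt (fun τ : ℝ => vel (p.2 + τ • u) s) (vel u s) 0 :=
      ((hl 2).mul_const _).add ((hl 3).mul_const _)
    have hv' : HasDerivAt (fun τ : ℝ => velPerp (p.2 + τ • u) s) (velPerp u s) 0 :=
      ((hl 3).mul_const _).sub ((hl 2).mul_const _)
    refine hv.prodMk (hv'.prodMk (((((hl 1).const_add 1).pow 2).add
      ((hv.sub (hl 2)).const_mul (2 * σ * p.1))).congr_deriv ?_))
    simp
  have hfd : HasFDerivAt f (fderiv ℝ f (orbitPoint σ p s))
      (orbitPoint σ (p.1, p.2 + (0 : ℝ) • u) s) := by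
    rw [zero_smul, add_zero]
    exact ((hf.contDiffAt (isOpen_positiveGap.mem_nhds (gap_pos hσ hp s))).differentiableAt
      (by simp)).hasFDerivAt
  have := (hfd.comp_hasDerivAt 0 hc).const_mul (w s)
  have hp' : ∀ τ : ℝ, p + ((0 : ℝ), τ • u) = (p.1, p.2 + τ • u) := fun τ =>
    Prod.ext (add_zero _) rfl
  simpa [Function.comp_def, hp'] using this

theorem orbitPoint_zero (σ : ℝ) (p : ℝ × Phase) :
    orbitPoint σ p 0 = (p.2 2, p.2 3, (1 + p.2 1) ^ 2) := by
  simp [orbitPoint, gap, vel, velPerp]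

theorem orbitPoint_two_pi (σ : ℝ) (p : ℝ × Phase) :
    orbitPoint σ p (2 * Real.pi) = orbitPoint σ p 0 := by
  simp [orbitPoint, gap, vel, velPerp]

theorem hasDerivAt_comp_orbitPoint (hσ : σ ^ 2 = 1) (hf : ContDiffOn ℝ ∞ f positiveGap)
    (hp : p ∈ domain) (s : ℝ) :
    HasDerivAt (fun s => f (orbitPoint σ p s)) (fderiv ℝ f (orbitPoint σ p s)
      (velPerp p.2 s, -vel p.2 s, 2 * σ * p.1 * velPerp p.2 s)) s :=
  HasFDerivAt.comp_hasDerivAt s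
    ((hf.contDiffAt (isOpen_positiveGap.mem_nhds (gap_pos hσ hp s))).differentiableAt
      (by simp)).hasFDerivAt (hasDerivAt_orbitPoint σ p s)

theorem continuous_comp_orbitPoint {G : Type*} [TopologicalSpace G] {g : ℝ × ℝ × ℝ → G}
    (hσ : σ ^ 2 = 1) (hg : ContinuousOn g positiveGap) (hp : p ∈ domain) :
    Continuous (fun s => g (orbitPoint σ p s)) :=
  hg.comp_continuous (continuous_iff_continuousAt.2 fun s =>
    (hasDerivAt_orbitPoint σ p s).continuousAt) fun s => gap_pos hσ hp s

theorem continuous_deriv_comp_orbitPoint (hσ : σ ^ 2 = 1) (hf : ContDiffOn ℝ ∞ f positiveGap)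
    (hp : p ∈ domain) : Continuous (fun s => fderiv ℝ f (orbitPoint σ p s)
      (velPerp p.2 s, -vel p.2 s, 2 * σ * p.1 * velPerp p.2 s)) := by
  refine (continuous_comp_orbitPoint hσ
    (hf.continuousOn_fderiv_of_isOpen isOpen_positiveGap (by simp)) hp).clm_apply ?_
  unfold vel velPerp
  fun_prop

/-- Integration by parts over the gyro-angle. -/
theorem integral_mul_deriv_orbitPoint (hσ : σ ^ 2 = 1) (hw : ∀ s, HasDerivAt w (w' s) s)
    (hw' : Continuous w') (hf : ContDiffOn ℝ ∞ f positiveGap) (hp : p ∈ domain) :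
    ∫ s in (0 : ℝ)..(2 * Real.pi), w s * fderiv ℝ f (orbitPoint σ p s)
      (velPerp p.2 s, -vel p.2 s, 2 * σ * p.1 * velPerp p.2 s) =
    (w (2 * Real.pi) - w 0) * f (orbitPoint σ p 0) -
      ∫ s in (0 : ℝ)..(2 * Real.pi), w' s * f (orbitPoint σ p s) := by
  rw [intervalIntegral.integral_mul_deriv_eq_deriv_mul (fun s _ => hw s)
    (fun s _ => hasDerivAt_comp_orbitPoint hσ hf hp s) (hw'.intervalIntegrable _ _)
    ((continuous_deriv_comp_orbitPoint hσ hf hp).intervalIntegrable _ _), orbitPoint_two_pi]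
  ring

theorem field_two (σ ε : ℝ) (z : Phase) : field σ ε z 2 = σ * z 3 * (1 + z 1) := rfl

theorem field_three (σ ε : ℝ) (z : Phase) : field σ ε z 3 = -(σ * z 2 * (1 + z 1)) := rfl

theorem field_one (σ ε : ℝ) (z : Phase) : field σ ε z 1 = ε * z 3 := rfl

/-- The derivative of a mean along the Lorentz force vector field. -/
theorem fderiv_mean_field (hσ : σ ^ 2 = 1) (hw : ContDiff ℝ ∞ w)
    (hww' : ∀ s, HasDerivAt w (w' s) s) (hw' : Continuous w')
    (hf : ContDiffOn ℝ ∞ f positiveGap) (hp : p ∈ domain) :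
    fderiv ℝ (mean σ w f) p (0, field σ p.1 p.2) = σ * (1 + p.2 1) *
      ((2 * Real.pi)⁻¹ * (w (2 * Real.pi) - w 0) * f (p.2 2, p.2 3, (1 + p.2 1) ^ 2) -
        mean σ w' f p) := by
  rw [fderiv_mean_apply hσ hw hf hp]
  have h : ∀ s, w s * fderiv ℝ f (orbitPoint σ p s) (vel (field σ p.1 p.2) s,
      velPerp (field σ p.1 p.2) s, 2 * (1 + p.2 1) * field σ p.1 p.2 1 +
        2 * σ * p.1 * (vel (field σ p.1 p.2) s - field σ p.1 p.2 2)) =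
      (σ * (1 + p.2 1)) * (w s * fderiv ℝ f (orbitPoint σ p s)
        (velPerp p.2 s, -vel p.2 s, 2 * σ * p.1 * velPerp p.2 s)) := by
    intro s
    -- Moving `z` along the Lorentz field acts on the triple like a shift of `s` at the rate `σ (1 +
    -- y)`; in the last entry this is the conservation of `Y`.
    have : (vel (field σ p.1 p.2) s, velPerp (field σ p.1 p.2) s,
        2 * (1 + p.2 1) * field σ p.1 p.2 1 +
        2 * σ * p.1 * (vel (field σ p.1 p.2) s - field σ p.1 p.2 2)) =
        (σ * (1 + p.2 1)) • (velPerp p.2 s, -vel p.2 s, 2 * σ * p.1 * velPerp p.2 s) := by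
      simp only [vel, velPerp, field_one, field_two, field_three, Prod.smul_mk, smul_eq_mul,
        Prod.mk.injEq]
      refine ⟨by ring, by ring, ?_⟩
      linear_combination (-2 * p.1 * (1 + p.2 1) * p.2 3) * hσ
    rw [this, map_smul, smul_eq_mul]
    ring
  simp only [h]
  rw [intervalIntegral.integral_const_mul, integral_mul_deriv_orbitPoint hσ hww' hw' hf hp,
    orbitPoint_zero, mean]
  ring

theorem fderiv_mean_const_field (hσ : σ ^ 2 = 1) (hf : ContDiffOn ℝ ∞ f positiveGap)
    (hp : p ∈ domain) : fderiv ℝ (mean σ (fun _ => 1) f) p (0, field σ p.1 p.2) = 0 := by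
  rw [fderiv_mean_field (w' := fun _ => 0) hσ contDiff_const (fun s => hasDerivAt_const s 1)
    continuous_const hf hp]
  simp [mean]

/-- The weight `s` is not periodic, and its boundary term is the value of `f` at the point itself.
Such means therefore integrate `f` minus its mean along the motion; all the shifts defining the
normal coordinates rest on this. -/
theorem fderiv_mean_id_field (hσ : σ ^ 2 = 1) (hf : ContDiffOn ℝ ∞ f positiveGap)
    (hp : p ∈ domain) : fderiv ℝ (mean σ (fun s => s) f) p (0, field σ p.1 p.2) =
      σ * (1 + p.2 1) * (f (p.2 2, p.2 3, (1 + p.2 1) ^ 2) - mean σ (fun _ => 1) f p) := by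
  rw [fderiv_mean_field (w := fun s => s) (w' := fun _ => 1) hσ contDiff_id
    (fun s => hasDerivAt_id s) continuous_const hf hp]
  have := Real.pi_pos
  field_simp
  ring

theorem fderiv_mean_x (hσ : σ ^ 2 = 1) (hw : ContDiff ℝ ∞ w)
    (hf : ContDiffOn ℝ ∞ f positiveGap) (hp : p ∈ domain) :
    fderiv ℝ (mean σ w f) p (0, ![1, 0, 0, 0]) = 0 := by
  rw [fderiv_mean_apply hσ hw hf hp]
  have : ((0 : ℝ), (0 : ℝ), (0 : ℝ)) = 0 := rfl
  simp [vel, velPerp, this]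

theorem mean_add_x (x : ℝ) (p : ℝ × Phase) :
    mean σ w f (p.1, p.2 + ![x, 0, 0, 0]) = mean σ w f p := by
  simp [mean, orbitPoint, gap, vel, velPerp]

end Mean

/-! ### The exact roto-rate and its Hamiltonian -/

section ExactRotoRate

variable {σ : ℝ} {p : ℝ × Phase}

/-- The integrand `1 / √Q`. -/
noncomputable def invField (q : ℝ × ℝ × ℝ) : ℝ := (√q.2.2)⁻¹

/-- The integrand `v / √Q`. -/
noncomputable def velInvField (q : ℝ × ℝ × ℝ) : ℝ := q.1 * (√q.2.2)⁻¹

/-- The integrand `v'² / √Q`. -/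
noncomputable def perpSqInvField (q : ℝ × ℝ × ℝ) : ℝ := q.2.1 ^ 2 * (√q.2.2)⁻¹

/-- The integrand `v √Q`. -/
noncomputable def velField (q : ℝ × ℝ × ℝ) : ℝ := q.1 * √q.2.2

theorem contDiffOn_sqrt_gap : ContDiffOn ℝ ∞ (fun q : ℝ × ℝ × ℝ => √q.2.2) positiveGap :=
  (contDiff_snd.snd).contDiffOn.sqrt fun _ hq => (ne_of_gt hq)

theorem contDiffOn_invField : ContDiffOn ℝ ∞ invField positiveGap :=
  contDiffOn_sqrt_gap.inv fun _ hq => (Real.sqrt_pos.2 hq).ne'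

theorem contDiffOn_velInvField : ContDiffOn ℝ ∞ velInvField positiveGap :=
  contDiff_fst.contDiffOn.mul contDiffOn_invField

theorem contDiffOn_perpSqInvField : ContDiffOn ℝ ∞ perpSqInvField positiveGap :=
  ((contDiff_snd.fst).pow 2).contDiffOn.mul contDiffOn_invField

theorem contDiffOn_velField : ContDiffOn ℝ ∞ velField positiveGap :=
  contDiff_fst.contDiffOn.mul contDiffOn_sqrt_gap

/-- The mean of the inverse magnetic field over a torus. -/
noncomputable def meanInvField (σ : ℝ) (p : ℝ × Phase) : ℝ := mean σ (fun _ => 1) invField p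

/-- The coefficient of `∂_x` in the roto-rate. -/
noncomputable def driftCoeff (σ : ℝ) (p : ℝ × Phase) : ℝ :=
  -(p.1 * mean σ (fun _ => 1) velInvField p)

/-- The action variable as a manifestly smooth function of `(ε, z)`. -/
noncomputable def smoothAction (σ : ℝ) (p : ℝ × Phase) : ℝ :=
  p.1 * σ * mean σ (fun _ => 1) velField p

/-- The roto-rate as a smooth function of `(ε, z)`. -/
noncomputable def exactRotoRate (σ : ℝ) (p : ℝ × Phase) : Phase :=
  meanInvField σ p • field σ p.1 p.2 + driftCoeff σ p • ![1, 0, 0, 0]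

theorem contDiffOn_meanInvField (hσ : σ ^ 2 = 1) : ContDiffOn ℝ ∞ (meanInvField σ) domain :=
  contDiffOn_mean hσ contDiff_const contDiffOn_invField

theorem contDiffOn_driftCoeff (hσ : σ ^ 2 = 1) : ContDiffOn ℝ ∞ (driftCoeff σ) domain :=
  (contDiff_fst.contDiffOn.mul (contDiffOn_mean hσ contDiff_const contDiffOn_velInvField)).neg

theorem contDiffOn_smoothAction (hσ : σ ^ 2 = 1) : ContDiffOn ℝ ∞ (smoothAction σ) domain :=
  (contDiff_fst.contDiffOn.mul contDiffOn_const).mul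
    (contDiffOn_mean hσ contDiff_const contDiffOn_velField)

theorem contDiffOn_exactRotoRate (hσ : σ ^ 2 = 1) : ContDiffOn ℝ ∞ (exactRotoRate σ) domain :=
  ((contDiffOn_meanInvField hσ).smul (contDiff_field σ).contDiffOn).add
    ((contDiffOn_driftCoeff hσ).smul contDiffOn_const)

theorem exactRotoRate_add_x (x : ℝ) (p : ℝ × Phase) :
    exactRotoRate σ (p.1, p.2 + ![x, 0, 0, 0]) = exactRotoRate σ p := by
  have : field σ p.1 (p.2 + ![x, 0, 0, 0]) = field σ p.1 p.2 := by simp [field]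
  simp only [exactRotoRate, meanInvField, driftCoeff, mean_add_x, this]

theorem gap_zero (σ : ℝ) (z : Phase) (s : ℝ) : gap σ (0, z) s = (1 + z 1) ^ 2 := by
  simp [gap]

theorem one_add_pos (hp : p ∈ domain) : 0 < 1 + p.2 1 := by linarith [hp.1]

theorem sqrt_one_add_sq (hp : p ∈ domain) : √((1 + p.2 1) ^ 2) = 1 + p.2 1 :=
  Real.sqrt_sq (one_add_pos hp).le

theorem meanInvField_pos (hσ : σ ^ 2 = 1) (hp : p ∈ domain) : 0 < meanInvField σ p := by
  unfold meanInvField mean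
  refine mul_pos (inv_pos.2 Real.two_pi_pos) ?_
  refine intervalIntegral.intervalIntegral_pos_of_pos ?_ (fun s => ?_) Real.two_pi_pos
  · exact (continuous_const.mul (continuous_comp_orbitPoint hσ contDiffOn_invField.continuousOn
      hp)).intervalIntegrable _ _
  · rw [one_mul]
    exact inv_pos.2 (Real.sqrt_pos.2 (gap_pos hσ hp s))

theorem meanInvField_zero {z : Phase} (hz : z ∈ region) :
    meanInvField σ (0, z) = (1 + z 1)⁻¹ := by
  have h := sqrt_one_add_sq (zero_mem_domain hz)
  have := Real.pi_pos
  simp only [meanInvField, mean, invField, orbitPoint, gap_zero, h]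
  simp
  field_simp

theorem exactRotoRate_zero {z : Phase} (hz : z ∈ region) :
    exactRotoRate σ (0, z) = limitingRotoRate σ z := by
  simp only [exactRotoRate, meanInvField_zero hz, driftCoeff, field_zero]
  rw [inv_smul_smul₀ (one_add_pos (zero_mem_domain hz)).ne']
  simp

theorem fderiv_apply_exactRotoRate {F : ℝ × Phase → ℝ} :
    fderiv ℝ F p (0, exactRotoRate σ p) = meanInvField σ p * fderiv ℝ F p (0, field σ p.1 p.2) +
      driftCoeff σ p * fderiv ℝ F p (0, ![1, 0, 0, 0]) := by
  have : ((0 : ℝ), exactRotoRate σ p) = meanInvField σ p • ((0 : ℝ), field σ p.1 p.2) +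
      driftCoeff σ p • ((0 : ℝ), (![1, 0, 0, 0] : Phase)) := by
    simp [exactRotoRate]
  rw [this, map_add, map_smul, map_smul, smul_eq_mul, smul_eq_mul]

theorem fderiv_mean_const_exactRotoRate (hσ : σ ^ 2 = 1) {f : ℝ × ℝ × ℝ → ℝ}
    (hf : ContDiffOn ℝ ∞ f positiveGap) (hp : p ∈ domain) :
    fderiv ℝ (mean σ (fun _ => 1) f) p (0, exactRotoRate σ p) = 0 := by
  rw [fderiv_apply_exactRotoRate, fderiv_mean_const_field hσ hf hp,
    fderiv_mean_x hσ contDiff_const hf hp]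
  simp

theorem fderiv_mean_id_exactRotoRate (hσ : σ ^ 2 = 1) {f : ℝ × ℝ × ℝ → ℝ}
    (hf : ContDiffOn ℝ ∞ f positiveGap) (hp : p ∈ domain) :
    fderiv ℝ (mean σ (fun s => s) f) p (0, exactRotoRate σ p) = meanInvField σ p *
      (σ * (1 + p.2 1) * (f (p.2 2, p.2 3, (1 + p.2 1) ^ 2) - mean σ (fun _ => 1) f p)) := by
  rw [fderiv_apply_exactRotoRate, fderiv_mean_id_field hσ hf hp,
    fderiv_mean_x (w := fun s => s) hσ contDiff_id hf hp]
  simp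

theorem differentiableAt_of_domain {E : Type*} [NormedAddCommGroup E] [NormedSpace ℝ E]
    {F : ℝ × Phase → E} (hF : ContDiffOn ℝ ∞ F domain) (hp : p ∈ domain) :
    DifferentiableAt ℝ F p :=
  (hF.contDiffAt (isOpen_domain.mem_nhds hp)).differentiableAt (by simp)

theorem hasDerivAt_of_domain {E : Type*} [NormedAddCommGroup E] [NormedSpace ℝ E]
    {F : ℝ × Phase → E} (hF : ContDiffOn ℝ ∞ F domain) (hp : p ∈ domain) (u : Phase) :
    HasDerivAt (fun τ : ℝ => F (p + τ • ((0 : ℝ), u))) (fderiv ℝ F p (0, u)) 0 := by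
  have h := (differentiableAt_of_domain hF hp).hasFDerivAt.hasLineDerivAt ((0 : ℝ), u)
  exact h

theorem hasFDerivAt_slice {E : Type*} [NormedAddCommGroup E] [NormedSpace ℝ E]
    {F : ℝ × Phase → E} {ε : ℝ} {z : Phase} (hF : DifferentiableAt ℝ F (ε, z)) :
    HasFDerivAt (fun z => F (ε, z))
      ((fderiv ℝ F (ε, z)).comp (ContinuousLinearMap.inr ℝ ℝ Phase)) z :=
  hF.hasFDerivAt.comp z (hasFDerivAt_prodMk_right ε z)

theorem fderiv_slice {E : Type*} [NormedAddCommGroup E] [NormedSpace ℝ E]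
    {F : ℝ × Phase → E} {ε : ℝ} {z : Phase} (hF : DifferentiableAt ℝ F (ε, z)) (u : Phase) :
    fderiv ℝ (fun z => F (ε, z)) z u = fderiv ℝ F (ε, z) (0, u) := by
  rw [(hasFDerivAt_slice hF).fderiv]
  simp

/-- The derivative of `c * F`, where `c` depends on `ε` only, in the directions with constant
`ε`. -/
theorem fderiv_fst_mul {F : ℝ × Phase → ℝ} (hF : ContDiffOn ℝ ∞ F domain) (hp : p ∈ domain)
    {c : ℝ → ℝ} (hc : Differentiable ℝ c) (u : Phase) :
    fderiv ℝ (fun p => c p.1 * F p) p (0, u) = c p.1 * fderiv ℝ F p (0, u) := by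
  have hd := differentiableAt_of_domain hF hp
  refine fderiv_apply_eq_of_hasDerivAt
    (((hc _).comp p differentiableAt_fst).mul hd) ?_
  have := (hasDerivAt_of_domain hF hp u).const_mul (c p.1)
  simpa using this

theorem driftCoeff_eq (σ : ℝ) :
    driftCoeff σ = fun p => -p.1 * mean σ (fun _ => 1) velInvField p := by
  funext p
  simp [driftCoeff]

theorem fderiv_driftCoeff (hσ : σ ^ 2 = 1) (hp : p ∈ domain) (u : Phase) :
    fderiv ℝ (driftCoeff σ) p (0, u) =
      -p.1 * fderiv ℝ (mean σ (fun _ => 1) velInvField) p (0, u) := by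
  rw [driftCoeff_eq]
  exact fderiv_fst_mul (c := fun ε => -ε) (contDiffOn_mean hσ contDiff_const
    contDiffOn_velInvField) hp (by fun_prop) u

theorem fderiv_smoothAction (hσ : σ ^ 2 = 1) (hp : p ∈ domain) (u : Phase) :
    fderiv ℝ (smoothAction σ) p (0, u) =
      p.1 * σ * fderiv ℝ (mean σ (fun _ => 1) velField) p (0, u) :=
  fderiv_fst_mul (c := fun ε => ε * σ) (contDiffOn_mean hσ contDiff_const
    contDiffOn_velField) hp (by fun_prop) u

/-- The exact roto-rate commutes with the Lorentz force. -/
theorem lieBracket_exactRotoRate (hσ : σ ^ 2 = 1) {ε : ℝ} {z : Phase} (hp : (ε, z) ∈ domain) :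
    VectorField.lieBracket ℝ (fun z => exactRotoRate σ (ε, z)) (field σ ε) z = 0 := by
  have hA := differentiableAt_of_domain (contDiffOn_meanInvField hσ) hp
  have hB := differentiableAt_of_domain (contDiffOn_driftCoeff hσ) hp
  have hA' := (hasFDerivAt_slice hA).differentiableAt
  have hB' := (hasFDerivAt_slice hB).differentiableAt
  have hX := (differentiable_field σ ε).differentiableAt (x := z)
  have h1 : (fun z => exactRotoRate σ (ε, z)) =
      (fun z => meanInvField σ (ε, z) • field σ ε z) +
        fun z => driftCoeff σ (ε, z) • (fun _ : Phase => (![1, 0, 0, 0] : Phase)) z := rfl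
  rw [h1, VectorField.lieBracket_add_left (hA'.fun_smul hX)
    (hB'.fun_smul (differentiableAt_const _)),
    VectorField.lieBracket_smul_left hA' hX,
    VectorField.lieBracket_smul_left hB' (differentiableAt_const _),
    fderiv_slice hA, fderiv_slice hB, fderiv_driftCoeff hσ hp,
    show fderiv ℝ (meanInvField σ) (ε, z) (0, field σ ε z) = 0 from
      fderiv_mean_const_field hσ contDiffOn_invField hp,
    show fderiv ℝ (mean σ (fun _ => 1) velInvField) (ε, z) (0, field σ ε z) = 0 from
      fderiv_mean_const_field hσ contDiffOn_velInvField hp]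
  have h2 : VectorField.lieBracket ℝ (fun _ : Phase => (![1, 0, 0, 0] : Phase)) (field σ ε) z
      = 0 := by
    rw [VectorField.lieBracket, fderiv_field_apply]
    ext i
    fin_cases i <;> simp
  rw [h2]
  simp

/-- The symplectic form in coordinates. -/
theorem omega_eq (σ ε : ℝ) (z u w : Phase) :
    omega σ ε z u w = -(ε * (u 2 * w 0 - w 2 * u 0 + (u 3 * w 1 - w 3 * u 1)) -
      σ * (1 + z 1) * (u 1 * w 0 - w 1 * u 0)) := by
  have h : ∀ u w : Phase, fderiv ℝ (fun p => liouville σ ε p w) z u =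
      ε * (u 2 * w 0 + u 3 * w 1) - σ * (1 + z 1) * u 1 * w 0 := by
    intro u w
    refine fderiv_apply_eq_of_hasDerivAt ?_ ?_
    · unfold liouville; fun_prop
    · have hl := fun i => hasDerivAt_line z u i 0
      refine (((((hl 2).mul_const (w 0)).add ((hl 3).mul_const (w 1))).const_mul ε).sub
        ((((hl 1).add (((hl 1).pow 2).div_const 2)).const_mul σ).mul_const (w 0))).congr_deriv ?_
      simp only [zero_smul, add_zero]
      push_cast
      ring
  rw [omega, h, h]
  ring

theorem vel_mul_add (z u : Phase) (s : ℝ) :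
    vel u s * vel z s + velPerp u s * velPerp z s = z 2 * u 2 + z 3 * u 3 := by
  simp only [vel, velPerp]
  linear_combination (z 2 * u 2 + z 3 * u 3) * Real.sin_sq_add_cos_sq s

theorem continuous_vel (u : Phase) : Continuous (vel u) := by unfold vel; fun_prop

theorem continuous_velPerp (u : Phase) : Continuous (velPerp u) := by unfold velPerp; fun_prop

theorem continuous_sqrt_gap (hσ : σ ^ 2 = 1) (hp : p ∈ domain) :
    Continuous (fun s => √(gap σ p s)) :=
  continuous_comp_orbitPoint hσ contDiffOn_sqrt_gap.continuousOn hp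

theorem continuous_inv_sqrt_gap (hσ : σ ^ 2 = 1) (hp : p ∈ domain) :
    Continuous (fun s => (√(gap σ p s))⁻¹) :=
  continuous_comp_orbitPoint hσ contDiffOn_invField.continuousOn hp

theorem fderiv_sqrt_gap {q : ℝ × ℝ × ℝ} (hq : q ∈ positiveGap) (v : ℝ × ℝ × ℝ) :
    fderiv ℝ (fun q : ℝ × ℝ × ℝ => √q.2.2) q v = v.2.2 * (√q.2.2)⁻¹ / 2 := by
  refine fderiv_apply_eq_of_hasDerivAt ((contDiffOn_sqrt_gap.contDiffAt
    (isOpen_positiveGap.mem_nhds hq)).differentiableAt (by simp)) ?_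
  have h1 : HasDerivAt (fun τ : ℝ => (q + τ • v).2.2) v.2.2 0 := by
    simpa using ((hasDerivAt_id (0 : ℝ)).mul_const v.2.2).const_add q.2.2
  have hq' : (q + (0 : ℝ) • v).2.2 ≠ 0 := by simpa using (ne_of_gt hq)
  refine (h1.sqrt hq').congr_deriv ?_
  rw [zero_smul, add_zero]
  have := Real.sqrt_pos.2 hq
  field_simp

theorem fderiv_velField {q : ℝ × ℝ × ℝ} (hq : q ∈ positiveGap) (v : ℝ × ℝ × ℝ) :
    fderiv ℝ velField q v = v.1 * √q.2.2 + q.1 * (v.2.2 * (√q.2.2)⁻¹ / 2) := by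
  have hd : DifferentiableAt ℝ (fun q : ℝ × ℝ × ℝ => √q.2.2) q :=
    (contDiffOn_sqrt_gap.contDiffAt (isOpen_positiveGap.mem_nhds hq)).differentiableAt (by simp)
  have h : velField = fun q : ℝ × ℝ × ℝ => q.1 * √q.2.2 := rfl
  rw [h, fderiv_fun_mul differentiableAt_fst hd, add_apply, smul_apply, smul_apply,
    fderiv_sqrt_gap hq]
  simp [fderiv_fst]
  ring

/-- Integration by parts for the mean of the velocity with weight the magnetic field. -/
theorem integral_vel_mul_sqrt_gap (hσ : σ ^ 2 = 1) (hp : p ∈ domain) (u : Phase) :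
    ∫ s in (0 : ℝ)..(2 * Real.pi), vel u s * √(gap σ p s) =
      σ * p.1 * ∫ s in (0 : ℝ)..(2 * Real.pi),
        velPerp u s * velPerp p.2 s * (√(gap σ p s))⁻¹ := by
  have hw : ∀ s, HasDerivAt (fun s => -velPerp u s) (vel u s) s := by
    intro s
    refine (((Real.hasDerivAt_cos s).const_mul (u 3)).sub
      ((Real.hasDerivAt_sin s).const_mul (u 2))).neg.congr_deriv ?_
    unfold vel; ring
  have h := integral_mul_deriv_orbitPoint hσ hw (continuous_vel u) contDiffOn_sqrt_gap hp
  have h0 : -velPerp u (2 * Real.pi) - -velPerp u 0 = 0 := by simp [velPerp]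
  rw [h0, zero_mul, zero_sub, eq_neg_iff_add_eq_zero, add_comm,
    ← eq_neg_iff_add_eq_zero] at h
  refine h.trans ?_
  rw [← intervalIntegral.integral_neg, ← intervalIntegral.integral_const_mul]
  refine intervalIntegral.integral_congr fun s _ => ?_
  have hs : orbitPoint σ p s ∈ positiveGap := gap_pos hσ hp s
  simp only [fderiv_sqrt_gap hs]
  simp only [orbitPoint]
  ring

/-- The new integrand `(ε v_y)² / (1 + y)` is that of the integral of `ε v_y dy` over the closed
orbit of the roto-rate, which links the action to the loop integral. -/
theorem smoothAction_eq (hσ : σ ^ 2 = 1) (hp : p ∈ domain) :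
    smoothAction σ p = p.1 ^ 2 * mean σ (fun _ => 1) perpSqInvField p := by
  have h := integral_vel_mul_sqrt_gap hσ hp p.2
  simp only [smoothAction, mean, velField, perpSqInvField, orbitPoint, one_mul]
  rw [h]
  simp only [← sq]
  linear_combination (p.1 ^ 2 * ((2 * Real.pi)⁻¹ * ∫ s in (0 : ℝ)..(2 * Real.pi),
    velPerp p.2 s ^ 2 * (√(gap σ p s))⁻¹)) * hσ

/-- The exact roto-rate is Hamiltonian with the action variable as Hamiltonian. -/
theorem omega_exactRotoRate (hσ : σ ^ 2 = 1) (hp : p ∈ domain) (u : Phase) :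
    omega σ p.1 p.2 (exactRotoRate σ p) u = fderiv ℝ (smoothAction σ) p (0, u) := by
  have hs := continuous_sqrt_gap hσ hp
  have hi := continuous_inv_sqrt_gap hσ hp
  have c1 : Continuous (fun s => vel u s * √(gap σ p s)) := (continuous_vel u).mul hs
  have c2 : Continuous (fun s => vel p.2 s * (√(gap σ p s))⁻¹) := (continuous_vel _).mul hi
  have c3 : Continuous (fun s => vel u s * vel p.2 s * (√(gap σ p s))⁻¹) :=
    ((continuous_vel u).mul (continuous_vel _)).mul hi
  have c4 : Continuous (fun s => velPerp u s * velPerp p.2 s * (√(gap σ p s))⁻¹) :=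
    ((continuous_velPerp u).mul (continuous_velPerp _)).mul hi
  have e1 := integral_vel_mul_sqrt_gap hσ hp u
  -- Rotations preserve the inner product of velocities, so the two integrals combine into a
  -- multiple of `meanInvField`.
  have e2 : (∫ s in (0 : ℝ)..(2 * Real.pi), vel u s * vel p.2 s * (√(gap σ p s))⁻¹) +
      (∫ s in (0 : ℝ)..(2 * Real.pi), velPerp u s * velPerp p.2 s * (√(gap σ p s))⁻¹) =
      (p.2 2 * u 2 + p.2 3 * u 3) * ∫ s in (0 : ℝ)..(2 * Real.pi), (√(gap σ p s))⁻¹ := by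
    rw [← intervalIntegral.integral_add (c3.intervalIntegrable _ _) (c4.intervalIntegrable _ _),
      ← intervalIntegral.integral_const_mul]
    refine intervalIntegral.integral_congr fun s _ => ?_
    simp only [← vel_mul_add p.2 u s]
    ring
  have e3 : (∫ s in (0 : ℝ)..(2 * Real.pi), 1 * fderiv ℝ velField (orbitPoint σ p s)
      (vel u s, velPerp u s, 2 * (1 + p.2 1) * u 1 + 2 * σ * p.1 * (vel u s - u 2))) =
      (∫ s in (0 : ℝ)..(2 * Real.pi), vel u s * √(gap σ p s)) +
      ((1 + p.2 1) * u 1 - σ * p.1 * u 2) *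
        (∫ s in (0 : ℝ)..(2 * Real.pi), vel p.2 s * (√(gap σ p s))⁻¹) +
      σ * p.1 * ∫ s in (0 : ℝ)..(2 * Real.pi), vel u s * vel p.2 s * (√(gap σ p s))⁻¹ := by
    have d2 : Continuous (fun s => ((1 + p.2 1) * u 1 - σ * p.1 * u 2) *
        (vel p.2 s * (√(gap σ p s))⁻¹)) := continuous_const.mul c2
    have d3 : Continuous (fun s => σ * p.1 * (vel u s * vel p.2 s * (√(gap σ p s))⁻¹)) :=
      continuous_const.mul c3
    have d12 : Continuous (fun s => vel u s * √(gap σ p s) +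
        ((1 + p.2 1) * u 1 - σ * p.1 * u 2) * (vel p.2 s * (√(gap σ p s))⁻¹)) := c1.add d2
    rw [← intervalIntegral.integral_const_mul, ← intervalIntegral.integral_const_mul,
      ← intervalIntegral.integral_add (c1.intervalIntegrable _ _) (d2.intervalIntegrable _ _),
      ← intervalIntegral.integral_add (d12.intervalIntegrable _ _) (d3.intervalIntegrable _ _)]
    refine intervalIntegral.integral_congr fun s _ => ?_
    have hs : orbitPoint σ p s ∈ positiveGap := gap_pos hσ hp s
    simp only [fderiv_velField hs]
    simp only [orbitPoint]
    ring
  rw [fderiv_smoothAction hσ hp, fderiv_mean_apply hσ contDiff_const contDiffOn_velField hp, e3,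
    omega_eq]
  have r0 : exactRotoRate σ p 0 = meanInvField σ p * (p.1 * p.2 2) + driftCoeff σ p := by
    simp [exactRotoRate, field]
  have r1 : exactRotoRate σ p 1 = meanInvField σ p * (p.1 * p.2 3) := by
    simp [exactRotoRate, field]
  have r2 : exactRotoRate σ p 2 = meanInvField σ p * (σ * p.2 3 * (1 + p.2 1)) := by
    simp [exactRotoRate, field]
  have r3 : exactRotoRate σ p 3 = -(meanInvField σ p * (σ * p.2 2 * (1 + p.2 1))) := by
    simp [exactRotoRate, field]
  have hA : meanInvField σ p = (2 * Real.pi)⁻¹ *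
      ∫ s in (0 : ℝ)..(2 * Real.pi), (√(gap σ p s))⁻¹ := by
    simp [meanInvField, mean, invField, orbitPoint]
  have hB : driftCoeff σ p = -(p.1 * ((2 * Real.pi)⁻¹ *
      ∫ s in (0 : ℝ)..(2 * Real.pi), vel p.2 s * (√(gap σ p s))⁻¹)) := by
    simp [driftCoeff, mean, velInvField, orbitPoint]
  rw [r0, r1, r2, r3, hA, hB, e1]
  set I2 := ∫ s in (0 : ℝ)..(2 * Real.pi), vel p.2 s * (√(gap σ p s))⁻¹
  set I3 := ∫ s in (0 : ℝ)..(2 * Real.pi), vel u s * vel p.2 s * (√(gap σ p s))⁻¹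
  set I4 := ∫ s in (0 : ℝ)..(2 * Real.pi), velPerp u s * velPerp p.2 s * (√(gap σ p s))⁻¹
  set I5 := ∫ s in (0 : ℝ)..(2 * Real.pi), (√(gap σ p s))⁻¹
  linear_combination (-p.1 ^ 2 * (2 * Real.pi)⁻¹) * e2 -
    (p.1 ^ 2 * (2 * Real.pi)⁻¹ * (I3 + I4 - u 2 * I2)) * hσ

end ExactRotoRate

/-! ### Coordinates that straighten the roto-rate -/

section NormalForm

variable {σ : ℝ} {p : ℝ × Phase}

/-- The angle by which the velocity has to be rotated to make the roto-rate rigid. -/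
noncomputable def angleShift (σ : ℝ) (p : ℝ × Phase) : ℝ :=
  mean σ (fun s => s) invField p / meanInvField σ p

/-- The oscillation of `x` along the orbits of the roto-rate. -/
noncomputable def xShift (σ : ℝ) (p : ℝ × Phase) : ℝ :=
  -σ * (p.1 * mean σ (fun s => s) velInvField p +
    driftCoeff σ p / meanInvField σ p * mean σ (fun s => s) invField p)

/-- A function whose derivative along the roto-rate is the oscillation of the Liouville form. -/
noncomputable def actionShift (σ : ℝ) (p : ℝ × Phase) : ℝ :=
  σ * (p.1 ^ 2 * mean σ (fun s => s) perpSqInvField p -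
    smoothAction σ p / meanInvField σ p * mean σ (fun s => s) invField p)

/-- Coordinates in which the roto-rate is the limiting roto-rate. -/
noncomputable def normalCoords (σ : ℝ) (p : ℝ × Phase) : Phase :=
  ![p.2 0 + xShift σ p, (1 + p.2 1) ^ 2 - 2 * σ * p.1 * p.2 2, vel p.2 (angleShift σ p),
    velPerp p.2 (angleShift σ p)]

theorem contDiffOn_mean_id (hσ : σ ^ 2 = 1) {f : ℝ × ℝ × ℝ → ℝ}
    (hf : ContDiffOn ℝ ∞ f positiveGap) : ContDiffOn ℝ ∞ (mean σ (fun s => s) f) domain :=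
  contDiffOn_mean hσ contDiff_id hf

theorem contDiffOn_angleShift (hσ : σ ^ 2 = 1) : ContDiffOn ℝ ∞ (angleShift σ) domain :=
  (contDiffOn_mean_id hσ contDiffOn_invField).div (contDiffOn_meanInvField hσ)
    fun _ hp => (meanInvField_pos hσ hp).ne'

theorem contDiffOn_xShift (hσ : σ ^ 2 = 1) : ContDiffOn ℝ ∞ (xShift σ) domain :=
  contDiffOn_const.mul ((contDiff_fst.contDiffOn.mul
    (contDiffOn_mean_id hσ contDiffOn_velInvField)).add
    (((contDiffOn_driftCoeff hσ).div (contDiffOn_meanInvField hσ)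
      fun _ hp => (meanInvField_pos hσ hp).ne').mul (contDiffOn_mean_id hσ contDiffOn_invField)))

theorem contDiffOn_actionShift (hσ : σ ^ 2 = 1) : ContDiffOn ℝ ∞ (actionShift σ) domain :=
  contDiffOn_const.mul (((contDiff_fst.pow 2).contDiffOn.mul
    (contDiffOn_mean_id hσ contDiffOn_perpSqInvField)).sub
    (((contDiffOn_smoothAction hσ).div (contDiffOn_meanInvField hσ)
      fun _ hp => (meanInvField_pos hσ hp).ne').mul (contDiffOn_mean_id hσ contDiffOn_invField)))

theorem contDiffOn_normalCoords (hσ : σ ^ 2 = 1) : ContDiffOn ℝ ∞ (normalCoords σ) domain := by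
  have hx := contDiffOn_xShift hσ
  have hg := contDiffOn_angleShift hσ
  have hc : ∀ i, ContDiffOn ℝ ∞ (fun p : ℝ × Phase => p.2 i) domain := fun i =>
    ContDiff.contDiffOn (by fun_prop)
  rw [contDiffOn_pi]
  intro i
  fin_cases i
  · exact (hc 0).add hx
  · exact ContDiff.contDiffOn (f := fun p : ℝ × Phase =>
      (1 + p.2 1) ^ 2 - 2 * σ * p.1 * p.2 2) (by fun_prop)
  · exact ((hc 2).mul hg.cos).add ((hc 3).mul hg.sin)
  · exact ((hc 3).mul hg.cos).sub ((hc 2).mul hg.sin)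

theorem exactRotoRate_apply_zero : exactRotoRate σ p 0 =
    meanInvField σ p * (p.1 * p.2 2) + driftCoeff σ p := by
  simp [exactRotoRate, field]

theorem exactRotoRate_apply_one : exactRotoRate σ p 1 = meanInvField σ p * (p.1 * p.2 3) := by
  simp [exactRotoRate, field]

theorem exactRotoRate_apply_two :
    exactRotoRate σ p 2 = meanInvField σ p * (σ * p.2 3 * (1 + p.2 1)) := by
  simp [exactRotoRate, field]

theorem exactRotoRate_apply_three :
    exactRotoRate σ p 3 = -(meanInvField σ p * (σ * p.2 2 * (1 + p.2 1))) := by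
  simp [exactRotoRate, field]

theorem hasDerivAt_fst_line (p : ℝ × Phase) (u : Phase) :
    HasDerivAt (fun τ : ℝ => (p + τ • ((0 : ℝ), u)).1) 0 0 := by
  simpa using hasDerivAt_const (0 : ℝ) p.1

theorem hasDerivAt_snd_line (p : ℝ × Phase) (u : Phase) (i : Fin 4) :
    HasDerivAt (fun τ : ℝ => (p + τ • ((0 : ℝ), u)).2 i) (u i) 0 :=
  hasDerivAt_line p.2 u i 0

theorem fderiv_driftCoeff_exactRotoRate (hσ : σ ^ 2 = 1) (hp : p ∈ domain) :
    fderiv ℝ (driftCoeff σ) p (0, exactRotoRate σ p) = 0 := by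
  rw [fderiv_driftCoeff hσ hp, fderiv_mean_const_exactRotoRate hσ contDiffOn_velInvField hp,
    mul_zero]

theorem fderiv_smoothAction_exactRotoRate (hσ : σ ^ 2 = 1) (hp : p ∈ domain) :
    fderiv ℝ (smoothAction σ) p (0, exactRotoRate σ p) = 0 := by
  rw [fderiv_smoothAction hσ hp, fderiv_mean_const_exactRotoRate hσ contDiffOn_velField hp,
    mul_zero]

theorem fderiv_mean_id_invField (hσ : σ ^ 2 = 1) (hp : p ∈ domain) :
    fderiv ℝ (mean σ (fun s => s) invField) p (0, exactRotoRate σ p) =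
      meanInvField σ p * (σ * (1 - (1 + p.2 1) * meanInvField σ p)) := by
  have h := one_add_pos hp
  rw [fderiv_mean_id_exactRotoRate hσ contDiffOn_invField hp, invField, sqrt_one_add_sq hp,
    ← meanInvField]
  field_simp

/-- Along the roto-rate the velocity turns at the rate `σ (1 + y) A` instead of `σ`; the shift makes
up the difference. -/
theorem fderiv_angleShift (hσ : σ ^ 2 = 1) (hp : p ∈ domain) :
    fderiv ℝ (angleShift σ) p (0, exactRotoRate σ p) =
      σ * (1 - (1 + p.2 1) * meanInvField σ p) := by
  have hA := (meanInvField_pos hσ hp).ne'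
  refine fderiv_apply_eq_of_hasDerivAt (differentiableAt_of_domain (contDiffOn_angleShift hσ) hp) ?_
  have h1 := hasDerivAt_of_domain (contDiffOn_mean_id hσ contDiffOn_invField) hp (exactRotoRate σ p)
  have h2 := hasDerivAt_of_domain (contDiffOn_meanInvField hσ) hp (exactRotoRate σ p)
  rw [fderiv_mean_id_invField hσ hp] at h1
  rw [show fderiv ℝ (meanInvField σ) p (0, exactRotoRate σ p) = 0 from
    fderiv_mean_const_exactRotoRate hσ contDiffOn_invField hp] at h2
  refine (h1.div h2 (by simpa using hA)).congr_deriv ?_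
  simp only [zero_smul, add_zero, mul_zero, sub_zero]
  field_simp

/-- This cancels the `x`-component of the roto-rate. A primitive exists because `driftCoeff` was
chosen to give that component zero mean over an orbit. -/
theorem fderiv_xShift (hσ : σ ^ 2 = 1) (hp : p ∈ domain) :
    fderiv ℝ (xShift σ) p (0, exactRotoRate σ p) =
      -(meanInvField σ p * (p.1 * p.2 2) + driftCoeff σ p) := by
  have hA := (meanInvField_pos hσ hp).ne'
  have ha := one_add_pos hp
  refine fderiv_apply_eq_of_hasDerivAt (differentiableAt_of_domain (contDiffOn_xShift hσ) hp) ?_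
  have h0 := hasDerivAt_fst_line p (exactRotoRate σ p)
  have h1 := hasDerivAt_of_domain (contDiffOn_mean_id hσ contDiffOn_invField) hp (exactRotoRate σ p)
  have h2 := hasDerivAt_of_domain (contDiffOn_meanInvField hσ) hp (exactRotoRate σ p)
  have h3 := hasDerivAt_of_domain (contDiffOn_mean_id hσ contDiffOn_velInvField) hp
    (exactRotoRate σ p)
  have h4 := hasDerivAt_of_domain (contDiffOn_driftCoeff hσ) hp (exactRotoRate σ p)
  rw [fderiv_mean_id_invField hσ hp] at h1
  rw [show fderiv ℝ (meanInvField σ) p (0, exactRotoRate σ p) = 0 from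
    fderiv_mean_const_exactRotoRate hσ contDiffOn_invField hp] at h2
  rw [fderiv_mean_id_exactRotoRate hσ contDiffOn_velInvField hp, velInvField,
    sqrt_one_add_sq hp] at h3
  rw [fderiv_driftCoeff_exactRotoRate hσ hp] at h4
  refine (((h0.mul h3).add ((h4.div h2 (by simpa using hA)).mul h1)).const_mul (-σ)).congr_deriv ?_
  simp only [zero_smul, add_zero, mul_zero, zero_mul, sub_zero, Pi.div_apply, zero_add, zero_div]
  have hB : driftCoeff σ p = -(p.1 * mean σ (fun _ => 1) velInvField p) := rfl
  rw [hB]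
  field_simp
  linear_combination
    (-meanInvField σ p * p.1 * p.2 2 + p.1 * mean σ (fun _ => 1) velInvField p) * hσ

/-- The rate of `ε v_y dy` along the roto-rate, minus its mean, has zero orbit average and is
therefore a derivative along the roto-rate. -/
theorem fderiv_actionShift (hσ : σ ^ 2 = 1) (hp : p ∈ domain) :
    fderiv ℝ (actionShift σ) p (0, exactRotoRate σ p) =
      meanInvField σ p * (p.1 * p.2 3) ^ 2 - smoothAction σ p := by
  have hA := (meanInvField_pos hσ hp).ne'
  have ha := one_add_pos hp
  refine fderiv_apply_eq_of_hasDerivAt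
    (differentiableAt_of_domain (contDiffOn_actionShift hσ) hp) ?_
  have h0 := hasDerivAt_fst_line p (exactRotoRate σ p)
  have h1 := hasDerivAt_of_domain (contDiffOn_mean_id hσ contDiffOn_invField) hp (exactRotoRate σ p)
  have h2 := hasDerivAt_of_domain (contDiffOn_meanInvField hσ) hp (exactRotoRate σ p)
  have h3 := hasDerivAt_of_domain (contDiffOn_mean_id hσ contDiffOn_perpSqInvField) hp
    (exactRotoRate σ p)
  have h4 := hasDerivAt_of_domain (contDiffOn_smoothAction hσ) hp (exactRotoRate σ p)
  rw [fderiv_mean_id_invField hσ hp] at h1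
  rw [show fderiv ℝ (meanInvField σ) p (0, exactRotoRate σ p) = 0 from
    fderiv_mean_const_exactRotoRate hσ contDiffOn_invField hp] at h2
  rw [fderiv_mean_id_exactRotoRate hσ contDiffOn_perpSqInvField hp, perpSqInvField,
    sqrt_one_add_sq hp] at h3
  rw [fderiv_smoothAction_exactRotoRate hσ hp] at h4
  refine ((((h0.pow 2).mul h3).sub ((h4.div h2 (by simpa using hA)).mul h1)).const_mul
    σ).congr_deriv ?_
  simp only [zero_smul, add_zero, mul_zero, zero_mul, sub_zero, zero_add, zero_div, Pi.div_apply,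
    Pi.pow_apply]
  rw [smoothAction_eq hσ hp]
  field_simp
  linear_combination (meanInvField σ p * p.1 ^ 2 * p.2 3 ^ 2 -
    p.1 ^ 2 * mean σ (fun _ => 1) perpSqInvField p) * hσ

/-- In the normal coordinates, the exact roto-rate is the limiting roto-rate. -/
theorem fderiv_normalCoords (hσ : σ ^ 2 = 1) (hp : p ∈ domain) :
    fderiv ℝ (normalCoords σ) p (0, exactRotoRate σ p) =
      limitingRotoRate σ (normalCoords σ p) := by
  refine fderiv_apply_eq_of_hasDerivAt
    (differentiableAt_of_domain (contDiffOn_normalCoords hσ) hp) ?_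
  have h0 := hasDerivAt_fst_line p (exactRotoRate σ p)
  have hl := hasDerivAt_snd_line p (exactRotoRate σ p)
  have hx := hasDerivAt_of_domain (contDiffOn_xShift hσ) hp (exactRotoRate σ p)
  have hg := hasDerivAt_of_domain (contDiffOn_angleShift hσ) hp (exactRotoRate σ p)
  rw [fderiv_xShift hσ hp] at hx
  rw [fderiv_angleShift hσ hp] at hg
  have r0 := exactRotoRate_apply_zero (σ := σ) (p := p)
  have r1 := exactRotoRate_apply_one (σ := σ) (p := p)
  have r2 := exactRotoRate_apply_two (σ := σ) (p := p)
  have r3 := exactRotoRate_apply_three (σ := σ) (p := p)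
  rw [hasDerivAt_pi]
  intro i
  fin_cases i
  · refine ((hl 0).add hx).congr_deriv ?_
    simp [limitingRotoRate, r0]
  · refine ((((hl 1).const_add 1).pow 2).sub ((h0.const_mul (2 * σ)).mul (hl 2))).congr_deriv ?_
    simp [limitingRotoRate, r1, r2]
    linear_combination (-2 * p.1 * meanInvField σ p * p.2 3 * (1 + p.2 1)) * hσ
  · refine (((hl 2).mul hg.cos).add ((hl 3).mul hg.sin)).congr_deriv ?_
    simp [limitingRotoRate, r2, r3, normalCoords, velPerp]
    ring
  · refine (((hl 3).mul hg.cos).sub ((hl 2).mul hg.sin)).congr_deriv ?_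
    simp [limitingRotoRate, r2, r3, normalCoords, vel]
    ring

/-- At `ε = 0` the gap `Q` is constant in `s`, and the mean of `s` over `[0, 2π]` is `π`: the
velocity is turned by half a turn. -/
theorem normalCoords_zero {z : Phase} (hz : z ∈ region) :
    normalCoords σ (0, z) = ![z 0, (1 + z 1) ^ 2, -z 2, -z 3] := by
  have hp := zero_mem_domain hz
  have ha := one_add_pos hp
  have hg : angleShift σ (0, z) = Real.pi := by
    have hpi := Real.pi_pos
    rw [angleShift, meanInvField_zero hz, mean]
    simp only [invField, orbitPoint, gap_zero, sqrt_one_add_sq hp]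
    rw [intervalIntegral.integral_mul_const, integral_id]
    field_simp
    ring
  ext i
  fin_cases i <;> simp [normalCoords, hg, xShift, driftCoeff, vel, velPerp]

theorem eq_zero_of_fderiv_normalCoords (hσ : σ ^ 2 = 1) {z d : Phase} (hz : z ∈ region)
    (h : fderiv ℝ (normalCoords σ) (0, z) (0, d) = 0) : d = 0 := by
  have hp := zero_mem_domain hz
  have ha : 0 < 1 + z 1 := one_add_pos hp
  have hd := differentiableAt_of_domain (contDiffOn_normalCoords hσ) hp
  rw [← fderiv_slice hd] at h
  have he : (fun z => normalCoords σ (0, z)) =ᶠ[𝓝 z]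
      fun z : Phase => ![z 0, (1 + z 1) ^ 2, -z 2, -z 3] := by
    filter_upwards [isOpen_region.mem_nhds hz] with w hw using normalCoords_zero hw
  have hdiff :
      DifferentiableAt ℝ (fun z : Phase => (![z 0, (1 + z 1) ^ 2, -z 2, -z 3] : Phase)) z :=
    he.differentiableAt_iff.1 (hasFDerivAt_slice hd).differentiableAt
  rw [he.fderiv_eq] at h
  have hl := fun i => hasDerivAt_line z d i 0
  have h2 : fderiv ℝ (fun z : Phase => (![z 0, (1 + z 1) ^ 2, -z 2, -z 3] : Phase)) z d =
      ![d 0, 2 * (1 + z 1) * d 1, -d 2, -d 3] := by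
    refine fderiv_apply_eq_of_hasDerivAt hdiff ?_
    rw [hasDerivAt_pi]
    intro i
    fin_cases i
    · exact hl 0
    · refine (((hl 1).const_add 1).pow 2).congr_deriv ?_
      simp
    · exact (hl 2).neg
    · exact (hl 3).neg
  rw [h2] at h
  ext i
  have hi := congrFun h i
  fin_cases i
  · exact hi
  · have : 2 * (1 + z 1) * d 1 = 0 := hi
    exact (mul_eq_zero.1 this).resolve_left (by positivity)
  · exact neg_eq_zero.1 hi
  · exact neg_eq_zero.1 hi

end NormalForm

/-! ### Periodicity of the formal integral curves -/

section AlongCurves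

variable {σ : ℝ}

/-- The coefficients of the roto-rate. -/
noncomputable def rotoRate (σ : ℝ) (k : ℕ) (z : Phase) : Phase := jet k (exactRotoRate σ) z

/-- The coefficients of the adiabatic invariant series. -/
noncomputable def actionSeries (σ : ℝ) (k : ℕ) (z : Phase) : ℝ := jet k (smoothAction σ) z

theorem contDiffOn_rotoRate (hσ : σ ^ 2 = 1) (k : ℕ) :
    ContDiffOn ℝ ∞ (rotoRate σ k) region :=
  (contDiffOn_jet isOpen_domain starInFst_domain (contDiffOn_exactRotoRate hσ) k).mono
    fun _ hz => zero_mem_domain hz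

theorem contDiffOn_actionSeries (hσ : σ ^ 2 = 1) (k : ℕ) :
    ContDiffOn ℝ ∞ (actionSeries σ k) region :=
  (contDiffOn_jet isOpen_domain starInFst_domain (contDiffOn_smoothAction hσ) k).mono
    fun _ hz => zero_mem_domain hz

theorem rotoRate_zero {z : Phase} (hz : z ∈ region) :
    rotoRate σ 0 z = limitingRotoRate σ z := exactRotoRate_zero hz

theorem exactRotoRate_eq_partialField (hσ : σ ^ 2 = 1) (k : ℕ) {p : ℝ × Phase}
    (hp : p ∈ domain) : exactRotoRate σ p = partialField (rotoRate σ) k p.1 p.2 +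
      p.1 ^ (k + 1) • hadamard^[k + 1] (exactRotoRate σ) p :=
  eq_partialSum_jet isOpen_domain starInFst_domain (contDiffOn_exactRotoRate hσ) k hp

theorem smoothAction_eq_partialSum (hσ : σ ^ 2 = 1) (k : ℕ) {p : ℝ × Phase}
    (hp : p ∈ domain) : smoothAction σ p = partialSum (fun i => actionSeries σ i p.2) k p.1 +
      p.1 ^ (k + 1) • hadamard^[k + 1] (smoothAction σ) p :=
  eq_partialSum_jet isOpen_domain starInFst_domain (contDiffOn_smoothAction hσ) k hp

theorem exists_eventually_bound {E : Type*} [NormedAddCommGroup E] {G : ℝ × ℝ → E} {T : ℝ}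
    (hG : Continuous G) : ∃ M, ∀ᶠ ε in 𝓝 (0 : ℝ), ∀ t ∈ Icc 0 T, ‖G (ε, t)‖ ≤ M := by
  obtain ⟨M, hM⟩ := ((isCompact_Icc (a := (-1 : ℝ)) (b := 1)).prod
    (isCompact_Icc (a := (0 : ℝ)) (b := T))).exists_bound_of_continuousOn hG.continuousOn
  refine ⟨M, ?_⟩
  filter_upwards [Icc_mem_nhds (by norm_num : (-1 : ℝ) < 0) one_pos] with ε hε t ht
  exact hM (ε, t) ⟨hε, ht⟩

variable {c : ℕ → ℝ → Phase}

theorem continuous_partialCurve (hc : ∀ i, Continuous (c i)) (k : ℕ) :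
    Continuous (fun q : ℝ × ℝ => partialCurve c k q.1 q.2) := by
  unfold partialCurve partialSum
  exact continuous_finsetSum _ fun i _ => (continuous_fst.pow i).smul ((hc i).comp continuous_snd)

theorem IsFormalIntegralCurve.continuous {R : ℕ → Phase → Phase} (hc : IsFormalIntegralCurve R c)
    (i : ℕ) : Continuous (c i) := (hc.smooth i).continuous

theorem IsFormalIntegralCurve.continuous_deriv {R : ℕ → Phase → Phase}
    (hc : IsFormalIntegralCurve R c) (i : ℕ) : Continuous (deriv (c i)) :=
  (hc.smooth i).continuous_deriv (by simp)

theorem partialCurve_zero (c : ℕ → ℝ → Phase) (k : ℕ) (t : ℝ) : partialCurve c k 0 t = c 0 t :=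
  partialSum_at_zero (fun i => c i t) k

/-- The partial sums of a formal integral curve satisfy the exact equation up to a uniform
error. -/
theorem exists_bound_deriv_sub_exactRotoRate (hσ : σ ^ 2 = 1)
    (hc : IsFormalIntegralCurve (rotoRate σ) c) (k : ℕ) (T : ℝ) :
    ∃ C, ∀ᶠ ε in 𝓝 (0 : ℝ), ∀ t ∈ Icc 0 T,
      ‖partialSum (fun i => deriv (c i) t) k ε - exactRotoRate σ (ε, partialCurve c k ε t)‖ ≤
        C * |ε| ^ (k + 1) := by
  -- The coefficients and their derivatives at time `t` become a point of a finite-dimensional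
  -- parameter space. The defect is smooth in `ε` and these parameters, which yields uniformity in
  -- `t` although the curves are only `C¹`.
  let B := Fin (k + 1) → Phase
  let poly : ℝ → B → Phase := fun ε b => ∑ i : Fin (k + 1), ε ^ (i : ℕ) • b i
  let O : Set (ℝ × (B × B)) := {q | (q.1, poly q.1 q.2.1) ∈ domain}
  let g : ℝ × (B × B) → Phase := fun q =>
    poly q.1 q.2.2 - exactRotoRate σ (q.1, poly q.1 q.2.1)
  have hp1 : ContDiff ℝ ∞ (fun q : ℝ × (B × B) => poly q.1 q.2.1) := by
    show ContDiff ℝ ∞ (fun q : ℝ × (B × B) => ∑ i : Fin (k + 1), q.1 ^ (i : ℕ) • q.2.1 i)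
    fun_prop
  have hp2 : ContDiff ℝ ∞ (fun q : ℝ × (B × B) => poly q.1 q.2.2) := by
    show ContDiff ℝ ∞ (fun q : ℝ × (B × B) => ∑ i : Fin (k + 1), q.1 ^ (i : ℕ) • q.2.2 i)
    fun_prop
  have hO : IsOpen O := isOpen_domain.preimage (continuous_fst.prodMk hp1.continuous)
  have hg : ContDiffOn ℝ ∞ g (starCore O) :=
    (hp2.contDiffOn.sub ((contDiffOn_exactRotoRate hσ).comp
      (contDiff_fst.prodMk hp1).contDiffOn fun q hq => hq)).mono (starCore_subset O)
  have hpoly : ∀ ε (b : ℕ → Phase), poly ε (fun i => b i) = partialSum b k ε := fun ε b =>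
    sum_fin_eq_partialSum b k ε
  let κ : ℝ → B × B := fun t => (fun i => c i t, fun i => deriv (c i) t)
  have hκ : Continuous κ := (continuous_pi fun i : Fin (k + 1) => hc.continuous i).prodMk
    (continuous_pi fun i : Fin (k + 1) => hc.continuous_deriv i)
  have hmem : ∀ t, ((0 : ℝ), κ t) ∈ starCore O := fun t => by
    refine zero_mem_starCore ?_
    show ((0 : ℝ), poly 0 (fun i => c i t)) ∈ domain
    rw [hpoly 0 (fun i => c i t), partialSum_at_zero]
    exact zero_mem_domain (hc.mem t)
  obtain ⟨C, hC⟩ := exists_bound_of_eqMod (isOpen_starCore hO) (starInFst_starCore O) hg k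
    (K := κ '' Icc 0 T) (isCompact_Icc.image hκ) (by rintro _ ⟨t, _, rfl⟩; exact hmem t) (by
      rintro _ ⟨t, _, rfl⟩
      have h1 := hc.eqn k t
      simp only [(deriv_partialCurve hc.smooth k _ t).deriv] at h1
      have h0 := zero_mem_domain (hc.mem t)
      have hcont : ContinuousAt (fun ε : ℝ => (ε, partialCurve c k ε t)) 0 :=
        (continuous_id.prodMk (continuous_partialSum (fun i => c i t) k)).continuousAt
      have h2 : EqMod (k + 1) (fun ε => exactRotoRate σ (ε, partialCurve c k ε t))
          (fun ε => partialField (rotoRate σ) k ε (partialCurve c k ε t)) := by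
        refine EqMod.of_smul (r := fun ε =>
          hadamard^[k + 1] (exactRotoRate σ) (ε, partialCurve c k ε t)) ?_ ?_
        · refine ContinuousAt.comp (g := hadamard^[k + 1] (exactRotoRate σ)) ?_ hcont
          rw [partialCurve_zero]
          exact (contDiffOn_iterate_hadamard isOpen_domain starInFst_domain
            (contDiffOn_exactRotoRate hσ) (k + 1)).continuousOn.continuousAt
              (isOpen_domain.mem_nhds h0)
        · have : ∀ᶠ ε in 𝓝 (0 : ℝ), (ε, partialCurve c k ε t) ∈ domain := by
            refine hcont.eventually (isOpen_domain.mem_nhds ?_)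
            simp only [partialCurve_zero]
            exact h0
          filter_upwards [this] with ε hε
          exact exactRotoRate_eq_partialField hσ k hε
      have h3 := (h1.trans h2.symm).sub (EqMod.refl (k + 1)
        (fun ε => exactRotoRate σ (ε, partialCurve c k ε t)))
      refine h3.congr' (Eventually.of_forall fun ε => ?_) (Eventually.of_forall fun ε => sub_self _)
      show _ = poly ε (fun i => deriv (c i) t) - exactRotoRate σ (ε, poly ε (fun i => c i t))
      rw [hpoly ε (fun i => deriv (c i) t), hpoly ε (fun i => c i t)]
      rfl)
  refine ⟨C, ?_⟩
  filter_upwards [hC] with ε hε t ht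
  have := hε _ (mem_image_of_mem κ ht)
  have h4 : g (ε, κ t) = partialSum (fun i => deriv (c i) t) k ε -
      exactRotoRate σ (ε, partialCurve c k ε t) := by
    show poly ε (fun i => deriv (c i) t) - exactRotoRate σ (ε, poly ε (fun i => c i t)) = _
    rw [hpoly ε (fun i => deriv (c i) t), hpoly ε (fun i => c i t)]
    rfl
  rwa [h4] at this

/-- Smooth functions change along the partial sums of a formal integral curve as along the exact
roto-rate, up to a uniform error. -/
theorem exists_bound_deriv_comp (hσ : σ ^ 2 = 1)
    (hc : IsFormalIntegralCurve (rotoRate σ) c) (k : ℕ) (T : ℝ)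
    {E : Type*} [NormedAddCommGroup E] [NormedSpace ℝ E] {F : ℝ × Phase → E}
    (hF : ContDiffOn ℝ ∞ F domain) :
    ∃ C, ∀ᶠ ε in 𝓝 (0 : ℝ), ∀ t ∈ Icc 0 T, (ε, partialCurve c k ε t) ∈ domain ∧
      ∃ d, HasDerivAt (fun t => F (ε, partialCurve c k ε t)) d t ∧
      ‖d - fderiv ℝ F (ε, partialCurve c k ε t) (0, exactRotoRate σ (ε, partialCurve c k ε t))‖ ≤
        C * |ε| ^ (k + 1) := by
  have hcurve := continuous_partialCurve hc.continuous k
  have hmap : Continuous (fun q : ℝ × ℝ => (q.1, partialCurve c k q.1 q.2)) :=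
    continuous_fst.prodMk hcurve
  have h0 : ∀ t, ((0 : ℝ), partialCurve c k 0 t) ∈ domain := fun t => by
    rw [partialCurve_zero]
    exact zero_mem_domain (hc.mem t)
  have hfd : ContinuousOn (fderiv ℝ F) domain :=
    hF.continuousOn_fderiv_of_isOpen isOpen_domain (by simp)
  obtain ⟨M, hM⟩ : ∃ M, ∀ t ∈ Icc 0 T, ‖fderiv ℝ F (0, partialCurve c k 0 t)‖ ≤ M := by
    refine isCompact_Icc.exists_bound_of_continuousOn (ContinuousOn.comp (g := fderiv ℝ F) hfd
      (hmap.comp (continuous_const.prodMk continuous_id)).continuousOn fun t _ => h0 t)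
  have hev : ∀ᶠ ε in 𝓝 (0 : ℝ), ∀ t ∈ Icc 0 T, (ε, partialCurve c k ε t) ∈ domain ∧
      ‖fderiv ℝ F (ε, partialCurve c k ε t)‖ < M + 1 := by
    refine isCompact_Icc.eventually_forall_of_forall_eventually fun t ht => ?_
    have h1 : ∀ᶠ q in 𝓝 ((0 : ℝ), partialCurve c k 0 t), q ∈ domain :=
      isOpen_domain.mem_nhds (h0 t)
    have h2 : ∀ᶠ q in 𝓝 ((0 : ℝ), partialCurve c k 0 t), ‖fderiv ℝ F q‖ < M + 1 :=
      (hfd.continuousAt (isOpen_domain.mem_nhds (h0 t))).norm.eventually_lt_const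
        (lt_of_le_of_lt (hM t ht) (by linarith))
    exact (hmap.continuousAt (x := ((0 : ℝ), t))).eventually (h1.and h2)
  obtain ⟨C, hC⟩ := exists_bound_deriv_sub_exactRotoRate hσ hc k T
  refine ⟨(M + 1) * C, ?_⟩
  filter_upwards [hev, hC] with ε h1 h2 t ht
  obtain ⟨hd, hb⟩ := h1 t ht
  refine ⟨hd, fderiv ℝ F (ε, partialCurve c k ε t) (0, partialSum (fun i => deriv (c i) t) k ε),
    ?_, ?_⟩
  · have h3 : HasDerivAt (fun t => (ε, partialCurve c k ε t))
        ((0 : ℝ), partialSum (fun i => deriv (c i) t) k ε) t :=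
      (hasDerivAt_const t ε).prodMk (deriv_partialCurve hc.smooth k ε t)
    exact (differentiableAt_of_domain hF hd).hasFDerivAt.comp_hasDerivAt t h3
  · rw [← map_sub]
    refine (ContinuousLinearMap.le_opNorm _ _).trans ?_
    have h4 : ‖((0 : ℝ), partialSum (fun i => deriv (c i) t) k ε) -
        ((0 : ℝ), exactRotoRate σ (ε, partialCurve c k ε t))‖ ≤ C * |ε| ^ (k + 1) := by
      simpa [Prod.norm_def] using h2 t ht
    calc _ ≤ (M + 1) * (C * |ε| ^ (k + 1)) :=
          mul_le_mul hb.le h4 (norm_nonneg _) ((norm_nonneg _).trans hb.le)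
      _ = _ := by ring

/-- A bound on the derivative bounds the increment along `[0, T]`. -/
theorem norm_sub_le_of_hasDerivAt {E : Type*} [NormedAddCommGroup E] [NormedSpace ℝ E]
    {f : ℝ → E} {C T : ℝ} (h : ∀ t ∈ Icc 0 T, ∃ d, HasDerivAt f d t ∧ ‖d‖ ≤ C) {t : ℝ}
    (ht : t ∈ Icc 0 T) : ‖f t - f 0‖ ≤ C * t := by
  have h1 : ∀ t ∈ Icc 0 T, DifferentiableAt ℝ f t := fun t ht => by
    obtain ⟨d, hd, -⟩ := h t ht
    exact hd.differentiableAt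
  have h2 : ∀ t ∈ Icc 0 T, ‖deriv f t‖ ≤ C := fun t ht => by
    obtain ⟨d, hd, hb⟩ := h t ht
    rwa [hd.deriv]
  have := (convex_Icc (0 : ℝ) T).norm_image_sub_le_of_norm_deriv_le h1 h2
    (left_mem_Icc.2 (ht.1.trans ht.2)) ht
  simpa [abs_of_nonneg ht.1] using this

/-- Constants of the exact roto-rate are constant along its formal integral curves, up to a
uniform error. -/
theorem exists_bound_sub_of_invariant (hσ : σ ^ 2 = 1)
    (hc : IsFormalIntegralCurve (rotoRate σ) c) (k : ℕ) (T : ℝ)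
    {E : Type*} [NormedAddCommGroup E] [NormedSpace ℝ E] {F : ℝ × Phase → E}
    (hF : ContDiffOn ℝ ∞ F domain)
    (h : ∀ p ∈ domain, fderiv ℝ F p (0, exactRotoRate σ p) = 0) :
    ∃ C, ∀ᶠ ε in 𝓝 (0 : ℝ), ∀ t ∈ Icc 0 T,
      ‖F (ε, partialCurve c k ε t) - F (ε, partialCurve c k ε 0)‖ ≤ C * |ε| ^ (k + 1) := by
  obtain ⟨C, hC⟩ := exists_bound_deriv_comp hσ hc k T hF
  refine ⟨|C| * T, ?_⟩
  filter_upwards [hC] with ε hε t ht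
  refine (norm_sub_le_of_hasDerivAt (f := fun t => F (ε, partialCurve c k ε t))
    (C := |C| * |ε| ^ (k + 1)) (fun t ht => ?_) ht).trans ?_
  · obtain ⟨hd, d, h1, h2⟩ := hε t ht
    rw [h _ hd, sub_zero] at h2
    exact ⟨d, h1, h2.trans (by gcongr; exact le_abs_self C)⟩
  · calc |C| * |ε| ^ (k + 1) * t ≤ |C| * |ε| ^ (k + 1) * T := by
          gcongr
          exact ht.2
      _ = _ := by ring

theorem norm_rot_le (hσ : σ ^ 2 = 1) (t : ℝ) (z : Phase) : ‖rot σ t z‖ ≤ 2 * ‖z‖ := by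
  have hs : |σ| = 1 := by
    rw [← sq_eq_sq₀ (abs_nonneg σ) zero_le_one, sq_abs, hσ, one_pow]
  have hz := fun i => norm_le_pi_norm z i
  have hn := norm_nonneg z
  have h1 : |Real.cos t| ≤ 1 := Real.abs_cos_le_one t
  have h2 : |Real.sin t| ≤ 1 := Real.abs_sin_le_one t
  have h3 : ∀ i, |Real.cos t * z i| ≤ ‖z‖ := fun i => by
    rw [abs_mul]
    exact (mul_le_of_le_one_left (abs_nonneg _) h1).trans (hz i)
  have h4 : ∀ i, |σ * Real.sin t * z i| ≤ ‖z‖ := fun i => by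
    rw [abs_mul, abs_mul, hs, one_mul]
    exact (mul_le_of_le_one_left (abs_nonneg _) h2).trans (hz i)
  rw [pi_norm_le_iff_of_nonneg (by positivity)]
  intro i
  fin_cases i
  · exact (hz 0).trans (by linarith)
  · exact (hz 1).trans (by linarith)
  · exact (abs_add_le _ _).trans (by linarith [h3 2, h4 3])
  · exact (abs_sub _ _).trans (by linarith [h3 3, h4 2])

/-- The normal coordinates return to their initial values after the time `2π`. -/
theorem eqMod_normalCoords (hσ : σ ^ 2 = 1) (hc : IsFormalIntegralCurve (rotoRate σ) c) (k : ℕ) :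
    EqMod (k + 1) (fun ε => normalCoords σ (ε, partialCurve c k ε (2 * Real.pi)))
      (fun ε => normalCoords σ (ε, partialCurve c k ε 0)) := by
  obtain ⟨C, hC⟩ := exists_bound_deriv_comp hσ hc k (2 * Real.pi) (contDiffOn_normalCoords hσ)
  refine IsBigO.of_bound (2 * C * (2 * Real.pi)) ?_
  filter_upwards [hC] with ε hε
  -- Turned back by `rot σ (-t)`, the normal coordinates would be constant along the exact
  -- roto-rate. The factor `2` is that of `norm_rot_le`.
  have h1 := norm_sub_le_of_hasDerivAt (T := 2 * Real.pi) (C := 2 * (C * |ε| ^ (k + 1)))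
    (f := fun t => rot σ (-t) (normalCoords σ (ε, partialCurve c k ε t))) (fun t ht => by
      obtain ⟨hd, d, h2, h3⟩ := hε t ht
      refine ⟨_, hasDerivAt_rot_neg hσ h2, (norm_rot_le hσ _ _).trans ?_⟩
      rw [fderiv_normalCoords hσ hd] at h3
      gcongr) (right_mem_Icc.2 Real.two_pi_pos.le)
  have h4 := rot_add_two_pi σ (-(2 * Real.pi))
    (normalCoords σ (ε, partialCurve c k ε (2 * Real.pi)))
  rw [neg_add_cancel, rot_zero] at h4
  simp only [← h4, neg_zero, rot_zero] at h1
  refine h1.trans (le_of_eq ?_)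
  rw [norm_pow, Real.norm_eq_abs]
  ring

/-- By induction on the order, the truncated curve fails to close by exactly `ε^(k+1) d`. In normal
coordinates the failure is `ε^(k+1) L d` to leading order, but also `O(ε^(k+2))`; hence `L d = 0`,
and `L` is injective on directions of constant `ε`. -/
theorem apply_two_pi_of_formalIntegralCurve (hσ : σ ^ 2 = 1)
    (hc : IsFormalIntegralCurve (rotoRate σ) c) (k : ℕ) : c k (2 * Real.pi) = c k 0 := by
  induction k using Nat.strong_induction_on with
  | _ k ih =>
    cases k with
    | zero =>
      have h := hc.apply_zero hσ (contDiffOn_rotoRate hσ) (fun z hz => rotoRate_zero hz)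
        (2 * Real.pi)
      have h2 := rot_add_two_pi σ 0 (c 0 0)
      rw [zero_add, rot_zero] at h2
      rw [h, h2]
    | succ k =>
      rw [← sub_eq_zero]
      set d := c (k + 1) (2 * Real.pi) - c (k + 1) 0 with hd
      have hz := hc.mem 0
      refine eq_zero_of_fderiv_normalCoords hσ hz ?_
      set L := fderiv ℝ (normalCoords σ) (0, c 0 0) with hL
      have hp : ∀ ε, partialCurve c (k + 1) ε (2 * Real.pi) =
          partialCurve c (k + 1) ε 0 + ε ^ (k + 1) • d := by
        intro ε
        simp only [partialCurve, partialSum_succ, hd]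
        rw [show partialSum (fun i => c i (2 * Real.pi)) k ε = partialSum (fun i => c i 0) k ε from
          Finset.sum_congr rfl fun i hi => by
            simp only [ih i (by simpa using hi)], smul_sub]
        abel
      have hstrict : HasStrictFDerivAt (normalCoords σ) L (0, c 0 0) :=
        ((contDiffOn_normalCoords hσ).contDiffAt
          (isOpen_domain.mem_nhds (zero_mem_domain hz))).hasStrictFDerivAt (by simp)
      have ht : ∀ s, c 0 s = c 0 0 → Tendsto (fun ε : ℝ => (ε, partialCurve c (k + 1) ε s)) (𝓝 0)
          (𝓝 ((0 : ℝ), c 0 0)) := by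
        intro s hs
        have h := tendsto_partialSum (fun i => c i s) (k + 1)
        simp only [hs] at h
        exact tendsto_id.prodMk_nhds h
      have h1 := hstrict.isLittleO.comp_tendsto
        ((ht (2 * Real.pi) (ih 0 (by omega))).prodMk_nhds (ht 0 rfl))
      have h2 : (fun ε : ℝ => (ε, partialCurve c (k + 1) ε (2 * Real.pi)) -
          (ε, partialCurve c (k + 1) ε 0)) = fun ε : ℝ => ε ^ (k + 1) • ((0 : ℝ), d) := by
        funext ε
        rw [hp]
        simp
      have h3 : (fun ε : ℝ => ε ^ (k + 1) • ((0 : ℝ), d)) =O[𝓝 0] (fun ε : ℝ => ε ^ (k + 1)) := by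
        simpa using (isBigO_refl (fun ε : ℝ => ε ^ (k + 1)) (𝓝 0)).smul
          (isBigO_const_const (((0 : ℝ), d)) (one_ne_zero (α := ℝ)) (𝓝 (0 : ℝ)))
      have h4 : (fun ε => normalCoords σ (ε, partialCurve c (k + 1) ε (2 * Real.pi)) -
          normalCoords σ (ε, partialCurve c (k + 1) ε 0) - ε ^ (k + 1) • L (0, d))
          =o[𝓝 0] (fun ε : ℝ => ε ^ (k + 1)) := by
        refine IsLittleO.trans_isBigO ?_ h3
        rw [← h2]
        refine h1.congr (fun ε => ?_) fun ε => rfl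
        have := congrFun h2 ε
        simp only [Function.comp_apply] at this ⊢
        rw [this, map_smul]
      have h5 : (fun ε => normalCoords σ (ε, partialCurve c (k + 1) ε (2 * Real.pi)) -
          normalCoords σ (ε, partialCurve c (k + 1) ε 0)) =o[𝓝 0] (fun ε : ℝ => ε ^ (k + 1)) :=
        (eqMod_normalCoords hσ hc (k + 1)).trans_isLittleO
          (isLittleO_pow_pow (Nat.lt_succ_self (k + 1)))
      have h6 : (fun ε : ℝ => ε ^ (k + 1) • L (0, d)) =o[𝓝[≠] 0] (fun ε : ℝ => ε ^ (k + 1)) := by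
        refine ((h5.sub h4).congr_left fun ε => ?_).mono nhdsWithin_le_nhds
        abel
      have h7 : (fun _ : ℝ => L (0, d)) =o[𝓝[≠] 0] (fun _ : ℝ => (1 : ℝ)) := by
        have := (isBigO_refl (fun ε : ℝ => (ε ^ (k + 1))⁻¹) (𝓝[≠] 0)).smul_isLittleO h6
        refine this.congr' ?_ ?_ <;>
        · filter_upwards [self_mem_nhdsWithin] with ε hε
          have : ε ^ (k + 1) ≠ 0 := pow_ne_zero _ hε
          simp [smul_smul, this]
      exact (tendsto_const_nhds_iff.1 ((isLittleO_one_iff ℝ).1 h7))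

theorem IsFormalIntegralCurve.shift {R : ℕ → Phase → Phase} (hc : IsFormalIntegralCurve R c)
    (a : ℝ) : IsFormalIntegralCurve R (fun k t => c k (t + a)) where
  smooth k := (hc.smooth k).comp (contDiff_id.add contDiff_const)
  mem t := hc.mem (t + a)
  eqn k t := by
    have h : ∀ ε, deriv (partialCurve (fun k t => c k (t + a)) k ε) t =
        deriv (partialCurve c k ε) (t + a) := fun ε =>
      deriv_comp_add_const (f := partialCurve c k ε) a t
    simp only [h]
    exact hc.eqn k (t + a)

/-- The formal integral curves of the roto-rate are `2π`-periodic. -/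
theorem periodic_of_formalIntegralCurve (hσ : σ ^ 2 = 1)
    (hc : IsFormalIntegralCurve (rotoRate σ) c) (k : ℕ) (t : ℝ) :
    c k (t + 2 * Real.pi) = c k t := by
  have := apply_two_pi_of_formalIntegralCurve hσ (hc.shift t) k
  simpa [add_comm] using this

end AlongCurves

/-! ### Kruskal's series and the formal identities -/

section Kruskal

variable {σ : ℝ}

theorem liouville_eq (σ ε : ℝ) (z u : Phase) :
    liouville σ ε z u = momentum σ ε z * u 0 + ε * z 3 * u 1 := by
  unfold liouville momentum
  ring

theorem contDiff_momentum (σ : ℝ) : ContDiff ℝ ∞ (fun p : ℝ × Phase => momentum σ p.1 p.2) := by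
  unfold momentum
  fun_prop

theorem fderiv_momentum_exactRotoRate (p : ℝ × Phase) :
    fderiv ℝ (fun p : ℝ × Phase => momentum σ p.1 p.2) p (0, exactRotoRate σ p) = 0 := by
  refine fderiv_apply_eq_of_hasDerivAt
    ((contDiff_momentum σ).differentiable (by simp)).differentiableAt ?_
  have h0 := hasDerivAt_fst_line p (exactRotoRate σ p)
  have hl := hasDerivAt_snd_line p (exactRotoRate σ p)
  refine ((h0.mul (hl 2)).sub (((hl 1).add
    (((hl 1).pow 2).div_const 2)).const_mul σ)).congr_deriv ?_
  simp [exactRotoRate_apply_one, exactRotoRate_apply_two]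
  ring

theorem eqMod_loopAction (hσ : σ ^ 2 = 1) {c : ℕ → ℝ → Phase}
    (hc : IsFormalIntegralCurve (rotoRate σ) c) {z : Phase} (hz : c 0 0 = z)
    (hz' : ∀ k, c (k + 1) 0 = 0) (k : ℕ) :
    EqMod (k + 1) (fun ε => loopAction σ ε (partialCurve c k ε))
      (fun ε => smoothAction σ (ε, z)) := by
  have hp0 : ∀ ε, partialCurve c k ε 0 = z := by
    intro ε
    rw [partialCurve, partialSum, Finset.sum_range_succ']
    simp [hz, hz']
  have hp2 : ∀ ε, partialCurve c k ε (2 * Real.pi) = z := by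
    intro ε
    rw [← hp0 ε]
    simp only [partialCurve, apply_two_pi_of_formalIntegralCurve hσ hc]
  obtain ⟨C₁, h1⟩ := exists_bound_sub_of_invariant hσ hc k (2 * Real.pi)
    (contDiff_momentum σ).contDiffOn fun p _ => fderiv_momentum_exactRotoRate p
  obtain ⟨C₂, h2⟩ := exists_bound_sub_of_invariant hσ hc k (2 * Real.pi)
    (contDiffOn_smoothAction hσ) fun p hp => fderiv_smoothAction_exactRotoRate hσ hp
  obtain ⟨C₃, h3⟩ := exists_bound_deriv_comp hσ hc k (2 * Real.pi) (contDiffOn_actionShift hσ)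
  obtain ⟨C₄, h4⟩ := exists_bound_deriv_sub_exactRotoRate hσ hc k (2 * Real.pi)
  have hcurve := continuous_partialCurve hc.continuous k
  have hvel : Continuous (fun q : ℝ × ℝ => partialSum (fun i => deriv (c i) q.2) k q.1) :=
    continuous_partialCurve (c := fun i => deriv (c i)) hc.continuous_deriv k
  obtain ⟨M₁, h5⟩ := exists_eventually_bound (T := 2 * Real.pi) (G := fun q : ℝ × ℝ =>
    partialSum (fun i => deriv (c i) q.2) k q.1 0) ((continuous_apply 0).comp hvel)
  obtain ⟨M₂, h6⟩ := exists_eventually_bound (T := 2 * Real.pi) (G := fun q : ℝ × ℝ =>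
    q.1 * partialCurve c k q.1 q.2 3) (continuous_fst.mul ((continuous_apply 3).comp hcurve))
  refine IsBigO.of_bound (C₁ * M₁ + M₂ * C₄ + C₂ + C₃) ?_
  filter_upwards [h1, h2, h3, h4, h5, h6] with ε h1 h2 h3 h4 h5 h6
  set e := |ε| ^ (k + 1) with he
  have hpi := Real.pi_pos
  set P : ℝ → Phase := partialCurve c k ε with hP
  set V : ℝ → Phase := fun t => partialSum (fun i => deriv (c i) t) k ε with hV
  have hPV : ∀ t, HasDerivAt P (V t) t := fun t => deriv_partialCurve hc.smooth k ε t
  have hPc : Continuous P := continuous_iff_continuousAt.2 fun t => (hPV t).continuousAt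
  have hVc : Continuous V := hvel.comp (continuous_const.prodMk continuous_id)
  have hℓ : Continuous (fun t => liouville σ ε (P t) (V t)) := by
    unfold liouville
    fun_prop
  -- From the integral of the Liouville form are subtracted the linear growth of the action, its
  -- oscillation, and the exact part `p_x x`. The derivative of the rest is `O(ε^(k+1))`, while the
  -- last two terms return to their initial values at `2π`.
  let H : ℝ → ℝ := fun t => (∫ s in (0 : ℝ)..t, liouville σ ε (P s) (V s)) -
    t * smoothAction σ (ε, z) - actionShift σ (ε, P t) - momentum σ ε z * P t 0
  have hH : ∀ t ∈ Icc 0 (2 * Real.pi), ∃ d, HasDerivAt H d t ∧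
      ‖d‖ ≤ (C₁ * M₁ + M₂ * C₄ + C₂ + C₃) * e := by
    intro t ht
    obtain ⟨hd, d, hd1, hd2⟩ := h3 t ht
    rw [fderiv_actionShift hσ hd] at hd2
    have hI := intervalIntegral.integral_hasDerivAt_right (hℓ.intervalIntegrable 0 t)
      (hℓ.stronglyMeasurableAtFilter _ _) hℓ.continuousAt
    refine ⟨_, ((hI.sub ((hasDerivAt_id t).mul_const (smoothAction σ (ε, z)))).sub hd1).sub
      ((hasDerivAt_pi.1 (hPV t) 0).const_mul (momentum σ ε z)), ?_⟩
    have e0 : P 0 = z := hp0 ε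
    have b1 : ‖momentum σ ε (P t) - momentum σ ε (P 0)‖ ≤ C₁ * e := h1 t ht
    have b2 : ‖smoothAction σ (ε, P t) - smoothAction σ (ε, P 0)‖ ≤ C₂ * e := h2 t ht
    have b4 := (norm_le_pi_norm _ 1).trans (h4 t ht)
    have b5 := h5 t ht
    have b6 := h6 t ht
    rw [e0] at b1 b2
    rw [Pi.sub_apply, exactRotoRate_apply_one] at b4
    simp only [Real.norm_eq_abs] at b1 b2 b4 b5 b6 hd2 ⊢
    have c1 : |(momentum σ ε (P t) - momentum σ ε z) * V t 0| ≤ C₁ * e * M₁ := by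
      rw [abs_mul]
      exact mul_le_mul b1 b5 (abs_nonneg _) ((abs_nonneg _).trans b1)
    have c2 : |ε * P t 3 * (V t 1 - meanInvField σ (ε, P t) * (ε * P t 3))| ≤ M₂ * (C₄ * e) := by
      rw [abs_mul]
      exact mul_le_mul b6 b4 (abs_nonneg _) ((abs_nonneg _).trans b6)
    have key : liouville σ ε (P t) (V t) - 1 * smoothAction σ (ε, z) - d -
        momentum σ ε z * V t 0 = (momentum σ ε (P t) - momentum σ ε z) * V t 0 +
        ε * P t 3 * (V t 1 - meanInvField σ (ε, P t) * (ε * P t 3)) +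
        (smoothAction σ (ε, P t) - smoothAction σ (ε, z)) -
        (d - (meanInvField σ (ε, P t) * (ε * P t 3) ^ 2 - smoothAction σ (ε, P t))) := by
      rw [liouville_eq]
      ring
    rw [key]
    calc _ ≤ C₁ * e * M₁ + M₂ * (C₄ * e) + C₂ * e + C₃ * e :=
          (abs_sub _ _).trans (add_le_add ((abs_add_le _ _).trans
            (add_le_add ((abs_add_le _ _).trans (add_le_add c1 c2)) b2)) hd2)
      _ = _ := by ring
  have hfin := norm_sub_le_of_hasDerivAt hH (right_mem_Icc.2 (by positivity))
  have hloop : loopAction σ ε P = (2 * Real.pi)⁻¹ *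
      ∫ t in (0 : ℝ)..(2 * Real.pi), liouville σ ε (P t) (V t) := by
    simp only [loopAction, (hPV _).deriv]
  have hdiff : loopAction σ ε P - smoothAction σ (ε, z) =
      (2 * Real.pi)⁻¹ * (H (2 * Real.pi) - H 0) := by
    have e2 : P (2 * Real.pi) = z := hp2 ε
    have e0 : P 0 = z := hp0 ε
    simp only [H, hloop, e2, e0, intervalIntegral.integral_same]
    field_simp
    ring
  rw [hdiff, norm_mul, norm_pow, Real.norm_eq_abs ε, ← he, Real.norm_eq_abs,
    abs_of_pos (by positivity)]
  calc _ ≤ (2 * Real.pi)⁻¹ * ((C₁ * M₁ + M₂ * C₄ + C₂ + C₃) * e * (2 * Real.pi)) := by gcongr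
    _ = _ := by field_simp

theorem eqMod_smoothAction (hσ : σ ^ 2 = 1) {z : Phase} (hz : z ∈ region) (k : ℕ) :
    EqMod (k + 1) (fun ε => smoothAction σ (ε, z))
      (partialSum (fun i => actionSeries σ i z) k) :=
  eqMod_partialSum_jet isOpen_domain starInFst_domain (contDiffOn_smoothAction hσ) k
    (zero_mem_domain hz)

theorem isKruskalSeries_actionSeries (hσ : σ ^ 2 = 1) :
    IsKruskalSeries σ (rotoRate σ) (actionSeries σ) := fun _ hz _ hc h0 h1 k =>
  (eqMod_loopAction hσ hc h0 h1 k).trans (eqMod_smoothAction hσ hz k)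

theorem eventually_mem_domain {z : Phase} (hz : z ∈ region) :
    ∀ᶠ ε in 𝓝 (0 : ℝ), (ε, z) ∈ domain := by
  have : ContinuousAt (fun ε : ℝ => (ε, z)) 0 := by fun_prop
  exact this.eventually (isOpen_domain.mem_nhds (zero_mem_domain hz))

theorem rotoRate_add_x (hσ : σ ^ 2 = 1) (x : ℝ) (k : ℕ) {z : Phase} (hz : z ∈ region) :
    rotoRate σ k (z + ![x, 0, 0, 0]) = rotoRate σ k z := by
  have hz' : z + ![x, 0, 0, 0] ∈ region := by
    have h : (z + ![x, 0, 0, 0]) 1 = z 1 := add_zero _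
    rwa [region, mem_ofPred_eq, h]
  have h := fun {w : Phase} (hw : w ∈ region) => eqMod_partialSum_jet isOpen_domain
    starInFst_domain (contDiffOn_exactRotoRate hσ) k (zero_mem_domain hw)
  have h1 := h hz'
  have h2 : ∀ ε, exactRotoRate σ (ε, z + ![x, 0, 0, 0]) = exactRotoRate σ (ε, z) := fun ε =>
    exactRotoRate_add_x x (ε, z)
  simp only [h2] at h1
  exact eq_of_eqMod_partialSum (h1.symm.trans (h hz)) k le_rfl

theorem continuousAt_slice {E : Type*} [TopologicalSpace E] {F : ℝ × Phase → E}
    (hF : ContinuousOn F domain) {z : Phase} (hz : z ∈ region) :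
    ContinuousAt (fun ε : ℝ => F (ε, z)) 0 :=
  ContinuousAt.comp (g := F) (f := fun ε : ℝ => (ε, z))
    (hF.continuousAt (isOpen_domain.mem_nhds (zero_mem_domain hz))) (by fun_prop)

theorem eventually_mem_domain_slice {ε : ℝ} {z : Phase} (h : (ε, z) ∈ domain) :
    ∀ᶠ w in 𝓝 z, (ε, w) ∈ domain := by
  have : ContinuousAt (fun w : Phase => (ε, w)) z := by fun_prop
  exact this.eventually (isOpen_domain.mem_nhds h)

/-- The truncation is the exact roto-rate, which commutes, minus `ε^(k+1)` times the smooth Hadamard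
remainder. -/
theorem lieBracket_partialField_rotoRate (hσ : σ ^ 2 = 1) (k : ℕ) {z : Phase}
    (hz : z ∈ region) :
    EqMod (k + 1) (fun ε => VectorField.lieBracket ℝ (partialField (rotoRate σ) k ε) (field σ ε) z)
      (fun _ => 0) := by
  set ρ := hadamard^[k + 1] (exactRotoRate σ) with hρ
  have hρs : ContDiffOn ℝ ∞ ρ domain :=
    contDiffOn_iterate_hadamard isOpen_domain starInFst_domain (contDiffOn_exactRotoRate hσ) (k + 1)
  refine EqMod.of_smul (r := fun ε => -(fderiv ℝ (field σ ε) z (ρ (ε, z)) -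
    fderiv ℝ ρ (ε, z) (0, field σ ε z))) ?_ ?_
  · refine (ContinuousAt.sub ?_ ?_).neg
    · have h1 := continuousAt_slice hρs.continuousOn hz
      have h2 : ∀ i, ContinuousAt (fun ε => ρ (ε, z) i) 0 := fun i =>
        (continuous_apply i).continuousAt.comp h1
      simp only [fderiv_field_apply]
      rw [continuousAt_pi]
      intro i
      fin_cases i
      · exact continuousAt_id.mul (h2 2)
      · exact continuousAt_id.mul (h2 3)
      · exact continuousAt_const.mul (((h2 3).mul continuousAt_const).add
          (continuousAt_const.mul (h2 1)))
      · exact (continuousAt_const.mul (((h2 2).mul continuousAt_const).add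
          (continuousAt_const.mul (h2 1)))).neg
    · refine ContinuousAt.clm_apply (continuousAt_slice
        (hρs.continuousOn_fderiv_of_isOpen isOpen_domain (by simp)) hz) ?_
      exact (continuous_const.prodMk ((contDiff_field σ).continuous.comp
        (continuous_id.prodMk continuous_const))).continuousAt
  · filter_upwards [eventually_mem_domain hz] with ε hε
    have he : partialField (rotoRate σ) k ε =ᶠ[𝓝 z]
        (fun z => exactRotoRate σ (ε, z)) + (-(ε ^ (k + 1))) • fun z => ρ (ε, z) := by
      filter_upwards [eventually_mem_domain_slice hε] with w hw
      rw [Pi.add_apply, Pi.smul_apply, exactRotoRate_eq_partialField hσ k hw]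
      simp [hρ]
    have hR := (hasFDerivAt_slice (differentiableAt_of_domain (contDiffOn_exactRotoRate hσ)
      hε)).differentiableAt
    have hρd := differentiableAt_of_domain hρs hε
    have hρ' := (hasFDerivAt_slice hρd).differentiableAt
    have h1 : VectorField.lieBracket ℝ (partialField (rotoRate σ) k ε) (field σ ε) z =
        VectorField.lieBracket ℝ ((fun z => exactRotoRate σ (ε, z)) +
          (-(ε ^ (k + 1))) • fun z => ρ (ε, z)) (field σ ε) z := by
      simp only [VectorField.lieBracket, he.fderiv_eq, he.eq_of_nhds]
    rw [h1, VectorField.lieBracket_add_left hR (hρ'.const_smul _),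
      lieBracket_exactRotoRate hσ hε, VectorField.lieBracket_const_smul_left hρ',
      VectorField.lieBracket, fderiv_slice hρd, zero_add, zero_add, neg_smul, smul_neg]

theorem isRotoRate_rotoRate (hσ : σ ^ 2 = 1) : IsRotoRate σ (rotoRate σ) where
  smooth := contDiffOn_rotoRate hσ
  periodic_x k _ hz := rotoRate_add_x hσ _ k hz
  commutes k _ hz := lieBracket_partialField_rotoRate hσ k hz
  periodic _ hc := periodic_of_formalIntegralCurve hσ hc
  limit _ hz := rotoRate_zero hz

/-- Truncation of the exact identity `omega_exactRotoRate`: on either side the remainder is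
`ε^(k+1)` times a function continuous at `ε = 0`. -/
theorem isHamiltonianSeries_actionSeries (hσ : σ ^ 2 = 1) :
    IsHamiltonianSeries σ (rotoRate σ) (actionSeries σ) := by
  refine ⟨contDiffOn_actionSeries hσ, fun k z hz w => ?_⟩
  set ρ := hadamard^[k + 1] (exactRotoRate σ) with hρ
  set η := hadamard^[k + 1] (smoothAction σ) with hη
  have hρs : ContDiffOn ℝ ∞ ρ domain :=
    contDiffOn_iterate_hadamard isOpen_domain starInFst_domain (contDiffOn_exactRotoRate hσ) (k + 1)
  have hηs : ContDiffOn ℝ ∞ η domain :=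
    contDiffOn_iterate_hadamard isOpen_domain starInFst_domain (contDiffOn_smoothAction hσ) (k + 1)
  refine EqMod.of_smul (r := fun ε => fderiv ℝ η (ε, z) (0, w) - omega σ ε z (ρ (ε, z)) w) ?_ ?_
  · refine ContinuousAt.sub (ContinuousAt.clm_apply (continuousAt_slice
      (hηs.continuousOn_fderiv_of_isOpen isOpen_domain (by simp)) hz) continuousAt_const) ?_
    have h1 := continuousAt_slice hρs.continuousOn hz
    have h2 : ∀ i, ContinuousAt (fun ε => ρ (ε, z) i) 0 := fun i =>
      (continuous_apply i).continuousAt.comp h1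
    simp only [omega_eq]
    have h3 : ∀ f₀ f₁ f₂ f₃ : ℝ → ℝ, ContinuousAt f₀ 0 → ContinuousAt f₁ 0 → ContinuousAt f₂ 0 →
        ContinuousAt f₃ 0 → ContinuousAt (fun ε => -(ε * (f₂ ε * w 0 - w 2 * f₀ ε +
          (f₃ ε * w 1 - w 3 * f₁ ε)) - σ * (1 + z 1) * (f₁ ε * w 0 - w 1 * f₀ ε))) 0 := by
      intro f₀ f₁ f₂ f₃ _ _ _ _
      fun_prop
    exact h3 _ _ _ _ (h2 0) (h2 1) (h2 2) (h2 3)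
  · filter_upwards [eventually_mem_domain hz] with ε hε
    have h1 : omega σ ε z (exactRotoRate σ (ε, z)) w =
        omega σ ε z (partialField (rotoRate σ) k ε z) w +
          ε ^ (k + 1) * omega σ ε z (ρ (ε, z)) w := by
      rw [exactRotoRate_eq_partialField hσ k hε]
      simp only [omega_eq, Pi.add_apply, Pi.smul_apply, smul_eq_mul, ← hρ]
      ring
    have h2 := omega_exactRotoRate hσ hε w
    have hJ : (fun z => smoothAction σ (ε, z)) =ᶠ[𝓝 z]
        fun z => partialSum (fun i => actionSeries σ i z) k ε + ε ^ (k + 1) * η (ε, z) := by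
      filter_upwards [eventually_mem_domain_slice hε] with v hv
      exact smoothAction_eq_partialSum hσ k hv
    have hμ : ∀ i, HasFDerivAt (actionSeries σ i) (fderiv ℝ (actionSeries σ i) z) z := fun i =>
      (((contDiffOn_actionSeries hσ i).contDiffAt (isOpen_region.mem_nhds hz)).differentiableAt
        (by simp)).hasFDerivAt
    have hηd := differentiableAt_of_domain hηs hε
    have hsum : HasFDerivAt (fun z => partialSum (fun i => actionSeries σ i z) k ε)
        (∑ i ∈ Finset.range (k + 1), ε ^ i • fderiv ℝ (actionSeries σ i) z) z := by
      unfold partialSum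
      exact HasFDerivAt.fun_sum fun i _ => (hμ i).const_smul (ε ^ i)
    have h3 : fderiv ℝ (smoothAction σ) (ε, z) (0, w) =
        partialSum (fun i => fderiv ℝ (actionSeries σ i) z w) k ε +
          ε ^ (k + 1) * fderiv ℝ η (ε, z) (0, w) := by
      rw [← fderiv_slice (differentiableAt_of_domain (contDiffOn_smoothAction hσ) hε),
        hJ.fderiv_eq, (hsum.fun_add ((hasFDerivAt_slice hηd).const_mul (ε ^ (k + 1)))).fderiv]
      simp [partialSum]
    rw [smul_eq_mul]
    linear_combination h2 - h1 + h3

end Kruskal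

/-! ### Constants of motion, invariant tori and the cyclotron cycle -/

section ConstantsOfMotion

variable {σ ε : ℝ}

theorem eq_of_hasDerivWithinAt_zero {f : ℝ → ℝ} {s : Set ℝ} (hs : s.OrdConnected)
    (hf : ∀ t ∈ s, HasDerivWithinAt f 0 s t) {t₁ t₂ : ℝ} (h₁ : t₁ ∈ s) (h₂ : t₂ ∈ s) :
    f t₁ = f t₂ := by
  have := hs.convex.norm_image_sub_le_of_norm_hasDerivWithin_le (C := 0) hf (by simp) h₂ h₁
  simpa [sub_eq_zero] using this

theorem IsMotionOn.speed_eq {γ : ℝ → Phase} {s : Set ℝ} (hγ : IsMotionOn σ ε γ s)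
    (hs : s.OrdConnected) {t₁ t₂ : ℝ} (h₁ : t₁ ∈ s) (h₂ : t₂ ∈ s) :
    speed (γ t₁) = speed (γ t₂) := by
  have : γ t₁ 2 ^ 2 + γ t₁ 3 ^ 2 = γ t₂ 2 ^ 2 + γ t₂ 3 ^ 2 := by
    refine eq_of_hasDerivWithinAt_zero (f := fun t => γ t 2 ^ 2 + γ t 3 ^ 2) hs
      (fun t ht => ?_) h₁ h₂
    have h := hasDerivWithinAt_pi.1 (hγ t ht)
    refine (((h 2).pow 2).add ((h 3).pow 2)).congr_deriv ?_
    rw [field_two, field_three]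
    push_cast
    ring
  rw [speed, speed, this]

theorem IsMotionOn.centerY_eq {γ : ℝ → Phase} {s : Set ℝ} (hγ : IsMotionOn σ ε γ s)
    (hs : s.OrdConnected) {t₁ t₂ : ℝ} (h₁ : t₁ ∈ s) (h₂ : t₂ ∈ s) :
    centerY σ ε (γ t₁) = centerY σ ε (γ t₂) := by
  have : momentum σ ε (γ t₁) = momentum σ ε (γ t₂) := by
    refine eq_of_hasDerivWithinAt_zero (f := fun t => momentum σ ε (γ t)) hs
      (fun t ht => ?_) h₁ h₂
    have h := hasDerivWithinAt_pi.1 (hγ t ht)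
    refine (((h 2).const_mul ε).sub
      (((h 1).add (((h 1).pow 2).div_const 2)).const_mul σ)).congr_deriv ?_
    rw [field_one, field_two]
    push_cast
    ring
  rw [centerY, centerY, this]

theorem one_add_two_mul_centerY (hσ : σ ^ 2 = 1) (z : Phase) :
    1 + 2 * centerY σ ε z = (1 + z 1) ^ 2 - 2 * σ * ε * z 2 := by
  have h0 : σ ≠ 0 := by rintro rfl; norm_num at hσ
  unfold centerY momentum
  field_simp
  linear_combination (2 * ε * z 2) * hσ

theorem abs_eq_one_of_sq (hσ : σ ^ 2 = 1) : |σ| = 1 := by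
  rcases mul_self_eq_one_iff.1 ((sq σ).symm.trans hσ) with rfl | rfl <;> simp

theorem abs_two_mul_le (hσ : σ ^ 2 = 1) {v r : ℝ} (hε : 0 ≤ ε) (hv : |v| ≤ r) :
    |2 * σ * ε * v| ≤ 2 * ε * r := by
  rw [abs_mul, abs_mul, abs_mul, abs_eq_one_of_sq hσ, abs_of_nonneg hε]
  norm_num
  gcongr

theorem abs_le_speed (z : Phase) : |z 2| ≤ speed z :=
  Real.abs_le_sqrt (by nlinarith [sq_nonneg (z 3)])

/-- To leave the region, `y` would have to take the value `-1`. There conservation of `Y` reads `1 +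
2Y = -2σε v_x ≤ 2εr`, contrary to `hrY`. -/
theorem IsMotionOn.mem_levelSet (hσ : σ ^ 2 = 1) {r Y : ℝ} (hε : 0 < ε)
    (hrY : 2 * ε * r < 1 + 2 * Y) {γ : ℝ → Phase} {s : Set ℝ} (hγ : IsMotionOn σ ε γ s)
    (hs : s.OrdConnected) {t₀ t : ℝ} (h₀ : t₀ ∈ s) (h : γ t₀ ∈ levelSet σ ε r Y) (ht : t ∈ s) :
    γ t ∈ levelSet σ ε r Y := by
  obtain ⟨hreg, hr, hY⟩ := h
  have hr' : ∀ τ ∈ s, speed (γ τ) = r := fun τ hτ => (hγ.speed_eq hs hτ h₀).trans hr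
  have hY' : ∀ τ ∈ s, centerY σ ε (γ τ) = Y := fun τ hτ => (hγ.centerY_eq hs hτ h₀).trans hY
  refine ⟨?_, hr' t ht, hY' t ht⟩
  by_contra hneg
  have h1 : γ t 1 ≤ -1 := not_lt.1 hneg
  have h2 : -1 < γ t₀ 1 := hreg
  have hsub : uIcc t t₀ ⊆ s := hs.uIcc_subset ht h₀
  have hcont : ContinuousOn (fun τ => γ τ 1) (uIcc t t₀) := fun τ hτ =>
    ((hasDerivWithinAt_pi.1 (hγ τ (hsub hτ)) 1).continuousWithinAt).mono hsub
  obtain ⟨τ, hτ, hy⟩ := intermediate_value_uIcc hcont (mem_uIcc.2 (Or.inl ⟨h1, h2.le⟩))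
  have h3 := one_add_two_mul_centerY (ε := ε) hσ (γ τ)
  rw [hY' τ (hsub hτ)] at h3
  have h4 := (abs_le.1 (abs_two_mul_le hσ hε.le
    ((abs_le_speed (γ τ)).trans_eq (hr' τ (hsub hτ))))).1
  have hy' : γ τ 1 = -1 := hy
  rw [hy'] at h3
  linarith

theorem exists_angle (a b : ℝ) : ∃ θ, a = √(a ^ 2 + b ^ 2) * Real.cos θ ∧
    b = √(a ^ 2 + b ^ 2) * Real.sin θ := by
  have h : ‖(⟨a, b⟩ : ℂ)‖ = √(a ^ 2 + b ^ 2) := by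
    rw [Complex.norm_def, Complex.normSq_mk, sq, sq]
  refine ⟨Complex.arg ⟨a, b⟩, ?_, ?_⟩ <;> rw [← h]
  · rw [Complex.norm_mul_cos_arg]
  · rw [Complex.norm_mul_sin_arg]

theorem sqrt_mul_sqrt_one_add {m : ℝ} (hm : 0 < m) (x c : ℝ) :
    √m * √(1 + x / m * c) = √(m + x * c) := by
  rw [← Real.sqrt_mul hm.le]
  congr 1
  field_simp

theorem torus_eq {r Y : ℝ} (hY : 0 < 1 + 2 * Y) (x ζ : ℝ) :
    torus σ ε r Y x ζ = ![x, -1 + √(1 + 2 * Y + 2 * σ * ε * r * Real.cos ζ),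
      r * Real.cos ζ, -(r * Real.sin ζ)] := by
  rw [torus, sqrt_mul_sqrt_one_add hY]

theorem torus_gap_pos (hσ : σ ^ 2 = 1) {r Y : ℝ} (hε : 0 < ε) (hr : 0 < r)
    (hrY : 2 * ε * r < 1 + 2 * Y) (ζ : ℝ) : 0 < 1 + 2 * Y + 2 * σ * ε * r * Real.cos ζ := by
  have h : |r * Real.cos ζ| ≤ r := by
    rw [abs_mul, abs_of_pos hr]
    exact mul_le_of_le_one_right hr.le (Real.abs_cos_le_one ζ)
  have := (abs_le.1 (abs_two_mul_le hσ hε.le h)).1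
  linarith

theorem levelSet_eq_range_torus (hσ : σ ^ 2 = 1) {r Y : ℝ} (hε : 0 < ε) (hr : 0 < r)
    (hrY : 2 * ε * r < 1 + 2 * Y) :
    levelSet σ ε r Y = range (fun p : ℝ × ℝ => torus σ ε r Y p.1 p.2) := by
  have hY : 0 < 1 + 2 * Y := (by positivity : 0 < 2 * ε * r).trans hrY
  ext z
  constructor
  · rintro ⟨hreg, hr', hY'⟩
    obtain ⟨θ, hc, hs⟩ := exists_angle (z 2) (z 3)
    rw [← speed, hr'] at hc hs
    -- On the torus `v_y = -r sin ζ`, so `ζ` is minus the polar angle of the velocity.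
    refine ⟨(z 0, -θ), ?_⟩
    have h1 := one_add_two_mul_centerY (ε := ε) hσ z
    rw [hY'] at h1
    have hpos : 0 ≤ 1 + z 1 := by
      have : -1 < z 1 := hreg
      linarith
    have h2 : 1 + 2 * Y + 2 * σ * ε * r * Real.cos θ = (1 + z 1) ^ 2 := by
      rw [h1, hc]
      ring
    ext i
    simp only [torus_eq hY, Real.cos_neg, h2, Real.sqrt_sq hpos, Real.sin_neg]
    fin_cases i
    · rfl
    · simp
    · exact hc.symm
    · simpa using hs.symm
  · rintro ⟨⟨x, ζ⟩, rfl⟩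
    have hpos := torus_gap_pos hσ hε hr hrY ζ
    have hr' : speed (torus σ ε r Y x ζ) = r := by
      have : (r * Real.cos ζ) ^ 2 + (-(r * Real.sin ζ)) ^ 2 = r ^ 2 := by
        linear_combination r ^ 2 * Real.sin_sq_add_cos_sq ζ
      simp only [speed, torus_eq hY]
      simp only [Matrix.cons_val]
      rw [this, Real.sqrt_sq hr.le]
    refine ⟨?_, hr', ?_⟩
    · change -1 < torus σ ε r Y x ζ 1
      simpa [torus_eq hY] using hpos
    · have h1 := one_add_two_mul_centerY (ε := ε) hσ (torus σ ε r Y x ζ)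
      simp only [torus_eq hY] at h1 ⊢
      simp only [Matrix.cons_val] at h1
      rw [add_neg_cancel_left, Real.sq_sqrt hpos.le] at h1
      linarith

theorem action_eq {r Y : ℝ} (hY : 0 < 1 + 2 * Y) :
    action σ ε r Y = ε * σ * ((2 * Real.pi)⁻¹ * ∫ ζ in (0 : ℝ)..(2 * Real.pi),
      r * Real.cos ζ * √(1 + 2 * Y + 2 * σ * ε * r * Real.cos ζ)) := by
  have : ∀ ζ, r * Real.cos ζ * √(1 + 2 * Y + 2 * σ * ε * r * Real.cos ζ) =
      (r * √(1 + 2 * Y)) * (√(1 + 2 * σ * ε * r / (1 + 2 * Y) * Real.cos ζ) * Real.cos ζ) := by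
    intro ζ
    rw [← sqrt_mul_sqrt_one_add hY]
    ring
  simp only [this, intervalIntegral.integral_const_mul, action]
  ring

theorem cos_mul_of_sq_eq_one (hσ : σ ^ 2 = 1) (t : ℝ) : Real.cos (σ * t) = Real.cos t := by
  rcases mul_self_eq_one_iff.1 ((sq σ).symm.trans hσ) with rfl | rfl <;> simp

theorem sin_mul_of_sq_eq_one (hσ : σ ^ 2 = 1) (t : ℝ) : Real.sin (σ * t) = σ * Real.sin t := by
  rcases mul_self_eq_one_iff.1 ((sq σ).symm.trans hσ) with rfl | rfl <;> simp

/-- The action variable is the action of the cyclotron cycle. -/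
theorem action_eq_loopAction_cycle (hσ : σ ^ 2 = 1) {r Y : ℝ} (hε : 0 < ε) (hr : 0 < r)
    (hrY : 2 * ε * r < 1 + 2 * Y) : action σ ε r Y = loopAction σ ε (cycle σ ε r Y) := by
  have hY : 0 < 1 + 2 * Y := (by positivity : 0 < 2 * ε * r).trans hrY
  have hpos := torus_gap_pos hσ hε hr hrY
  set S : ℝ → ℝ := fun t => √(1 + 2 * Y + 2 * σ * ε * r * Real.cos t) with hS
  set S' : ℝ → ℝ := fun t => 2 * σ * ε * r * -Real.sin t / (2 * S t) with hS'
  have hcyc : cycle σ ε r Y = fun t => ![0, -1 + S t, r * Real.cos t, -(r * (σ * Real.sin t))] := by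
    funext t
    rw [cycle, torus_eq hY, cos_mul_of_sq_eq_one hσ, sin_mul_of_sq_eq_one hσ]
  have hSd : ∀ t, HasDerivAt S (S' t) t := fun t =>
    (((Real.hasDerivAt_cos t).const_mul _).const_add _).sqrt (hpos t).ne'
  have hSc : Continuous S := continuous_iff_continuousAt.2 fun t => (hSd t).continuousAt
  have hSc' : Continuous S' := by
    refine Continuous.div (by fun_prop) (by fun_prop) fun t => ?_
    exact (mul_pos two_pos (Real.sqrt_pos.2 (hpos t))).ne'
  have hd : ∀ t, HasDerivAt (cycle σ ε r Y)
      ![0, S' t, r * -Real.sin t, -(r * (σ * Real.cos t))] t := by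
    intro t
    rw [hcyc, hasDerivAt_pi]
    intro i
    fin_cases i
    · exact hasDerivAt_const t 0
    · exact (hSd t).const_add (-1)
    · exact (Real.hasDerivAt_cos t).const_mul r
    · exact (((Real.hasDerivAt_sin t).const_mul σ).const_mul r).neg
  have hl : ∀ t, liouville σ ε (cycle σ ε r Y t) (deriv (cycle σ ε r Y) t) =
      (-(ε * σ * r)) * (Real.sin t * S' t) := by
    intro t
    rw [(hd t).deriv, hcyc, liouville]
    simp only [Matrix.cons_val]
    ring
  -- On the cycle `x` is constant, so only `ε v_y dy` contributes; integration by parts has no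
  -- boundary terms, since the sine vanishes at both ends.
  have hparts := intervalIntegral.integral_mul_deriv_eq_deriv_mul (a := 0) (b := 2 * Real.pi)
    (fun t _ => Real.hasDerivAt_sin t) (fun t _ => hSd t)
    (Real.continuous_cos.intervalIntegrable _ _) (hSc'.intervalIntegrable _ _)
  rw [action_eq hY, loopAction]
  simp only [hl, intervalIntegral.integral_const_mul, hparts, mul_assoc r]
  simp
  ring

end ConstantsOfMotion

/-! ### Convergence of the power series in `ε` -/

section PowerSeries

variable {σ ε : ℝ} {z : Phase}

theorem intervalIntegral_comp_sub_of_periodic {f : ℝ → ℝ} {T : ℝ} (hf : Function.Periodic f T)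
    (θ : ℝ) : ∫ s in (0 : ℝ)..T, f (s - θ) = ∫ s in (0 : ℝ)..T, f s := by
  rw [intervalIntegral.integral_comp_sub_right]
  have := hf.intervalIntegral_add_eq (0 - θ) 0
  rwa [zero_add, zero_sub, add_comm, ← sub_eq_add_neg, ← zero_sub] at this

/-- The action variable on phase space, where it is smooth in `(ε, z)`. -/
theorem actionAt_eq_smoothAction (hσ : σ ^ 2 = 1) (hp : (ε, z) ∈ domain) :
    actionAt σ ε z = smoothAction σ (ε, z) := by
  obtain ⟨θ, hc, hs⟩ := exists_angle (z 2) (z 3)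
  rw [← speed] at hc hs
  have hY := one_add_two_mul_centerY (ε := ε) hσ z
  have hvel : ∀ s, vel z s = speed z * Real.cos (s - θ) := by
    intro s
    rw [vel, Real.cos_sub, mul_add]
    nth_rw 1 [hc]
    nth_rw 1 [hs]
    ring
  have hgap : ∀ s, gap σ (ε, z) s =
      1 + 2 * centerY σ ε z + 2 * σ * ε * speed z * Real.cos (s - θ) := by
    intro s
    rw [gap, hvel, hY]
    ring
  have hpos : 0 < 1 + 2 * centerY σ ε z := by
    -- At this angle the cosine vanishes and `Q` equals `1 + 2Y`.
    have h := gap_pos hσ hp (Real.pi / 2 + θ)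
    rwa [hgap, add_sub_cancel_right, Real.cos_pi_div_two, mul_zero, add_zero] at h
  have hper : Function.Periodic (fun ζ => speed z * Real.cos ζ *
      √(1 + 2 * centerY σ ε z + 2 * σ * ε * speed z * Real.cos ζ)) (2 * Real.pi) := fun ζ => by
    simp only [Real.cos_add_two_pi]
  rw [actionAt, action_eq hpos, ← intervalIntegral_comp_sub_of_periodic hper θ, smoothAction, mean]
  simp only [velField, orbitPoint, hvel, hgap, one_mul]

/-- The coefficient of `ε` in the relative change of `Q` along a torus. -/
noncomputable def gapRatio (σ : ℝ) (z : Phase) (s : ℝ) : ℝ :=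
  2 * σ * (vel z s - z 2) / (1 + z 1) ^ 2

theorem abs_vel_le (z : Phase) (s : ℝ) : |vel z s| ≤ speed z :=
  Real.abs_le_sqrt (by nlinarith [vel_sq_add_velPerp_sq z s, sq_nonneg (velPerp z s)])

/-- The strict bound `gap_bound` at each angle becomes uniform because a continuous periodic
function attains its maximum. -/
theorem exists_abs_gapRatio_le (hσ : σ ^ 2 = 1) (hp : (ε, z) ∈ domain) :
    ∃ q : ℝ, 0 ≤ q ∧ q < 1 ∧ ∀ s, |ε * gapRatio σ z s| ≤ q := by
  have ha : 0 < 1 + z 1 := one_add_pos hp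
  have hcont : Continuous (fun s => |ε * gapRatio σ z s|) := by
    unfold gapRatio vel
    fun_prop
  have hper : Function.Periodic (fun s => |ε * gapRatio σ z s|) (2 * Real.pi) := fun s => by
    simp [gapRatio, vel]
  obtain ⟨s₀, -, hs₀⟩ := isCompact_Icc.exists_isMaxOn
    (nonempty_Icc.2 Real.two_pi_pos.le) hcont.continuousOn
  refine ⟨|ε * gapRatio σ z s₀|, abs_nonneg _, ?_, fun s => ?_⟩
  · have h := gap_bound hσ hp s₀
    have : ε * gapRatio σ z s₀ = 2 * σ * ε * (vel z s₀ - z 2) / (1 + z 1) ^ 2 := by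
      unfold gapRatio
      ring
    rw [this, abs_div, abs_of_pos (pow_pos ha 2), div_lt_one (pow_pos ha 2)]
    exact h
  · obtain ⟨y, hy, hys⟩ := hper.exists_mem_Ico₀ Real.two_pi_pos s
    rw [hys]
    exact hs₀ (Ico_subset_Icc_self hy)

theorem mem_ball_binomial {u : ℝ} (hu : |u| < 1) : u ∈ Metric.eball (0 : ℝ) 1 := by
  have : Metric.eball (0 : ℝ) 1 = Metric.ball 0 1 := by
    rw [← ENNReal.ofReal_one, Metric.eball_ofReal]
  rw [this]
  simpa using hu

theorem hasSum_sqrt_one_add {u : ℝ} (hu : |u| < 1) :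
    HasSum (fun k : ℕ => Ring.choose (1 / 2 : ℝ) k * u ^ k) (√(1 + u)) := by
  have := (Real.one_add_rpow_hasFPowerSeriesOnBall_zero (a := 1 / 2)).hasSum (mem_ball_binomial hu)
  rw [zero_add, ← Real.sqrt_eq_rpow] at this
  simpa [binomialSeries, FormalMultilinearSeries.coeff_ofScalars, mul_comm] using this

theorem summable_abs_choose {q : ℝ} (hq : 0 ≤ q) (hq1 : q < 1) :
    Summable (fun k : ℕ => |Ring.choose (1 / 2 : ℝ) k| * q ^ k) := by
  have hu : |q| < 1 := by rwa [abs_of_nonneg hq]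
  refine ((hasSum_sqrt_one_add hu).summable.abs).congr fun k => ?_
  rw [abs_mul, abs_of_nonneg (pow_nonneg hq k)]

/-- The coefficients of the power series of the action variable in `ε`, divided by `ε`. -/
noncomputable def actionCoeff (σ : ℝ) (z : Phase) (k : ℕ) : ℝ :=
  σ * ((2 * Real.pi)⁻¹ * ∫ s in (0 : ℝ)..(2 * Real.pi),
    vel z s * (1 + z 1) * (Ring.choose (1 / 2 : ℝ) k * gapRatio σ z s ^ k))

/-- The binomial series of `√(1 + ε g)`, with `g` the `gapRatio`, is integrated term by term,
dominated by a summable series since `|ε g| ≤ q < 1`. -/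
theorem hasSum_actionCoeff (hσ : σ ^ 2 = 1) (hp : (ε, z) ∈ domain) :
    HasSum (fun k : ℕ => ε ^ k * actionCoeff σ z k) (σ * mean σ (fun _ => 1) velField (ε, z)) := by
  have ha : 0 < 1 + z 1 := one_add_pos hp
  obtain ⟨q, hq, hq1, hx⟩ := exists_abs_gapRatio_le hσ hp
  have hsqrt : ∀ s, √(gap σ (ε, z) s) = (1 + z 1) * √(1 + ε * gapRatio σ z s) := by
    intro s
    have : gap σ (ε, z) s = (1 + z 1) ^ 2 * (1 + ε * gapRatio σ z s) := by
      unfold gap gapRatio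
      field_simp
    rw [this, Real.sqrt_mul (by positivity), Real.sqrt_sq ha.le]
  have hsum := summable_abs_choose hq hq1
  have key := intervalIntegral.hasSum_integral_of_dominated_convergence (μ := volume)
    (a := 0) (b := 2 * Real.pi)
    (F := fun (k : ℕ) s => vel z s * (1 + z 1) *
      (Ring.choose (1 / 2 : ℝ) k * (ε * gapRatio σ z s) ^ k))
    (f := fun s => vel z s * (1 + z 1) * √(1 + ε * gapRatio σ z s))
    (fun k _ => speed z * (1 + z 1) * (|Ring.choose (1 / 2 : ℝ) k| * q ^ k))
    (fun k => by
      refine Continuous.aestronglyMeasurable ?_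
      unfold gapRatio vel
      fun_prop)
    (fun k => Eventually.of_forall fun s _ => by
      rw [Real.norm_eq_abs, abs_mul, abs_mul, abs_mul, abs_pow, abs_of_pos ha]
      have := abs_vel_le z s
      have := hx s
      have := Real.sqrt_nonneg (z 2 ^ 2 + z 3 ^ 2)
      unfold speed at *
      gcongr)
    (Eventually.of_forall fun s _ => hsum.mul_left _)
    intervalIntegrable_const
    (Eventually.of_forall fun s _ => (hasSum_sqrt_one_add ((hx s).trans_lt hq1)).mul_left _)
  have h := key.mul_left (σ * (2 * Real.pi)⁻¹)
  convert! h using 1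
  · funext k
    simp only [actionCoeff, mul_pow]
    have : ∀ s, vel z s * (1 + z 1) * (Ring.choose (1 / 2 : ℝ) k * (ε ^ k * gapRatio σ z s ^ k)) =
        ε ^ k * (vel z s * (1 + z 1) * (Ring.choose (1 / 2 : ℝ) k * gapRatio σ z s ^ k)) :=
      fun s => by ring
    simp only [this, intervalIntegral.integral_const_mul]
    ring
  · simp only [mean, velField, orbitPoint, hsqrt, one_mul, mul_assoc]

theorem eqMod_of_hasSum {b : ℕ → ℝ} {f : ℝ → ℝ}
    (h : ∀ᶠ ε in 𝓝 (0 : ℝ), HasSum (fun k : ℕ => ε ^ k * b k) (f ε)) (k : ℕ) :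
    EqMod (k + 1) f (partialSum b k) := by
  have hps : HasFPowerSeriesAt f (FormalMultilinearSeries.ofScalars ℝ b) 0 := by
    rw [hasFPowerSeriesAt_iff]
    filter_upwards [h] with ε hε
    simpa [FormalMultilinearSeries.coeff_ofScalars] using hε
  have := hps.isBigO_sub_partialSum_pow (k + 1)
  simp only [zero_add] at this
  refine (this.congr_left fun ε => ?_).trans (isBigO_of_le _ fun ε => by simp)
  simp [FormalMultilinearSeries.partialSum, Slab.partialSum, mul_comm]

/-- The power series of the action variable in `ε`. -/
theorem hasSum_smoothAction (hσ : σ ^ 2 = 1) (hp : (ε, z) ∈ domain) :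
    HasSum (fun k : ℕ => ε ^ k * actionSeries σ k z) (smoothAction σ (ε, z)) := by
  -- The prefactor `ε` of the action shifts the coefficients by one and leaves no constant term.
  let b : ℕ → ℝ := fun k => Nat.casesOn k 0 (actionCoeff σ z)
  have hb : ∀ ε', (ε', z) ∈ domain →
      HasSum (fun k : ℕ => ε' ^ k * b k) (smoothAction σ (ε', z)) := by
    intro ε' hp'
    have h := (hasSum_actionCoeff hσ hp').mul_left ε'
    rw [← hasSum_nat_add_iff' 1]
    convert! h using 1
    · funext k
      simp only [b, pow_succ]
      ring
    · simp [b, smoothAction, mul_assoc]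
  have hz : z ∈ region := hp.1
  have h1 := eqMod_of_hasSum ((eventually_mem_domain hz).mono hb)
  -- A convergent power series is also an asymptotic expansion, and the coefficients of the latter
  -- are unique.
  have h2 : ∀ k, actionSeries σ k z = b k := fun k =>
    eq_of_eqMod_partialSum (a := fun i => actionSeries σ i z) (b := b)
      ((eqMod_smoothAction hσ hz k).symm.trans (h1 k)) k le_rfl
  simpa only [h2] using hb ε hp

theorem exists_hasSum_actionAt (hσ : σ ^ 2 = 1) {K : Set Phase} (hK : IsCompact K)
    (hKr : K ⊆ region) : ∃ ρ : ℝ, 0 < ρ ∧ ∀ z ∈ K, ∀ ε : ℝ, |ε| < ρ →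
      HasSum (fun k : ℕ => ε ^ k * actionSeries σ k z) (actionAt σ ε z) := by
  have h : ∀ᶠ ε in 𝓝 (0 : ℝ), ∀ z ∈ K, (ε, z) ∈ domain :=
    hK.eventually_forall_of_forall_eventually fun z hz =>
      isOpen_domain.mem_nhds (zero_mem_domain (hKr hz))
  obtain ⟨ρ, hρ, h⟩ := Metric.eventually_nhds_iff.1 h
  refine ⟨ρ, hρ, fun z hz ε hε => ?_⟩
  have hp := h (by simpa using hε) z hz
  rw [actionAt_eq_smoothAction hσ hp]
  exact hasSum_smoothAction hσ hp

end PowerSeries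

/-! ### Transfer to an arbitrary roto-rate and Kruskal series -/

theorem IsHamiltonianSeries.congr {σ : ℝ} {R R' : ℕ → Phase → Phase} {μ μ' : ℕ → Phase → ℝ}
    (h : IsHamiltonianSeries σ R μ) (hR : ∀ k, ∀ z ∈ region, R' k z = R k z)
    (hμ : ∀ k, ∀ z ∈ region, μ' k z = μ k z) : IsHamiltonianSeries σ R' μ' := by
  refine ⟨fun k => (h.1 k).congr (hμ k), fun k z hz w => ?_⟩
  have h1 : ∀ i, fderiv ℝ (μ' i) z = fderiv ℝ (μ i) z := fun i =>
    Filter.EventuallyEq.fderiv_eq (by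
      filter_upwards [isOpen_region.mem_nhds hz] with w hw using hμ i w hw)
  have h2 := h.2 k z hz w
  simp only [h1, partialField_congr fun i _ => hR i z hz]
  exact h2

end Slab

theorem proposition1 (σ : ℝ) (hσ : σ = 1 ∨ σ = -1) :
    -- the level sets are invariant tori, and `J₁` is the action of their cyclotron cycle
    (∀ ε r Y : ℝ, 0 < ε → 0 < r → 2 * ε * r < 1 + 2 * Y →
      Slab.levelSet σ ε r Y
          = Set.range (fun p : ℝ × ℝ => Slab.torus σ ε r Y p.1 p.2) ∧
      (∀ (γ : ℝ → Slab.Phase) (s : Set ℝ), s.OrdConnected → Slab.IsMotionOn σ ε γ s →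
        ∀ t₀ ∈ s, γ t₀ ∈ Slab.levelSet σ ε r Y → ∀ t ∈ s, γ t ∈ Slab.levelSet σ ε r Y) ∧
      Slab.action σ ε r Y = Slab.loopAction σ ε (Slab.cycle σ ε r Y)) ∧
    -- `J₁` is an exact constant of motion
    (∀ ε : ℝ, 0 < ε → ∀ (γ : ℝ → Slab.Phase) (s : Set ℝ), s.OrdConnected →
      Slab.IsMotionOn σ ε γ s →
        ∀ t₁ ∈ s, ∀ t₂ ∈ s, Slab.actionAt σ ε (γ t₁) = Slab.actionAt σ ε (γ t₂)) ∧
    -- the roto-rate and Kruskal's adiabatic invariant series exist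
    (∃ (R : ℕ → Slab.Phase → Slab.Phase) (μ : ℕ → Slab.Phase → ℝ),
      Slab.IsRotoRate σ R ∧ Slab.IsKruskalSeries σ R μ) ∧
    -- the roto-rate is unique, Kruskal's series is its Hamiltonian, and the power series of `J₁`
    -- in `ε` is Kruskal's series
    (∀ (R : ℕ → Slab.Phase → Slab.Phase) (μ : ℕ → Slab.Phase → ℝ),
      Slab.IsRotoRate σ R → Slab.IsKruskalSeries σ R μ →
        (∀ R', Slab.IsRotoRate σ R' → ∀ k, ∀ z ∈ Slab.region, R' k z = R k z) ∧
        Slab.IsHamiltonianSeries σ R μ ∧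
        ∀ K : Set Slab.Phase, IsCompact K → K ⊆ Slab.region →
          ∃ ρ : ℝ, 0 < ρ ∧ ∀ z ∈ K, ∀ ε : ℝ, |ε| < ρ →
            HasSum (fun k : ℕ => ε ^ k * μ k z) (Slab.actionAt σ ε z)) := by
  have hσ2 : σ ^ 2 = 1 := by rcases hσ with rfl | rfl <;> norm_num
  refine ⟨fun ε r Y hε hr hrY => ⟨Slab.levelSet_eq_range_torus hσ2 hε hr hrY,
    fun γ s hs hγ t₀ h₀ h t ht => hγ.mem_levelSet hσ2 hε hrY hs h₀ h ht,
    Slab.action_eq_loopAction_cycle hσ2 hε hr hrY⟩, fun ε _ γ s hs hγ t₁ h₁ t₂ h₂ => ?_,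
    ⟨_, _, Slab.isRotoRate_rotoRate hσ2, Slab.isKruskalSeries_actionSeries hσ2⟩,
    fun R μ hR hμ => ?_⟩
  · rw [Slab.actionAt, Slab.actionAt, hγ.speed_eq hs h₁ h₂, hγ.centerY_eq hs h₁ h₂]
  · have hR' := fun R' (h : Slab.IsRotoRate σ R') => Slab.IsRotoRate.unique hσ2 hR h
    have hRR := Slab.IsRotoRate.unique hσ2 (Slab.isRotoRate_rotoRate hσ2) hR
    -- On the region the given series are now identified with the constructed ones, so the
    -- Hamiltonian property and the convergence carry over.
    have hμμ := Slab.IsKruskalSeries.unique hσ2 (Slab.isRotoRate_rotoRate hσ2) hRR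
      (Slab.isKruskalSeries_actionSeries hσ2) hμ
    refine ⟨hR', (Slab.isHamiltonianSeries_actionSeries hσ2).congr hRR hμμ,
      fun K hK hKr => ?_⟩
    obtain ⟨ρ, hρ, h⟩ := Slab.exists_hasSum_actionAt hσ2 hK hKr
    refine ⟨ρ, hρ, fun z hz ε hε => ?_⟩
    simpa only [hμμ _ z (hKr hz)] using h z hz ε hε
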